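/- **Setting.** Let $\varepsilon\in\{1,-1\}$ and equip $\mathbb R^3$ with $A\cdot B=A_1B_1+\varepsilon(A_2B_2+A_3B_3)$ (Euclidean space for $\varepsilon=1$, Minkowski space for $\varepsilon=-1$), with its volume form $Vol$ and the cross product determined by $A\cdot(B\times C)=Vol(A,B,C)$. Let $\mathbb K=\mathbb R$ or $\mathbb C$; over $\mathbb C$ all products are extended complex-bilinearly. For a surface with position vector $\vec r$ and unit normal $\vec n$ ($\vec n\cdot\vec n=\pm1$) let $I$, $II=(\vec n\cdot\vec r_{,xx})dx^2+2(\vec n\cdot\vec r_{,xy})dx\,dy+(\vec n\cdot\vec r_{,yy})dy^2$ be its fundamental forms, $K=\det II/\det I$, and let $*$ be the Hodge dual with respect to $II$. (For $\mathbb K=\mathbb C$ the area density $\sqrt{|\det II|}$ in $*$ is replaced by a $C^1$ function $s$ with $s^2=\pm\det II$.) A *Bianchi surface* is a regular surface ($\det I\neq0$) with $K\ne0$ such that $\mathcal N=|K|^{-1/4}\vec n$ satisfies $*d*d\,\mathcal N=\tilde f\mathcal N$ for some scalar function $\tilde f$, and $*d*d(\mathcal N\cdot\mathcal N)=0$; here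 $\vec r,\vec n,K$ are of class $C^2$. Let $2\le k\le\infty$ and let $\vec r:D\to\mathbb R^3$ be the position vector of a Bianchi surface in an arbitrary parametrization, $D\subset\mathbb R^2$ open. Let $\vec N$ be a normal field with $r:=\vec N\cdot\vec N>0$, $\vec n_0=\vec N/\sqrt r$, and let $(\vec n_0,\vec n_1,\vec n_2)$ be an orthonormal frame ($\vec n_0\cdot\vec n_0=1$, $\vec n_1\cdot\vec n_1=\vec n_2\cdot\vec n_2=\varepsilon$) with rotation coefficients $\vec n_{A,x}=p_A{}^B\vec n_B$, $\vec n_{A,y}=q_A{}^B\vec n_B$. Assume that $\vec r,\vec N,\vec n_A$ are of class $C^{k+1}$. Capital indices run over $0,1,2$, the index $\mu$ over $1,2$. **Theorem (Transformations between normal fields of Bianchi surfaces).** 1. There are unique functions $a,b,c$ on $D$ (of class $C^k$) satisfying the Lelieuvre formulae $$\vec r_{,x}=(b\vec N_{,y}+c\vec N_{,x})\times\vec N,\qquad \vec r_{,y}=\vec N\times(a\vec N_{,x}+c\vec N_{,y}).$$ With $\Delta:=ab-c^2$ one has $\Delta\ne0$, $K=1/(r^2\Delta)$, and there is a function $f$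 with $$(a\vec N_{,x}+c\vec N_{,y})_{,x}+(b\vec N_{,y}+c\vec N_{,x})_{,y}=f\vec N .$$ Put $\epsilon:=\operatorname{sgn}\Delta$. In the following let $U\subseteq D$ be open. 2. If $U$ is simply connected, then for every $z_0\in U$ and $\kappa\in\mathbb K$ the system $$\epsilon(r\sqrt{|\Delta|})_{,x}+\tfrac{c}{\sqrt{|\Delta|}}p_{,x}+\tfrac{b}{\sqrt{|\Delta|}}p_{,y}=0,\qquad \epsilon(r\sqrt{|\Delta|})_{,y}-\tfrac{a}{\sqrt{|\Delta|}}p_{,x}-\tfrac{c}{\sqrt{|\Delta|}}p_{,y}=0\tag{1}$$ has a unique solution $p:U\to\mathbb K$ with $p(z_0)=\kappa$, and it is of class $C^k$ (the constant of integration is the spectral parameter). 3. Let $p:U\to\mathbb K$ solve (1), with $p\neq0$ and $p^2+r^2\Delta\ne0$ on $U$. If $U$ is simply connected, then for all $z_0\in U$, $\xi\in\mathbb K^3$ the linear system $$\begin{aligned} x^0_{,x}&=\tfrac{p^2}{p^2+r^2\Delta}\Big\{\big[(\tfrac rp c-1)p_\mu{}^0+\tfrac rp b\,q_\mu{}^0\big]x^\mu+\tfrac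 r{p^2}\big[(c+\tfrac rp\Delta)p_{,x}+b\,p_{,y}\big]x^0\Big\},\\ x^\mu_{,x}&=-x^Ap_A{}^\mu+\tfrac rp(c\,p_0{}^\mu+b\,q_0{}^\mu)x^0,\\ x^0_{,y}&=-\tfrac{p^2}{p^2+r^2\Delta}\Big\{\big[(\tfrac rp c+1)q_\mu{}^0+\tfrac rp a\,p_\mu{}^0\big]x^\mu+\tfrac r{p^2}\big[(c-\tfrac rp\Delta)p_{,y}+a\,p_{,x}\big]x^0\Big\},\\ x^\mu_{,y}&=-x^Aq_A{}^\mu-\tfrac rp(a\,p_0{}^\mu+c\,q_0{}^\mu)x^0 \end{aligned}\tag{2}$$ has a unique solution $(x^0,x^1,x^2):U\to\mathbb K^3$ with value $\xi$ at $z_0$, and it is of class $C^k$. For every solution of (2), the quantity $(x^0)^2\big(1+\tfrac{r^2}{p^2}\Delta\big)+\varepsilon\big[(x^1)^2+(x^2)^2\big]$ is constant on $U$ if $U$ is connected. 4. Let $(x^0,x^1,x^2)$ be a solution of (2) on $U$ with $x^0\ne0$ and $$(x^0)^2\big(1+\tfrac{r^2}{p^2}\Delta\big)+\varepsilon\big[(x^1)^2+(x^2)^2\big]=0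 .$$ Put $\theta:=x^0\sqrt r/p$ and $$\vec N':=\frac p{\sqrt r}\,\frac{x^A}{x^0}\,\vec n_A,\qquad (a',b',c'):=-\tfrac1\Delta(a,b,c),\quad \Delta':=a'b'-c'^2 .$$ Then: (i) $\vec N'$ is of class $C^k$ and is obtained from $\vec N$ by an extended Moutard transformation: $\theta$ satisfies $(a\theta_{,x}+c\theta_{,y})_{,x}+(b\theta_{,y}+c\theta_{,x})_{,y}=f\theta$, and $$(\theta\vec N')_{,x}=\theta^2\big[c(\vec N/\theta)_{,x}+b(\vec N/\theta)_{,y}\big],\qquad(\theta\vec N')_{,y}=-\theta^2\big[a(\vec N/\theta)_{,x}+c(\vec N/\theta)_{,y}\big];$$ (ii) $\vec N\cdot\vec N'=p$ and $\vec N'\cdot\vec N'=-\Delta r$; (iii) $\vec N'$ satisfies the normal field equations of Bianchi surfaces: $(a'\vec N'_{,x}+c'\vec N'_{,y})_{,x}+(b'\vec N'_{,y}+c'\vec N'_{,x})_{,y}=f'\vec N'$ with $f'=\theta\big\{(a'(\tfrac1\theta)_{,x}+c'(\tfrac1\theta)_{,y})_{,x}+(b'(\tfrac1\theta)_{,y}+c'(\tfrac1\theta)_{,x})_{,y}\big\}$,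 and, with $(A',B',C')=(a',b',c')/\sqrt{|\Delta'|}$ and $\rho=(\vec N'\cdot\vec N')\sqrt{|\Delta'|}$, $(A'\rho_{,x}+C'\rho_{,y})_{,x}+(B'\rho_{,y}+C'\rho_{,x})_{,y}=0$; (iv) for every constant vector $\vec c$, the vector $\vec r\,'=\vec r+\vec N\times\vec N'+\vec c$ satisfies the Lelieuvre formulae with $\vec N',a',b',c'$; if $U$ is connected, these are all solutions $\vec r\,'$; (v) on the open set of points of $U$ where $Vol(\vec N',\vec N'_{,x},\vec N'_{,y})\ne0$, $\vec r\,'$ is the position vector of a Bianchi surface with unit normal $\vec n_0'=\vec N'/\sqrt{|\vec N'\cdot\vec N'|}$, and its curvature $K'=\det II'/\det I'$ is $K'=-\epsilon K$. -/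

import Mathlib

namespace Bianchi

/-- Vectors of the three-dimensional ambient space over `𝕜`. For `𝕜 = ℝ` this is the vector space
of `𝔼³` or `𝕄³`, for `𝕜 = ℂ` its complexification. -/
abbrev Vec (𝕜 : Type*) := Fin 3 → 𝕜

section Algebra

variable {𝕜 : Type*} [RCLike 𝕜]

/-- The (complex bilinear, not sesquilinear) scalar product `A₁B₁ + ε (A₂B₂ + A₃B₃)`;
`ε = 1` is the Euclidean and `ε = -1` the Minkowski case. -/
def dot (ε : ℝ) (u v : Vec 𝕜) : 𝕜 := u 0 * v 0 + ε • (u 1 * v 1 + u 2 * v 2)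

/-- The volume form. -/
def vol (u v w : Vec 𝕜) : 𝕜 := Matrix.det (Matrix.of ![u, v, w])

/-- The cross product belonging to `dot ε` and `vol`: `dot ε u (cross ε v w) = vol u v w`
when `ε = ±1`. -/
def cross (ε : ℝ) (u v : Vec 𝕜) : Vec 𝕜 :=
  ![u 1 * v 2 - u 2 * v 1, ε • (u 2 * v 0 - u 0 * v 2), ε • (u 0 * v 1 - u 1 * v 0)]

theorem dot_cross {ε : ℝ} (hε : ε = 1 ∨ ε = -1) (u v w : Vec 𝕜) :
    dot ε u (cross ε v w) = vol u v w := by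
  rcases hε with rfl | rfl <;>
    simp [dot, cross, vol, Matrix.det_fin_three] <;> ring

/-- A real vector, viewed as a vector over `𝕜`. -/
def ofRealVec (𝕜 : Type*) [RCLike 𝕜] (v : Vec ℝ) : Vec 𝕜 := fun i => (v i : 𝕜)

end Algebra

section Derivatives

variable {E : Type*} [NormedAddCommGroup E] [NormedSpace ℝ E]

/-- Partial derivative with respect to the first coordinate `x`. -/
noncomputable def dx (F : ℝ × ℝ → E) (z : ℝ × ℝ) : E := fderiv ℝ F z (1, 0)

/-- Partial derivative with respect to the second coordinate `y`. -/
noncomputable def dy (F : ℝ × ℝ → E) (z : ℝ × ℝ) : E := fderiv ℝ F z (0, 1)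

end Derivatives

section Hodge

variable {𝕜 : Type*} [RCLike 𝕜] {E : Type*} [NormedAddCommGroup E] [NormedSpace ℝ E] [Module 𝕜 E]

/-- Differential of a function; a one-form `P dx + Q dy` is the pair `(P, Q)`. -/
noncomputable def d₀ (u : ℝ × ℝ → E) : (ℝ × ℝ → E) × (ℝ × ℝ → E) := (dx u, dy u)

/-- Exterior derivative of a one-form; a two-form `μ dx ∧ dy` is the function `μ`. -/
noncomputable def d₁ (ω : (ℝ × ℝ → E) × (ℝ × ℝ → E)) : ℝ × ℝ → E :=
  fun z => dx ω.2 z - dy ω.1 z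

/-- Hodge dual of a one-form with respect to the nondegenerate quadratic form
`h = e dx² + 2 f dx dy + g dy²` with area density `s` (that is `s = √|eg - f²|` for a real form):
`*(ω₁ dx + ω₂ dy) = s (h¹ʲ ωⱼ dy - h²ʲ ωⱼ dx)`, where `(hⁱʲ)` is the inverse matrix of `h`. -/
noncomputable def star₁ (e f g s : ℝ × ℝ → 𝕜) (ω : (ℝ × ℝ → E) × (ℝ × ℝ → E)) :
    (ℝ × ℝ → E) × (ℝ × ℝ → E) :=
  (fun z => -(s z • ((-f z / (e z * g z - f z ^ 2)) • ω.1 z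
      + (e z / (e z * g z - f z ^ 2)) • ω.2 z)),
   fun z => s z • ((g z / (e z * g z - f z ^ 2)) • ω.1 z
      + (-f z / (e z * g z - f z ^ 2)) • ω.2 z))

/-- Hodge dual of a two-form with respect to a quadratic form with area density `s`. -/
noncomputable def star₂ (s : ℝ × ℝ → 𝕜) (μ : ℝ × ℝ → E) : ℝ × ℝ → E := fun z => (s z)⁻¹ • μ z

/-- The operator `* d * d` on functions. -/
noncomputable def starDStarD (e f g s : ℝ × ℝ → 𝕜) (u : ℝ × ℝ → E) : ℝ × ℝ → E :=
  star₂ s (d₁ (star₁ e f g s (d₀ u)))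

end Hodge

section Surfaces

variable {𝕜 : Type*} [RCLike 𝕜]

/-- Determinant of the first fundamental form of the parametrized surface `R`. -/
noncomputable def detI (ε : ℝ) (R : ℝ × ℝ → Vec 𝕜) (z : ℝ × ℝ) : 𝕜 :=
  dot ε (dx R z) (dx R z) * dot ε (dy R z) (dy R z) - dot ε (dx R z) (dy R z) ^ 2

/-- The coefficient `e` of the second fundamental form `II = e dx² + 2 f dx dy + g dy²` with respect
to the unit normal field `n`. -/
noncomputable def formE (ε : ℝ) (R n : ℝ × ℝ → Vec 𝕜) (z : ℝ × ℝ) : 𝕜 := dot ε (n z) (dx (dx R) z)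
/-- The coefficient `f` of the second fundamental form. -/
noncomputable def formF (ε : ℝ) (R n : ℝ × ℝ → Vec 𝕜) (z : ℝ × ℝ) : 𝕜 := dot ε (n z) (dy (dx R) z)
/-- The coefficient `g` of the second fundamental form. -/
noncomputable def formG (ε : ℝ) (R n : ℝ × ℝ → Vec 𝕜) (z : ℝ × ℝ) : 𝕜 := dot ε (n z) (dy (dy R) z)

/-- Determinant of the second fundamental form. -/
noncomputable def detII (ε : ℝ) (R n : ℝ × ℝ → Vec 𝕜) (z : ℝ × ℝ) : 𝕜 :=
  formE ε R n z * formG ε R n z - formF ε R n z ^ 2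

/-- Gauss curvature `K = det II / det I` (the determinant of the shape operator) with respect to
the unit normal field `n`. -/
noncomputable def gaussK (ε : ℝ) (R n : ℝ × ℝ → Vec 𝕜) (z : ℝ × ℝ) : 𝕜 :=
  detII ε R n z / detI ε R z

/-- The distinguished normal field `𝒩 = |K|^(-1/4) n`. -/
noncomputable def distinguished (ε : ℝ) (R n : ℝ × ℝ → Vec 𝕜) (z : ℝ × ℝ) : Vec 𝕜 :=
  (‖gaussK ε R n z‖ ^ (-(1 / 4) : ℝ) : ℝ) • n z

/-- `R`, with unit normal field `n` (`n · n = 1`, or `n · n = -1` for a time-like normal),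
is the position vector of a Bianchi surface over the open set `U`: a regular surface with `K ≠ 0`
such that `*d*d 𝒩 = f 𝒩` for a scalar function `f` and `*d*d (𝒩 · 𝒩) = 0`, where `*` is the Hodge
dual with respect to the second fundamental form. The area density `s` satisfies `s² = ± det II`;
over `ℝ` this says `s = ± √|det II|`, and the choice of the sign is immaterial for `*d*d`. -/
structure IsBianchiSurface (ε : ℝ) (U : Set (ℝ × ℝ)) (R n : ℝ × ℝ → Vec 𝕜) : Prop where
  contDiffOn_position : ContDiffOn ℝ 2 R U
  contDiffOn_normal : ContDiffOn ℝ 2 n U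
  regular : ∀ z ∈ U, detI ε R z ≠ 0
  unit : ∀ z ∈ U, dot ε (n z) (n z) = 1 ∨ dot ε (n z) (n z) = -1
  normal : ∀ z ∈ U, dot ε (n z) (dx R z) = 0 ∧ dot ε (n z) (dy R z) = 0
  curved : ∀ z ∈ U, detII ε R n z ≠ 0
  contDiffOn_curvature : ContDiffOn ℝ 2 (gaussK ε R n) U
  bianchi : ∃ s : ℝ × ℝ → 𝕜, ContDiffOn ℝ 1 s U ∧
    (∀ z ∈ U, s z ^ 2 = detII ε R n z ∨ s z ^ 2 = -detII ε R n z) ∧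
    ∃ f : ℝ × ℝ → 𝕜, ∀ z ∈ U,
      starDStarD (formE ε R n) (formF ε R n) (formG ε R n) s (distinguished ε R n) z
        = f z • distinguished ε R n z ∧
      starDStarD (formE ε R n) (formF ε R n) (formG ε R n) s
        (fun w => dot ε (distinguished ε R n w) (distinguished ε R n w)) z = 0

/-- `Δ = ab - c²`. -/
def disc (a b c : ℝ × ℝ → ℝ) (z : ℝ × ℝ) : ℝ := a z * b z - c z ^ 2

/-- Lelieuvre formulae for the position vector `R`, the normal field `N` and coefficients
`a`, `b`, `c`. -/
def Lelieuvre (ε : ℝ) (U : Set (ℝ × ℝ)) (a b c : ℝ × ℝ → ℝ) (N R : ℝ × ℝ → Vec 𝕜) : Prop :=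
  ∀ z ∈ U, DifferentiableAt ℝ R z ∧ DifferentiableAt ℝ N z ∧
    dx R z = cross ε (b z • dy N z + c z • dx N z) (N z) ∧
    dy R z = cross ε (N z) (a z • dx N z + c z • dy N z)

/-- The self-adjoint equation `(a ψ,ₓ + c ψ,ᵧ),ₓ + (b ψ,ᵧ + c ψ,ₓ),ᵧ = f ψ`, the fluxes being
differentiable. -/
def SelfAdjointEq {E : Type*} [NormedAddCommGroup E] [NormedSpace ℝ E] [Module 𝕜 E]
    (U : Set (ℝ × ℝ)) (a b c : ℝ × ℝ → ℝ) (f : ℝ × ℝ → 𝕜) (ψ : ℝ × ℝ → E) : Prop :=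
  ∀ z ∈ U, DifferentiableAt ℝ ψ z ∧
    DifferentiableAt ℝ (fun w => a w • dx ψ w + c w • dy ψ w) z ∧
    DifferentiableAt ℝ (fun w => b w • dy ψ w + c w • dx ψ w) z ∧
    dx (fun w => a w • dx ψ w + c w • dy ψ w) z + dy (fun w => b w • dy ψ w + c w • dx ψ w) z
      = f z • ψ z

/-- `ψ'` is related to `ψ` by the extended Moutard transformation with the function `θ`. -/
def Moutard (U : Set (ℝ × ℝ)) (a b c : ℝ × ℝ → ℝ) (θ : ℝ × ℝ → 𝕜) (ψ ψ' : ℝ × ℝ → Vec 𝕜) : Prop :=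
  ∀ z ∈ U, θ z ≠ 0 ∧ DifferentiableAt ℝ θ z ∧ DifferentiableAt ℝ ψ z ∧ DifferentiableAt ℝ ψ' z ∧
    dx (fun w => θ w • ψ' w) z = θ z ^ 2 •
      (c z • dx (fun w => (θ w)⁻¹ • ψ w) z + b z • dy (fun w => (θ w)⁻¹ • ψ w) z) ∧
    dy (fun w => θ w • ψ' w) z = -(θ z ^ 2 •
      (a z • dx (fun w => (θ w)⁻¹ • ψ w) z + c z • dy (fun w => (θ w)⁻¹ • ψ w) z))

/-- The system for the function `p`, where `r = N · N`:
`sgn Δ (r √|Δ|),ₓ + (c/√|Δ|) p,ₓ + (b/√|Δ|) p,ᵧ = 0` and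
`sgn Δ (r √|Δ|),ᵧ - (a/√|Δ|) p,ₓ - (c/√|Δ|) p,ᵧ = 0`. -/
def PSystem (U : Set (ℝ × ℝ)) (a b c r : ℝ × ℝ → ℝ) (p : ℝ × ℝ → 𝕜) : Prop :=
  ∀ z ∈ U, DifferentiableAt ℝ p z ∧
    ((Real.sign (disc a b c z) * dx (fun w => r w * √|disc a b c w|) z : ℝ) : 𝕜)
      + ((c z / √|disc a b c z| : ℝ) : 𝕜) * dx p z
      + ((b z / √|disc a b c z| : ℝ) : 𝕜) * dy p z = 0 ∧
    ((Real.sign (disc a b c z) * dy (fun w => r w * √|disc a b c w|) z : ℝ) : 𝕜)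
      - ((a z / √|disc a b c z| : ℝ) : 𝕜) * dx p z
      - ((c z / √|disc a b c z| : ℝ) : 𝕜) * dy p z = 0

/-- The linear system for `(x⁰, x¹, x²)`; `P A B` and `Q A B` are the rotation coefficients
`p_A^B` and `q_A^B`, and `μ.succ` for `μ : Fin 2` runs through the indices `1, 2`. -/
def LinearSystem (U : Set (ℝ × ℝ)) (a b c r : ℝ × ℝ → ℝ) (P Q : Fin 3 → Fin 3 → ℝ × ℝ → ℝ)
    (p : ℝ × ℝ → 𝕜) (x : Fin 3 → ℝ × ℝ → 𝕜) : Prop :=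
  ∀ z ∈ U, (∀ A, DifferentiableAt ℝ (x A) z) ∧
    dx (x 0) z = p z ^ 2 / (p z ^ 2 + (r z : 𝕜) ^ 2 * (disc a b c z : 𝕜)) *
      ((∑ μ : Fin 2, (((r z : 𝕜) / p z * (c z : 𝕜) - 1) * (P μ.succ 0 z : 𝕜)
          + (r z : 𝕜) / p z * (b z : 𝕜) * (Q μ.succ 0 z : 𝕜)) * x μ.succ z)
        + (r z : 𝕜) / p z ^ 2 * (((c z : 𝕜) + (r z : 𝕜) / p z * (disc a b c z : 𝕜)) * dx p z
          + (b z : 𝕜) * dy p z) * x 0 z) ∧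
    (∀ μ : Fin 2, dx (x μ.succ) z = -(∑ A, x A z * (P A μ.succ z : 𝕜))
      + (r z : 𝕜) / p z * ((c z : 𝕜) * (P 0 μ.succ z : 𝕜) + (b z : 𝕜) * (Q 0 μ.succ z : 𝕜))
        * x 0 z) ∧
    dy (x 0) z = -(p z ^ 2 / (p z ^ 2 + (r z : 𝕜) ^ 2 * (disc a b c z : 𝕜))) *
      ((∑ μ : Fin 2, (((r z : 𝕜) / p z * (c z : 𝕜) + 1) * (Q μ.succ 0 z : 𝕜)
          + (r z : 𝕜) / p z * (a z : 𝕜) * (P μ.succ 0 z : 𝕜)) * x μ.succ z)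
        + (r z : 𝕜) / p z ^ 2 * (((c z : 𝕜) - (r z : 𝕜) / p z * (disc a b c z : 𝕜)) * dy p z
          + (a z : 𝕜) * dx p z) * x 0 z) ∧
    (∀ μ : Fin 2, dy (x μ.succ) z = -(∑ A, x A z * (Q A μ.succ z : 𝕜))
      - (r z : 𝕜) / p z * ((a z : 𝕜) * (P 0 μ.succ z : 𝕜) + (c z : 𝕜) * (Q 0 μ.succ z : 𝕜))
        * x 0 z)

/-- The quadratic expression `(x⁰)² (1 + (r²/p²) Δ) + ε ((x¹)² + (x²)²)`; the constraint says that
it vanishes. -/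
noncomputable def constraint (ε : ℝ) (a b c r : ℝ × ℝ → ℝ) (p : ℝ × ℝ → 𝕜) (x : Fin 3 → ℝ × ℝ → 𝕜)
    (z : ℝ × ℝ) : 𝕜 :=
  x 0 z ^ 2 * (1 + (r z : 𝕜) ^ 2 / p z ^ 2 * (disc a b c z : 𝕜))
    + ε • (x 1 z ^ 2 + x 2 z ^ 2)

/-- `θ = x⁰ √r / p`. -/
noncomputable def theta (r : ℝ × ℝ → ℝ) (p : ℝ × ℝ → 𝕜) (x : Fin 3 → ℝ × ℝ → 𝕜) (z : ℝ × ℝ) : 𝕜 :=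
  x 0 z * ((√(r z) : ℝ) : 𝕜) / p z

/-- `N' = (p / √r) (x^A / x⁰) n_A`. -/
noncomputable def newNormal (r : ℝ × ℝ → ℝ) (p : ℝ × ℝ → 𝕜) (x : Fin 3 → ℝ × ℝ → 𝕜)
    (n : Fin 3 → ℝ × ℝ → Vec ℝ) (z : ℝ × ℝ) : Vec 𝕜 :=
  (p z / ((√(r z) : ℝ) : 𝕜)) • ∑ A, (x A z / x 0 z) • ofRealVec 𝕜 (n A z)

/-- `r' = r + N × N' + C`. -/
noncomputable def newPosition (ε : ℝ) (R N : ℝ × ℝ → Vec ℝ) (N' : ℝ × ℝ → Vec 𝕜) (C : Vec 𝕜)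
    (z : ℝ × ℝ) : Vec 𝕜 :=
  ofRealVec 𝕜 (R z) + cross ε (ofRealVec 𝕜 (N z)) (N' z) + C

/-- The normalization `N / √|N · N|` of a nowhere isotropic vector field. -/
noncomputable def unitField (ε : ℝ) (N : ℝ × ℝ → Vec 𝕜) (z : ℝ × ℝ) : Vec 𝕜 :=
  (√‖dot ε (N z) (N z)‖)⁻¹ • N z

/-- The primed coefficient `a' = -a/Δ` (and likewise for `b`, `c`). -/
noncomputable def primed (a b c : ℝ × ℝ → ℝ) (u : ℝ × ℝ → ℝ) (z : ℝ × ℝ) : ℝ :=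
  -u z / disc a b c z

/-- The coefficient `A = a/√|Δ|` (and likewise for `b`, `c`). -/
noncomputable def conformal (a b c : ℝ × ℝ → ℝ) (u : ℝ × ℝ → ℝ) (z : ℝ × ℝ) : ℝ :=
  u z / √|disc a b c z|

/-- The potential `f' = θ ((a' (1/θ),ₓ + c' (1/θ),ᵧ),ₓ + (b' (1/θ),ᵧ + c' (1/θ),ₓ),ᵧ)`. -/
noncomputable def primedPotential (a b c : ℝ × ℝ → ℝ) (θ : ℝ × ℝ → 𝕜) (z : ℝ × ℝ) : 𝕜 :=
  θ z * (dx (fun w => primed a b c a w • dx (fun v => (θ v)⁻¹) w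
        + primed a b c c w • dy (fun v => (θ v)⁻¹) w) z
    + dy (fun w => primed a b c b w • dy (fun v => (θ v)⁻¹) w
        + primed a b c c w • dx (fun v => (θ v)⁻¹) w) z)

end Surfaces

end Bianchi

open Bianchi

/-! The natural unknown is the vector X = θN'. Since θ²(N/θ)_x = θN_x − θ_xN, the Moutard relations
express dX through N, θ and dθ. Prescribing N·N' = p means θ = X·N/p, and differentiating this
identity gives two linear equations for θ_x, θ_y whose determinant is p² + r²Δ. Where p and this
determinant do not vanish, X therefore satisfies a closed linear total differential system
(`moutardX`, `moutardY`); written in the frame n_A it is system (2) (`moutard_frameVec`,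
`linearSystem_iff`).

The heart of the matter is compatibility. The cross derivatives of X agree as soon as N and θ solve
the same self-adjoint equation (`MoutardData.compatible`). For θ this comes from the system for p:
with m = rΔ/2 that system is free of square roots (`BianchiNormal.flux_eqs`) and turns the two
equations for θ_x, θ_y into a second pair. Differentiating both pairs yields two homogeneous linear
equations for the defect of the self-adjoint equation and the defect of symmetry (θ_x)_y − (θ_y)_x,
again with determinant p² + r²Δ, so the defect vanishes (`MoutardData.theta_selfAdjoint`). The
second pair also shows that X·X + rΔθ² is constant; its vanishing means N'·N' = −Δr.

The system for p says that dp is the conjugate differential of r√|Δ|. It is closed by the scalar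
Bianchi condition (`IsBianchiSurface.div_flux_eq_zero`), because the Lelieuvre coefficients are the
second fundamental form in disguise: for n = lN one has II = −l vol(N, N_x, N_y)(b dx² − 2c dx dy +
a dy²), so that *d*d is, up to a factor, the self-adjoint operator with coefficients (a, b, c)/√|Δ|,
and 𝒩·𝒩 = r√|Δ|.

The transform is again of Bianchi type since the Moutard relations can be inverted with coefficients
−(a, b, c)/Δ and the function 1/θ (`inverse_flux`). Here Δ' = 1/Δ, and both the normalized
coefficients and (N'·N')√|Δ'| differ from the old ones, respectively from r√|Δ|, only by the locally
constant sign −sgn Δ; so the scalar equation persists. The vector equation for 𝒩' = |Δ|^(−1/4)N'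
follows by rescaling (`div_flux_inv_smul`).

All existence statements come from a Frobenius theorem for linear total differential systems:
locally a contraction argument, globally the covering space of germs of solutions over a simply
connected domain (`exists_isLinearSolution`). -/

namespace Bianchi

/-! ### Calculus with pairs of partial derivatives. -/

section Gradient

variable {E F : Type*} [NormedAddCommGroup E] [NormedSpace ℝ E] [NormedAddCommGroup F]
  [NormedSpace ℝ F]

/-- `f` is differentiable at `z` with partial derivatives `P` and `Q`. -/
def HasGrad (f : ℝ × ℝ → E) (P Q : E) (z : ℝ × ℝ) : Prop :=
  HasFDerivAt f ((ContinuousLinearMap.fst ℝ ℝ ℝ).smulRight P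
    + (ContinuousLinearMap.snd ℝ ℝ ℝ).smulRight Q) z

theorem HasGrad.of_hasFDerivAt {f : ℝ × ℝ → E} {L : ℝ × ℝ →L[ℝ] E} {P Q : E} {z : ℝ × ℝ}
    (h : HasFDerivAt f L z) (hP : L (1, 0) = P) (hQ : L (0, 1) = Q) : HasGrad f P Q z := by
  unfold HasGrad
  convert h using 1
  ext <;> simp [hP, hQ]

theorem _root_.DifferentiableAt.hasGrad {f : ℝ × ℝ → E} {z : ℝ × ℝ} (h : DifferentiableAt ℝ f z) :
    HasGrad f (dx f z) (dy f z) z :=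
  HasGrad.of_hasFDerivAt h.hasFDerivAt rfl rfl

theorem HasGrad.differentiableAt {f : ℝ × ℝ → E} {P Q : E} {z : ℝ × ℝ} (h : HasGrad f P Q z) :
    DifferentiableAt ℝ f z := HasFDerivAt.differentiableAt h

theorem HasGrad.dx_eq {f : ℝ × ℝ → E} {P Q : E} {z : ℝ × ℝ} (h : HasGrad f P Q z) :
    dx f z = P := by
  simp [dx, HasFDerivAt.fderiv h]

theorem HasGrad.dy_eq {f : ℝ × ℝ → E} {P Q : E} {z : ℝ × ℝ} (h : HasGrad f P Q z) :
    dy f z = Q := by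
  simp [dy, HasFDerivAt.fderiv h]

theorem HasGrad.congr {f g : ℝ × ℝ → E} {P Q P' Q' : E} {z : ℝ × ℝ} (h : HasGrad f P Q z)
    (hg : g =ᶠ[nhds z] f) (hP : P = P') (hQ : Q = Q') : HasGrad g P' Q' z := by
  subst hP hQ
  exact HasFDerivAt.congr_of_eventuallyEq h hg

theorem HasGrad.congr_grad {f : ℝ × ℝ → E} {P Q P' Q' : E} {z : ℝ × ℝ} (h : HasGrad f P Q z)
    (hP : P = P') (hQ : Q = Q') : HasGrad f P' Q' z := by
  subst hP hQ
  exact h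

/-- This is the tool for differentiating an identity that holds near a point: compute the gradient
of both sides and equate components. -/
theorem HasGrad.unique {f g : ℝ × ℝ → E} {P Q P' Q' : E} {z : ℝ × ℝ} (h : HasGrad f P Q z)
    (h' : HasGrad g P' Q' z) (hg : g =ᶠ[nhds z] f) : P = P' ∧ Q = Q' := by
  have := h.congr hg rfl rfl
  exact ⟨this.dx_eq.symm.trans h'.dx_eq, this.dy_eq.symm.trans h'.dy_eq⟩

theorem hasGrad_const (v : E) (z : ℝ × ℝ) : HasGrad (fun _ => v) 0 0 z :=
  .of_hasFDerivAt (hasFDerivAt_const v z) (by simp) (by simp)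

theorem HasGrad.add {f g : ℝ × ℝ → E} {P Q P' Q' : E} {z : ℝ × ℝ} (h : HasGrad f P Q z)
    (h' : HasGrad g P' Q' z) : HasGrad (fun w => f w + g w) (P + P') (Q + Q') z :=
  .of_hasFDerivAt (HasFDerivAt.add h h') (by simp) (by simp)

theorem HasGrad.sub {f g : ℝ × ℝ → E} {P Q P' Q' : E} {z : ℝ × ℝ} (h : HasGrad f P Q z)
    (h' : HasGrad g P' Q' z) : HasGrad (fun w => f w - g w) (P - P') (Q - Q') z :=
  .of_hasFDerivAt (HasFDerivAt.sub h h') (by simp) (by simp)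

theorem HasGrad.neg {f : ℝ × ℝ → E} {P Q : E} {z : ℝ × ℝ} (h : HasGrad f P Q z) :
    HasGrad (fun w => -f w) (-P) (-Q) z :=
  .of_hasFDerivAt (HasFDerivAt.neg h) (by simp [add_comm]) (by simp)

theorem HasGrad.clm (L : E →L[ℝ] F) {f : ℝ × ℝ → E} {P Q : E} {z : ℝ × ℝ} (h : HasGrad f P Q z) :
    HasGrad (fun w => L (f w)) (L P) (L Q) z :=
  .of_hasFDerivAt (L.hasFDerivAt.comp z h) (by simp) (by simp)

theorem HasGrad.sum {ι : Type*} (s : Finset ι) {f : ι → ℝ × ℝ → E} {P Q : ι → E} {z : ℝ × ℝ}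
    (h : ∀ i ∈ s, HasGrad (f i) (P i) (Q i) z) :
    HasGrad (fun w => ∑ i ∈ s, f i w) (∑ i ∈ s, P i) (∑ i ∈ s, Q i) z :=
  .of_hasFDerivAt (HasFDerivAt.fun_sum h) (by simp) (by simp)

end Gradient

/-! ### Product rules for scalars and vectors over ℝ or ℂ. -/

section Field

variable {𝕜 : Type*} [RCLike 𝕜] {E : Type*} [NormedAddCommGroup E] [NormedSpace ℝ E]
  [NormedSpace 𝕜 E] [IsScalarTower ℝ 𝕜 E]

theorem HasGrad.smul {f : ℝ × ℝ → 𝕜} {g : ℝ × ℝ → E} {P Q : 𝕜} {P' Q' : E}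
    {z : ℝ × ℝ} (h : HasGrad f P Q z) (h' : HasGrad g P' Q' z) :
    HasGrad (fun w => f w • g w) (P • g z + f z • P') (Q • g z + f z • Q') z :=
  .of_hasFDerivAt (HasFDerivAt.fun_smul h h') (by simp; abel) (by simp; abel)

theorem HasGrad.mul {f g : ℝ × ℝ → 𝕜} {P Q P' Q' : 𝕜}
    {z : ℝ × ℝ} (h : HasGrad f P Q z) (h' : HasGrad g P' Q' z) :
    HasGrad (fun w => f w * g w) (P * g z + f z * P') (Q * g z + f z * Q') z := by
  simpa only [smul_eq_mul] using h.smul h'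

theorem HasGrad.inv {f : ℝ × ℝ → 𝕜} {P Q : 𝕜} {z : ℝ × ℝ} (h : HasGrad f P Q z) (h0 : f z ≠ 0) :
    HasGrad (fun w => (f w)⁻¹) (-P / f z ^ 2) (-Q / f z ^ 2) z := by
  have h1 : HasFDerivAt (fun y : 𝕜 => y⁻¹) _ (f z) := (hasFDerivAt_inv h0).restrictScalars ℝ
  refine .of_hasFDerivAt (h1.comp z h) ?_ ?_ <;> simp [div_eq_mul_inv]

theorem HasGrad.div {f g : ℝ × ℝ → 𝕜} {P Q P' Q' : 𝕜}
    {z : ℝ × ℝ} (h : HasGrad f P Q z) (h' : HasGrad g P' Q' z) (h0 : g z ≠ 0) :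
    HasGrad (fun w => f w / g w) ((P * g z - f z * P') / g z ^ 2)
      ((Q * g z - f z * Q') / g z ^ 2) z := by
  refine (h.mul (h'.inv h0)).congr (.of_forall fun w => div_eq_mul_inv _ _) ?_ ?_ <;>
    field_simp <;> ring

theorem HasGrad.ofReal {f : ℝ × ℝ → ℝ} {P Q : ℝ} {z : ℝ × ℝ} (h : HasGrad f P Q z) :
    HasGrad (fun w => (f w : 𝕜)) (P : 𝕜) (Q : 𝕜) z := by
  simpa using h.clm (RCLike.ofRealCLM (K := 𝕜))

theorem HasGrad.apply {f : ℝ × ℝ → Vec 𝕜} {P Q : Vec 𝕜} {z : ℝ × ℝ} (h : HasGrad f P Q z)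
    (i : Fin 3) : HasGrad (fun w => f w i) (P i) (Q i) z :=
  h.clm (ContinuousLinearMap.proj (R := ℝ) (φ := fun _ : Fin 3 => 𝕜) i)

theorem HasGrad.pi {f : ℝ × ℝ → Vec 𝕜} {P Q : Vec 𝕜} {z : ℝ × ℝ}
    (h : ∀ i, HasGrad (fun w => f w i) (P i) (Q i) z) : HasGrad f P Q z :=
  .of_hasFDerivAt (hasFDerivAt_pi.2 h) (by ext; simp) (by ext; simp)

theorem HasGrad.ofRealVec {f : ℝ × ℝ → Vec ℝ} {P Q : Vec ℝ} {z : ℝ × ℝ} (h : HasGrad f P Q z) :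
    HasGrad (fun w => ofRealVec 𝕜 (f w)) (ofRealVec 𝕜 P) (ofRealVec 𝕜 Q) z :=
  .pi fun i => (h.apply i).ofReal

theorem dot_eq (ε : ℝ) (u v : Vec 𝕜) :
    dot ε u v = u 0 * v 0 + (ε : 𝕜) * (u 1 * v 1 + u 2 * v 2) := by
  rw [dot, RCLike.real_smul_eq_coe_mul]

theorem cross_eq (ε : ℝ) (u v : Vec 𝕜) :
    cross ε u v = ![u 1 * v 2 - u 2 * v 1, (ε : 𝕜) * (u 2 * v 0 - u 0 * v 2),
      (ε : 𝕜) * (u 0 * v 1 - u 1 * v 0)] := by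
  rw [cross, RCLike.real_smul_eq_coe_mul, RCLike.real_smul_eq_coe_mul]

theorem HasGrad.dot (ε : ℝ) {f g : ℝ × ℝ → Vec 𝕜} {P Q P' Q' : Vec 𝕜} {z : ℝ × ℝ}
    (h : HasGrad f P Q z) (h' : HasGrad g P' Q' z) :
    HasGrad (fun w => dot ε (f w) (g w)) (dot ε P (g z) + dot ε (f z) P')
      (dot ε Q (g z) + dot ε (f z) Q') z := by
  simp only [dot_eq]
  refine (((h.apply 0).mul (h'.apply 0)).add ((hasGrad_const (ε : 𝕜) z).mul
    (((h.apply 1).mul (h'.apply 1)).add ((h.apply 2).mul (h'.apply 2))))).congr_grad ?_ ?_ <;>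
    ring

theorem HasGrad.cross (ε : ℝ) {f g : ℝ × ℝ → Vec 𝕜} {P Q P' Q' : Vec 𝕜} {z : ℝ × ℝ}
    (h : HasGrad f P Q z) (h' : HasGrad g P' Q' z) :
    HasGrad (fun w => cross ε (f w) (g w)) (cross ε P (g z) + cross ε (f z) P')
      (cross ε Q (g z) + cross ε (f z) Q') z := by
  have key (i j : Fin 3) := ((h.apply i).mul (h'.apply j)).sub ((h.apply j).mul (h'.apply i))
  simp only [cross_eq]
  refine HasGrad.pi fun i => ?_
  fin_cases i
  · refine (key 1 2).congr_grad ?_ ?_ <;> simp <;> ring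
  · refine ((hasGrad_const (ε : 𝕜) z).mul (key 2 0)).congr_grad ?_ ?_ <;> simp <;> ring
  · refine ((hasGrad_const (ε : 𝕜) z).mul (key 0 1)).congr_grad ?_ ?_ <;> simp <;> ring

end Field

/-! ### Vector algebra of the bilinear product and the cross product. -/

section Algebra

variable {𝕜 : Type*} [RCLike 𝕜] {ε : ℝ}

theorem dot_comm (u v : Vec 𝕜) : dot ε u v = dot ε v u := by simp only [dot_eq]; ring

theorem dot_add_left (u v w : Vec 𝕜) : dot ε (u + v) w = dot ε u w + dot ε v w := by
  simp only [dot_eq, Pi.add_apply]; ring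

theorem dot_add_right (u v w : Vec 𝕜) : dot ε u (v + w) = dot ε u v + dot ε u w := by
  simp only [dot_eq, Pi.add_apply]; ring

theorem dot_sub_left (u v w : Vec 𝕜) : dot ε (u - v) w = dot ε u w - dot ε v w := by
  simp only [dot_eq, Pi.sub_apply]; ring

theorem dot_sub_right (u v w : Vec 𝕜) : dot ε u (v - w) = dot ε u v - dot ε u w := by
  simp only [dot_eq, Pi.sub_apply]; ring

theorem dot_neg_left (u v : Vec 𝕜) : dot ε (-u) v = -dot ε u v := by
  simp only [dot_eq, Pi.neg_apply]; ring

theorem dot_neg_right (u v : Vec 𝕜) : dot ε u (-v) = -dot ε u v := by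
  simp only [dot_eq, Pi.neg_apply]; ring

theorem dot_smul_left (t : 𝕜) (u v : Vec 𝕜) : dot ε (t • u) v = t * dot ε u v := by
  simp only [dot_eq, Pi.smul_apply, smul_eq_mul]; ring

theorem dot_smul_right (t : 𝕜) (u v : Vec 𝕜) : dot ε u (t • v) = t * dot ε u v := by
  simp only [dot_eq, Pi.smul_apply, smul_eq_mul]; ring

theorem dot_zero_left (u : Vec 𝕜) : dot ε 0 u = 0 := by simp [dot_eq]

theorem vol_eq (u v w : Vec 𝕜) : vol u v w =
    u 0 * (v 1 * w 2 - v 2 * w 1) - u 1 * (v 0 * w 2 - v 2 * w 0)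
      + u 2 * (v 0 * w 1 - v 1 * w 0) := by
  simp [vol, Matrix.det_fin_three]; ring

theorem cast_sq (hε : ε = 1 ∨ ε = -1) : (ε : 𝕜) ^ 2 = 1 := by
  rcases hε with rfl | rfl <;> simp

theorem cross_smul_right (t : 𝕜) (u v : Vec 𝕜) : cross ε u (t • v) = t • cross ε u v := by
  ext i; fin_cases i <;> simp [cross_eq] <;> ring

theorem cross_smul_left (t : 𝕜) (u v : Vec 𝕜) : cross ε (t • u) v = t • cross ε u v := by
  ext i; fin_cases i <;> simp [cross_eq] <;> ring

theorem cross_add_right (u v w : Vec 𝕜) : cross ε u (v + w) = cross ε u v + cross ε u w := by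
  ext i; fin_cases i <;> simp [cross_eq] <;> ring

theorem cross_add_left (u v w : Vec 𝕜) : cross ε (u + v) w = cross ε u w + cross ε v w := by
  ext i; fin_cases i <;> simp [cross_eq] <;> ring

theorem cross_self (u : Vec 𝕜) : cross ε u u = 0 := by
  ext i; fin_cases i <;> simp [cross_eq, mul_comm]

theorem cross_anticomm (u v : Vec 𝕜) : cross ε u v = -cross ε v u := by
  ext i; fin_cases i <;> simp [cross_eq] <;> ring

/-- The expansion of the double vector product. -/
theorem cross_cross (hε : ε = 1 ∨ ε = -1) (u v w : Vec 𝕜) :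
    cross ε u (cross ε v w) = dot ε u w • v - dot ε u v • w := by
  rcases hε with rfl | rfl <;> ext i <;> fin_cases i <;> simp [cross_eq, dot_eq] <;> ring

/-- The identity of Lagrange. -/
theorem dot_cross_cross (hε : ε = 1 ∨ ε = -1) (u v w t : Vec 𝕜) :
    dot ε (cross ε u v) (cross ε w t) = dot ε u w * dot ε v t - dot ε u t * dot ε v w := by
  rcases hε with rfl | rfl <;> simp [cross_eq, dot_eq] <;> ring

theorem dot_cross_left (hε : ε = 1 ∨ ε = -1) (u v w : Vec 𝕜) :
    dot ε (cross ε v w) u = vol u v w := by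
  rw [dot_comm, dot_cross hε]

end Algebra

/-! ### Regularity of partial derivatives, symmetry of second derivatives, constancy on connected
sets. -/

section Smoothness

variable {E : Type*} [NormedAddCommGroup E] [NormedSpace ℝ E] {U : Set (ℝ × ℝ)}

theorem contDiffOn_dx (hU : IsOpen U) {f : ℝ × ℝ → E} {n m : WithTop ℕ∞} (hf : ContDiffOn ℝ n f U)
    (hm : m + 1 ≤ n) : ContDiffOn ℝ m (dx f) U :=
  (hf.fderiv_of_isOpen hU hm).clm_apply contDiffOn_const

theorem contDiffOn_dy (hU : IsOpen U) {f : ℝ × ℝ → E} {n m : WithTop ℕ∞} (hf : ContDiffOn ℝ n f U)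
    (hm : m + 1 ≤ n) : ContDiffOn ℝ m (dy f) U :=
  (hf.fderiv_of_isOpen hU hm).clm_apply contDiffOn_const

theorem fderiv_eq_of_differentiableAt {f : ℝ × ℝ → E} {z : ℝ × ℝ} (h : DifferentiableAt ℝ f z) :
    fderiv ℝ f z = (ContinuousLinearMap.fst ℝ ℝ ℝ).smulRight (dx f z)
      + (ContinuousLinearMap.snd ℝ ℝ ℝ).smulRight (dy f z) :=
  HasFDerivAt.fderiv h.hasGrad

theorem contDiffOn_succ_of_partial (hU : IsOpen U) {f : ℝ × ℝ → E} {m : ℕ}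
    (hf : ∀ z ∈ U, DifferentiableAt ℝ f z) (hx : ContDiffOn ℝ m (dx f) U)
    (hy : ContDiffOn ℝ m (dy f) U) : ContDiffOn ℝ ((m + 1 : ℕ) : WithTop ℕ∞) f U := by
  have h : ContDiffOn ℝ ((m : WithTop ℕ∞) + 1) f U := by
    rw [contDiffOn_succ_iff_fderiv_of_isOpen hU]
    refine ⟨fun z hz => (hf z hz).differentiableWithinAt, by simp, ?_⟩
    exact ((contDiffOn_const.smulRight hx).add (contDiffOn_const.smulRight hy)).congr
      fun z hz => fderiv_eq_of_differentiableAt (hf z hz)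
  exact_mod_cast h

theorem ContDiffOn.hasGrad (hU : IsOpen U) {f : ℝ × ℝ → E} {n : WithTop ℕ∞}
    (hf : ContDiffOn ℝ n f U) (hn : 1 ≤ n) {z : ℝ × ℝ} (hz : z ∈ U) :
    HasGrad f (dx f z) (dy f z) z :=
  ((hf.differentiableOn (by intro h; simp [h] at hn)).differentiableAt (hU.mem_nhds hz)).hasGrad

theorem dx_dy_comm (hU : IsOpen U) {f : ℝ × ℝ → E} {n : WithTop ℕ∞} (hf : ContDiffOn ℝ n f U)
    (hn : 2 ≤ n) {z : ℝ × ℝ} (hz : z ∈ U) : dy (dx f) z = dx (dy f) z := by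
  have h := ((hf.of_le hn).contDiffAt (hU.mem_nhds hz)).isSymmSndFDerivAt (by simp)
  have hd : DifferentiableAt ℝ (fderiv ℝ f) z :=
    ((hf.fderiv_of_isOpen (m := 1) hU (by simpa [one_add_one_eq_two] using hn)).differentiableOn
      (by simp)).differentiableAt (hU.mem_nhds hz)
  have key (v w : ℝ × ℝ) : fderiv ℝ (fun z => fderiv ℝ f z v) z w = fderiv ℝ (fderiv ℝ f) z w v := by
    rw [fderiv_clm_apply hd (by fun_prop)]
    simp
  simp only [dx, dy]
  exact (key _ _).trans ((h _ _).trans (key _ _).symm)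

theorem eqOn_of_grad_eq (hU : IsOpen U) (hc : IsPreconnected U) {f g : ℝ × ℝ → E}
    {P Q : ℝ × ℝ → E} (hf : ∀ z ∈ U, HasGrad f (P z) (Q z) z)
    (hg : ∀ z ∈ U, HasGrad g (P z) (Q z) z) {z₀ : ℝ × ℝ} (hz₀ : z₀ ∈ U) {z : ℝ × ℝ} (hz : z ∈ U) :
    f z - f z₀ = g z - g z₀ := by
  have h : ∀ w ∈ U, HasGrad (fun w => f w - g w) 0 0 w := fun w hw =>
    ((hf w hw).sub (hg w hw)).congr_grad (sub_self _) (sub_self _)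
  have := hU.is_const_of_fderiv_eq_zero (𝕜 := ℝ) hc
    (fun w hw => (h w hw).differentiableAt.differentiableWithinAt)
    (fun w hw => by rw [HasFDerivAt.fderiv (h w hw)]; ext <;> simp) hz hz₀
  rw [sub_eq_sub_iff_add_eq_add] at this ⊢
  exact this.trans (add_comm _ _)

end Smoothness

/-! ### Smoothness of the products of vector fields. -/

section VectorSmoothness

variable {𝕜 : Type*} [RCLike 𝕜] {U : Set (ℝ × ℝ)} {n : WithTop ℕ∞}

theorem contDiffOn_ofReal {f : ℝ × ℝ → ℝ} (hf : ContDiffOn ℝ n f U) :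
    ContDiffOn ℝ n (fun z => (f z : 𝕜)) U :=
  (RCLike.ofRealCLM (K := 𝕜)).contDiff.comp_contDiffOn hf

theorem contDiffOn_ofRealVec {f : ℝ × ℝ → Vec ℝ} (hf : ContDiffOn ℝ n f U) :
    ContDiffOn ℝ n (fun z => ofRealVec 𝕜 (f z)) U :=
  contDiffOn_pi.2 fun i => contDiffOn_ofReal (contDiffOn_pi.1 hf i)

theorem contDiffOn_dot (ε : ℝ) {f g : ℝ × ℝ → Vec 𝕜} (hf : ContDiffOn ℝ n f U)
    (hg : ContDiffOn ℝ n g U) : ContDiffOn ℝ n (fun z => dot ε (f z) (g z)) U := by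
  have hf := contDiffOn_pi.1 hf
  have hg := contDiffOn_pi.1 hg
  simp only [dot_eq]
  exact ((hf 0).mul (hg 0)).add (contDiffOn_const.mul (((hf 1).mul (hg 1)).add ((hf 2).mul (hg 2))))

theorem contDiffOn_cross (ε : ℝ) {f g : ℝ × ℝ → Vec 𝕜} (hf : ContDiffOn ℝ n f U)
    (hg : ContDiffOn ℝ n g U) : ContDiffOn ℝ n (fun z => cross ε (f z) (g z)) U := by
  have hf := contDiffOn_pi.1 hf
  have hg := contDiffOn_pi.1 hg
  have key (i j : Fin 3) := ((hf i).mul (hg j)).sub ((hf j).mul (hg i))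
  simp only [cross_eq]
  refine contDiffOn_pi.2 fun i => ?_
  fin_cases i
  · exact key 1 2
  · exact contDiffOn_const.mul (key 2 0)
  · exact contDiffOn_const.mul (key 0 1)

theorem contDiffOn_vol {f g h : ℝ × ℝ → Vec 𝕜} (hf : ContDiffOn ℝ n f U)
    (hg : ContDiffOn ℝ n g U) (hh : ContDiffOn ℝ n h U) :
    ContDiffOn ℝ n (fun z => vol (f z) (g z) (h z)) U :=
  (contDiffOn_dot 1 hf (contDiffOn_cross 1 hg hh)).congr fun _ _ =>
    (dot_cross (Or.inl rfl) _ _ _).symm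

end VectorSmoothness

/-! ### Local solvability of linear total differential systems: the integral equation. -/

section LocalFrobenius

open MeasureTheory intervalIntegral

variable {V : Type*} [NormedAddCommGroup V] [NormedSpace ℝ V] [CompleteSpace V]

/-- The integral equation for a linear total differential equation on a square: there is a bounded
continuous `v` with `v (x, y) = ξ + ∫ A v ds + ∫ B v dt`, first along `y = y₀`, then along the
`y`-direction. -/
theorem exists_integral_solution {A B : ℝ × ℝ → V →L[ℝ] V} (hA : Continuous A) (hB : Continuous B)
    {M R : ℝ} (hR : 0 < R) (hAM : ∀ z, ‖A z‖ ≤ M) (hBM : ∀ z, ‖B z‖ ≤ M) (hMR : M * R ≤ 1 / 8)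
    (x₀ y₀ : ℝ) (ξ : V) :
    ∃ v : BoundedContinuousFunction (ℝ × ℝ) V, ∀ x y, |x - x₀| ≤ R → |y - y₀| ≤ R →
      v (x, y) = ξ + (∫ s in x₀..x, A (s, y₀) (v (s, y₀))) + ∫ t in y₀..y, B (x, t) (v (x, t)) := by
  have hM : 0 ≤ M := (norm_nonneg _).trans (hAM 0)
  -- clamping to the interval
  let c : ℝ → ℝ → ℝ := fun m x => max (m - R) (min (m + R) x)
  have hc : ∀ m, Continuous (c m) := fun m => by fun_prop
  have hcm : ∀ m x, |c m x - m| ≤ R := fun m x => by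
    rw [abs_le]
    constructor
    · have := le_max_left (m - R) (min (m + R) x); simp only [c]; linarith
    · have : c m x ≤ m + R := max_le (by linarith) (min_le_left _ _)
      linarith
  have hcx : ∀ m x, |x - m| ≤ R → c m x = x := fun m x h => by
    rw [abs_le] at h
    simp only [c]
    rw [min_eq_right (by linarith), max_eq_right (by linarith)]
  -- The endpoints of integration are clamped, so the operator acts on bounded continuous functions
  -- on the whole plane and its integrals have length at most R. On the square itself the clamping
  -- has no effect.
  let T₀ : BoundedContinuousFunction (ℝ × ℝ) V → ℝ × ℝ → V := fun v z =>
    ξ + (∫ s in x₀..c x₀ z.1, A (s, y₀) (v (s, y₀)))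
      + ∫ t in y₀..c y₀ z.2, B (z.1, t) (v (z.1, t))
  have hint1 : ∀ (v : BoundedContinuousFunction (ℝ × ℝ) V) a b,
      IntervalIntegrable (fun s => A (s, y₀) (v (s, y₀))) volume a b := fun v a b =>
    Continuous.intervalIntegrable (by fun_prop) _ _
  have hint2 : ∀ (v : BoundedContinuousFunction (ℝ × ℝ) V) x a b,
      IntervalIntegrable (fun t => B (x, t) (v (x, t))) volume a b := fun v x a b =>
    Continuous.intervalIntegrable (by fun_prop) _ _
  have hT₀ : ∀ v, Continuous (T₀ v) := fun v => by
    refine (continuous_const.add ?_).add ?_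
    · exact (continuous_primitive (hint1 v) x₀).comp ((hc x₀).comp continuous_fst)
    · exact continuous_parametric_intervalIntegral_of_continuous
        (f := fun (z : ℝ × ℝ) t => B (z.1, t) (v (z.1, t))) (by fun_prop)
        ((hc y₀).comp continuous_snd)
  have hbound : ∀ (v w : BoundedContinuousFunction (ℝ × ℝ) V) z,
      ‖T₀ v z - T₀ w z‖ ≤ 1 / 4 * ‖v - w‖ := fun v w z => by
    have e : T₀ v z - T₀ w z = (∫ s in x₀..c x₀ z.1, A (s, y₀) ((v - w) (s, y₀)))
        + ∫ t in y₀..c y₀ z.2, B (z.1, t) ((v - w) (z.1, t)) := by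
      simp only [T₀, BoundedContinuousFunction.coe_sub, Pi.sub_apply, map_sub]
      rw [integral_sub (hint1 v _ _) (hint1 w _ _), integral_sub (hint2 v _ _ _) (hint2 w _ _ _)]
      abel
    rw [e]
    -- Each of the two integrals contributes at most MR ≤ 1/8, whence the Lipschitz constant 1/4.
    have h1 : ‖∫ s in x₀..c x₀ z.1, A (s, y₀) ((v - w) (s, y₀))‖ ≤ M * ‖v - w‖ * R :=
      (norm_integral_le_of_norm_le_const fun s _ => (ContinuousLinearMap.le_opNorm _ _).trans
        (mul_le_mul (hAM _) ((v - w).norm_coe_le_norm _) (norm_nonneg _) hM)).trans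
        (mul_le_mul_of_nonneg_left (hcm _ _) (by positivity))
    have h2 : ‖∫ t in y₀..c y₀ z.2, B (z.1, t) ((v - w) (z.1, t))‖ ≤ M * ‖v - w‖ * R :=
      (norm_integral_le_of_norm_le_const fun s _ => (ContinuousLinearMap.le_opNorm _ _).trans
        (mul_le_mul (hBM _) ((v - w).norm_coe_le_norm _) (norm_nonneg _) hM)).trans
        (mul_le_mul_of_nonneg_left (hcm _ _) (by positivity))
    have := norm_nonneg (v - w)
    refine (norm_add_le _ _).trans ((add_le_add h1 h2).trans ?_)
    nlinarith
  have hbd : ∀ v z, ‖T₀ v z‖ ≤ ‖ξ‖ + 1 / 4 * ‖v‖ := fun v z => by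
    have h0 : T₀ 0 z = ξ := by simp [T₀]
    have := hbound v 0 z
    rw [h0, sub_zero] at this
    calc ‖T₀ v z‖ = ‖ξ + (T₀ v z - ξ)‖ := by rw [add_sub_cancel]
      _ ≤ _ := (norm_add_le _ _).trans (by gcongr)
  let T : BoundedContinuousFunction (ℝ × ℝ) V → BoundedContinuousFunction (ℝ × ℝ) V := fun v =>
    BoundedContinuousFunction.ofNormedAddCommGroup (T₀ v) (hT₀ v) _ (hbd v)
  have hT : ContractingWith (1 / 4) T := by
    refine ⟨by rw [← NNReal.coe_lt_coe]; norm_num, LipschitzWith.of_dist_le_mul fun v w => ?_⟩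
    rw [BoundedContinuousFunction.dist_le (by positivity)]
    intro z
    rw [dist_eq_norm, dist_eq_norm]
    simpa [T] using hbound v w z
  refine ⟨hT.fixedPoint T, fun x y hx hy => ?_⟩
  have h : T (hT.fixedPoint T) (x, y) = hT.fixedPoint T (x, y) := by
    rw [hT.fixedPoint_isFixedPt]
  rw [← h]
  simp only [T, T₀, BoundedContinuousFunction.coe_ofNormedAddCommGroup, hcx _ _ hx, hcx _ _ hy]

end LocalFrobenius

/-! ### Local solvability of linear total differential systems: both equations hold. -/

section LocalFrobenius

open MeasureTheory intervalIntegral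

variable {V : Type*} [NormedAddCommGroup V] [NormedSpace ℝ V]

theorem abs_sub_lt_of_mem_uIcc {x₀ x s R : ℝ} (hx : |x - x₀| < R) (hs : s ∈ Set.uIcc x₀ x) :
    |s - x₀| < R :=
  (Set.abs_sub_left_of_mem_uIcc hs).trans_lt hx

/-- The classical criterion: partial derivatives existing near a point and continuous there give
differentiability. -/
theorem HasGrad.of_partial {f : ℝ × ℝ → V} {P Q : ℝ × ℝ → V} {z : ℝ × ℝ}
    (hx : ∀ᶠ w in nhds z, HasDerivAt (fun s => f (s, w.2)) (P w) w.1)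
    (hy : ∀ᶠ w in nhds z, HasDerivAt (fun t => f (w.1, t)) (Q w) w.2)
    (hP : ContinuousAt P z) (hQ : ContinuousAt Q z) : HasGrad f (P z) (Q z) z := by
  have h := hasStrictFDerivAt_uncurry_coprod (𝕜 := ℝ) (u := z) (f := fun s t => f (s, t))
    (f₁ := fun s t => ContinuousLinearMap.toSpanSingleton ℝ (P (s, t)))
    (f₂ := fun s t => ContinuousLinearMap.toSpanSingleton ℝ (Q (s, t)))
    (hx.mono fun w hw => hw.hasFDerivAt) (hy.mono fun w hw => hw.hasFDerivAt)
    ((ContinuousLinearMap.toSpanSingletonCLE (𝕜 := ℝ) (E := V)).continuous.continuousAt.comp hP)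
    ((ContinuousLinearMap.toSpanSingletonCLE (𝕜 := ℝ) (E := V)).continuous.continuousAt.comp hQ)
  exact .of_hasFDerivAt h.hasFDerivAt (by simp [Function.HasUncurry.uncurry])
    (by simp [Function.HasUncurry.uncurry])

variable [CompleteSpace V]

/-- The solution v of the integral equation satisfies v_y = Bv by construction, but v_x = Av only on
the line y = y₀. The error D = v − u, with u obtained from v by integrating Av along horizontal
lines starting at x = x₀, vanishes on y = y₀. By compatibility D satisfies a linear homogeneous
integro-differential equation in y, which forces D = 0 because the square is small. -/
theorem exists_solution_square_aux {A B Ay Bx : ℝ × ℝ → V →L[ℝ] V} (hA : Continuous A)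
    (hB : Continuous B) (hAy : Continuous Ay) (hBx : Continuous Bx)
    {M R : ℝ} (hR : 0 < R) (hR1 : R ≤ 1) (hAM : ∀ z, ‖A z‖ ≤ M) (hBM : ∀ z, ‖B z‖ ≤ M)
    (hAyM : ∀ z, ‖Ay z‖ ≤ M) (hBxM : ∀ z, ‖Bx z‖ ≤ M) (hMR : M * R ≤ 1 / 8) {x₀ y₀ : ℝ}
    (hAd : ∀ x y, |x - x₀| < R → |y - y₀| < R → HasDerivAt (fun t => A (x, t)) (Ay (x, y)) y)
    (hBd : ∀ x y, |x - x₀| < R → |y - y₀| < R → HasDerivAt (fun s => B (s, y)) (Bx (x, y)) x)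
    (hcomp : ∀ x y, |x - x₀| < R → |y - y₀| < R → ∀ ξ,
      Ay (x, y) ξ + A (x, y) (B (x, y) ξ) = Bx (x, y) ξ + B (x, y) (A (x, y) ξ)) (ξ : V) :
    ∃ v : ℝ × ℝ → V, v (x₀, y₀) = ξ ∧ ∀ x y, |x - x₀| < R → |y - y₀| < R →
      HasGrad v (A (x, y) (v (x, y))) (B (x, y) (v (x, y))) (x, y) := by
  have hM : 0 ≤ M := (norm_nonneg _).trans (hAM 0)
  obtain ⟨v, hv⟩ := exists_integral_solution hA hB hR hAM hBM hMR x₀ y₀ ξ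
  have hx₀ : |x₀ - x₀| < R := by simpa
  have hy₀ : |y₀ - y₀| < R := by simpa
  have hnhds : ∀ {m x : ℝ}, |x - m| < R → ∀ᶠ s in nhds x, |s - m| < R := fun {m x} h =>
    (continuous_abs.comp (continuous_sub_right m)).continuousAt.eventually_lt continuousAt_const h
  -- derivative in the second variable
  have hvy : ∀ x y, |x - x₀| < R → |y - y₀| < R →
      HasDerivAt (fun t => v (x, t)) (B (x, y) (v (x, y))) y := fun x y hx hy => by
    have h1 : HasDerivAt (fun u => ∫ t in y₀..u, B (x, t) (v (x, t))) (B (x, y) (v (x, y))) y :=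
      (Continuous.integral_hasStrictDerivAt (f := fun t => B (x, t) (v (x, t)))
        (by fun_prop) _ _).hasDerivAt
    refine (h1.const_add (ξ + ∫ s in x₀..x, A (s, y₀) (v (s, y₀)))).congr_of_eventuallyEq ?_
    filter_upwards [hnhds hy] with t ht
    exact hv x t hx.le ht.le
  let u : ℝ × ℝ → V := fun z => v (x₀, z.2) + ∫ s in x₀..z.1, A (s, z.2) (v (s, z.2))
  let D : ℝ × ℝ → V := fun z => v z - u z
  have hucont : ∀ y, Continuous fun x => u (x, y) := fun y => by
    have h : Continuous fun s => A (s, y) (v (s, y)) := by fun_prop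
    exact (continuous_primitive (μ := volume)
      (fun a b => h.intervalIntegrable a b) x₀).const_add (v (x₀, y))
  have hux : ∀ x y, HasDerivAt (fun s => u (s, y)) (A (x, y) (v (x, y))) x := fun x y => by
    have h : HasDerivAt (fun s => ∫ s in x₀..s, A (s, y) (v (s, y))) (A (x, y) (v (x, y))) x :=
      (Continuous.integral_hasStrictDerivAt (f := fun s => A (s, y) (v (s, y)))
        (by fun_prop) _ _).hasDerivAt
    exact h.const_add (v (x₀, y))
  have huy : ∀ x y, |x - x₀| < R → |y - y₀| < R →
      HasDerivAt (fun t => u (x, t)) (B (x₀, y) (v (x₀, y))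
        + ∫ s in x₀..x, (Ay (s, y) (v (s, y)) + A (s, y) (B (s, y) (v (s, y))))) y := by
    intro x y hx hy
    refine (hvy x₀ y hx₀ hy).add ?_
    -- Differentiation under the integral sign; only A_y and the known derivative v_y = Bv enter.
    refine (intervalIntegral.hasDerivAt_integral_of_dominated_loc_of_deriv_le (μ := volume)
      (F := fun t s => A (s, t) (v (s, t)))
      (F' := fun t s => Ay (s, t) (v (s, t)) + A (s, t) (B (s, t) (v (s, t))))
      (bound := fun _ => M * ‖v‖ + M * (M * ‖v‖)) (hnhds hy) ?_ ?_ ?_ ?_ ?_ ?_).2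
    · exact .of_forall fun t => Continuous.aestronglyMeasurable (by fun_prop)
    · exact Continuous.intervalIntegrable (by fun_prop) _ _
    · exact Continuous.aestronglyMeasurable (by fun_prop)
    · refine .of_forall fun s _ t _ => (norm_add_le _ _).trans (add_le_add ?_ ?_)
      · exact (ContinuousLinearMap.le_opNorm _ _).trans
          (mul_le_mul (hAyM _) (v.norm_coe_le_norm _) (norm_nonneg _) hM)
      · exact (ContinuousLinearMap.le_opNorm _ _).trans (mul_le_mul (hAM _)
          ((ContinuousLinearMap.le_opNorm _ _).trans
            (mul_le_mul (hBM _) (v.norm_coe_le_norm _) (norm_nonneg _) hM)) (norm_nonneg _) hM)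
    · exact intervalIntegrable_const
    · refine .of_forall fun s hs t ht => ?_
      have hs' := abs_sub_lt_of_mem_uIcc hx (Set.uIoc_subset_uIcc hs)
      exact (hAd s t hs' ht).clm_apply (hvy s t hs' ht)
  -- The fundamental theorem applied to s ↦ B(s, y)u(s, y), whose derivative is known because u_x =
  -- Av holds by construction.
  have hBu : ∀ x y, |x - x₀| < R → |y - y₀| < R →
      ∫ s in x₀..x, (Bx (s, y) (u (s, y)) + B (s, y) (A (s, y) (v (s, y))))
        = B (x, y) (u (x, y)) - B (x₀, y) (v (x₀, y)) := by
    intro x y hx hy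
    have hc := hucont y
    rw [integral_eq_sub_of_hasDerivAt (f := fun s => B (s, y) (u (s, y)))]
    · simp [u]
    · intro s hs
      exact (hBd s y (abs_sub_lt_of_mem_uIcc hx hs) hy).clm_apply (hux s y)
    · exact Continuous.intervalIntegrable (by fun_prop) _ _
  have hDy : ∀ x y, |x - x₀| < R → |y - y₀| < R →
      HasDerivAt (fun t => D (x, t)) (B (x, y) (D (x, y)) - ∫ s in x₀..x, Bx (s, y) (D (s, y))) y := by
    intro x y hx hy
    have hc := hucont y
    refine ((hvy x y hx hy).fun_sub (huy x y hx hy)).congr_deriv ?_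
    -- Compatibility trades A_y v + ABv for B_x v + BAv. Replacing v by u + D in the first summand
    -- leaves an exact derivative plus an integral of B_x D.
    have e : ∫ s in x₀..x, (Ay (s, y) (v (s, y)) + A (s, y) (B (s, y) (v (s, y))))
        = (∫ s in x₀..x, (Bx (s, y) (u (s, y)) + B (s, y) (A (s, y) (v (s, y)))))
          + ∫ s in x₀..x, Bx (s, y) (D (s, y)) := by
      rw [← integral_add (Continuous.intervalIntegrable (by fun_prop) _ _)
        (Continuous.intervalIntegrable (by fun_prop) _ _)]
      refine integral_congr fun s hs => ?_
      simp only [hcomp s y (abs_sub_lt_of_mem_uIcc hx hs) hy, D, map_sub]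
      abel
    rw [e, hBu x y hx hy]
    simp only [D, map_sub]
    abel
  have hD₀ : ∀ x, |x - x₀| < R → D (x, y₀) = 0 := fun x hx => by
    have h1 := hv x y₀ hx.le hy₀.le
    have h2 := hv x₀ y₀ hx₀.le hy₀.le
    simp only [integral_same, add_zero] at h1 h2
    simp [D, u, h1, h2]
  -- A bound C on the square improves itself: integrating D_y from y₀ gives at most MRC + MR²C ≤
  -- C/4, using MR ≤ 1/8 and R ≤ 1. Iteration then yields D = 0.
  have hstep : ∀ C : ℝ, (∀ x y, |x - x₀| < R → |y - y₀| < R → ‖D (x, y)‖ ≤ C) →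
      ∀ x y, |x - x₀| < R → |y - y₀| < R → ‖D (x, y)‖ ≤ C / 2 := by
    intro C hC x y hx hy
    have hC0 : 0 ≤ C := (norm_nonneg _).trans (hC x y hx hy)
    have hb : ∀ t ∈ Set.uIcc y₀ y,
        ‖B (x, t) (D (x, t)) - ∫ s in x₀..x, Bx (s, t) (D (s, t))‖ ≤ M * C + M * C * R := by
      intro t ht
      have ht' := abs_sub_lt_of_mem_uIcc hy ht
      refine (norm_sub_le _ _).trans (add_le_add ?_ ?_)
      · exact (ContinuousLinearMap.le_opNorm _ _).trans
          (mul_le_mul (hBM _) (hC _ _ hx ht') (norm_nonneg _) hM)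
      · refine (norm_integral_le_of_norm_le_const (C := M * C) fun s hs =>
          (ContinuousLinearMap.le_opNorm _ _).trans (mul_le_mul (hBxM _) (hC _ _
            (abs_sub_lt_of_mem_uIcc hx (Set.uIoc_subset_uIcc hs)) ht') (norm_nonneg _) hM)).trans ?_
        gcongr
    have := (convex_uIcc y₀ y).norm_image_sub_le_of_norm_hasDerivWithin_le
      (fun t ht => (hDy x t hx (abs_sub_lt_of_mem_uIcc hy ht)).hasDerivWithinAt) hb
      Set.left_mem_uIcc Set.right_mem_uIcc
    rw [hD₀ x hx, sub_zero, Real.norm_eq_abs] at this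
    refine this.trans ?_
    have h3 : (M * C + M * C * R) * |y - y₀| ≤ (M * C + M * C * R) * R := by gcongr
    have h4 : M * R * C ≤ 1 / 8 * C := by gcongr
    have h5 : M * R * C * R ≤ 1 / 8 * C * 1 := by gcongr
    linarith
  have hDb : ∀ x y, |x - x₀| < R → |y - y₀| < R → ‖D (x, y)‖ ≤ 3 * ‖v‖ := by
    intro x y hx hy
    have h1 : ‖∫ s in x₀..x, A (s, y) (v (s, y))‖ ≤ M * ‖v‖ * |x - x₀| :=
      norm_integral_le_of_norm_le_const fun s _ => (ContinuousLinearMap.le_opNorm _ _).trans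
        (mul_le_mul (hAM _) (v.norm_coe_le_norm _) (norm_nonneg _) hM)
    have h2 : M * ‖v‖ * |x - x₀| ≤ M * ‖v‖ * R := by gcongr
    have h3 : M * R * ‖v‖ ≤ 1 / 8 * ‖v‖ := by gcongr
    have h4 := norm_sub_le (v (x, y)) (u (x, y))
    have h5 := norm_add_le (v (x₀, y)) (∫ s in x₀..x, A (s, y) (v (s, y)))
    have h6 := v.norm_coe_le_norm (x, y)
    have h7 := v.norm_coe_le_norm (x₀, y)
    have h8 := norm_nonneg v
    simp only [D, u] at h4 h5 ⊢
    linarith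
  have hD : ∀ x y, |x - x₀| < R → |y - y₀| < R → D (x, y) = 0 := by
    have hn : ∀ n : ℕ, ∀ x y, |x - x₀| < R → |y - y₀| < R → ‖D (x, y)‖ ≤ 3 * ‖v‖ * (1 / 2) ^ n := by
      intro n
      induction n with
      | zero => simpa using hDb
      | succ n ih =>
        intro x y hx hy
        have := hstep _ ih x y hx hy
        rw [pow_succ]
        linarith
    intro x y hx hy
    have hlim : Filter.Tendsto (fun n : ℕ => 3 * ‖v‖ * (1 / 2 : ℝ) ^ n) Filter.atTop (nhds 0) := by
      simpa using (tendsto_pow_atTop_nhds_zero_of_lt_one (by norm_num : (0 : ℝ) ≤ 1 / 2)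
        (by norm_num)).const_mul (3 * ‖v‖)
    exact norm_le_zero_iff.1 (ge_of_tendsto' hlim fun n => hn n x y hx hy)
  have hvx : ∀ x y, |x - x₀| < R → |y - y₀| < R →
      HasDerivAt (fun s => v (s, y)) (A (x, y) (v (x, y))) x := fun x y hx hy => by
    refine (hux x y).congr_of_eventuallyEq ?_
    filter_upwards [hnhds hx] with s hs
    exact sub_eq_zero.1 (hD s y hs hy)
  refine ⟨v, ?_, fun x y hx hy => ?_⟩
  · simpa using hv x₀ y₀ hx₀.le hy₀.le
  have hev : ∀ᶠ w in nhds (x, y), |w.1 - x₀| < R ∧ |w.2 - y₀| < R :=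
    (continuous_fst.continuousAt.eventually (hnhds hx)).and
      (continuous_snd.continuousAt.eventually (hnhds hy))
  exact HasGrad.of_partial (P := fun z => A z (v z)) (Q := fun z => B z (v z))
    (hev.mono fun w hw => hvx w.1 w.2 hw.1 hw.2) (hev.mono fun w hw => hvy w.1 w.2 hw.1 hw.2)
    (by fun_prop) (by fun_prop)

end LocalFrobenius

/-! ### Uniqueness and global solvability on simply connected domains. -/

section GlobalFrobenius

variable {V : Type*} [NormedAddCommGroup V] [NormedSpace ℝ V]

/-- `v` solves the linear total differential equation `dv = A v dx + B v dy` on `S`. -/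
def IsLinearSolution (A B : ℝ × ℝ → V →L[ℝ] V) (S : Set (ℝ × ℝ)) (v : ℝ × ℝ → V) : Prop :=
  ∀ z ∈ S, HasGrad v (A z (v z)) (B z (v z)) z

theorem IsLinearSolution.mono {A B : ℝ × ℝ → V →L[ℝ] V} {S T : Set (ℝ × ℝ)} {v : ℝ × ℝ → V}
    (h : IsLinearSolution A B T v) (hST : S ⊆ T) : IsLinearSolution A B S v :=
  fun z hz => h z (hST hz)

theorem IsLinearSolution.sub {A B : ℝ × ℝ → V →L[ℝ] V} {S : Set (ℝ × ℝ)} {v w : ℝ × ℝ → V}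
    (hv : IsLinearSolution A B S v) (hw : IsLinearSolution A B S w) :
    IsLinearSolution A B S (fun z => v z - w z) := fun z hz =>
  ((hv z hz).sub (hw z hz)).congr_grad (map_sub _ _ _).symm (map_sub _ _ _).symm

theorem HasGrad.hasDerivAt_line {v : ℝ × ℝ → V} {P Q : V} {z h : ℝ × ℝ} {t : ℝ}
    (hv : HasGrad v P Q (z + t • h)) :
    HasDerivAt (fun s : ℝ => v (z + s • h)) (h.1 • P + h.2 • Q) t := by
  have hl : HasDerivAt (fun s : ℝ => z + s • h) h t := by
    simpa using ((hasDerivAt_id t).smul_const h).const_add z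
  unfold HasGrad at hv
  have := HasFDerivAt.comp_hasDerivAt (f := fun s : ℝ => z + s • h) t hv hl
  simpa [Function.comp_def] using this

theorem IsLinearSolution.eq_zero_of_convex {A B : ℝ × ℝ → V →L[ℝ] V} {S : Set (ℝ × ℝ)}
    (hS : Convex ℝ S) {M : ℝ} (hA : ∀ z ∈ S, ‖A z‖ ≤ M) (hB : ∀ z ∈ S, ‖B z‖ ≤ M)
    {v : ℝ × ℝ → V} (hv : IsLinearSolution A B S v) {w : ℝ × ℝ} (hw : w ∈ S) (h0 : v w = 0)
    {z : ℝ × ℝ} (hz : z ∈ S) : v z = 0 := by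
  have hseg : ∀ t ∈ Set.Icc (0 : ℝ) 1, w + t • (z - w) ∈ S := fun t ht =>
    hS.add_smul_sub_mem hw hz ht
  have hd := fun t ht => (hv _ (hseg t ht)).hasDerivAt_line
  -- Grönwall's inequality along the segment from w to z, on which the derivative of v is bounded by
  -- a constant times v.
  have := eq_zero_of_abs_deriv_le_mul_abs_self_of_eq_zero_right (a := 0) (b := 1)
    (K := |(z - w).1| * M + |(z - w).2| * M)
    (fun t ht => (hd t ht).continuousAt.continuousWithinAt)
    (fun t ht => (hd t (Set.Ico_subset_Icc_self ht)).hasDerivWithinAt) (by simpa using h0) ?_ 1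
    (by simp)
  · simpa using this
  · intro t ht
    have ht := hseg t (Set.Ico_subset_Icc_self ht)
    refine (norm_add_le _ _).trans ?_
    rw [norm_smul, norm_smul, Real.norm_eq_abs, Real.norm_eq_abs, add_mul, mul_assoc, mul_assoc]
    gcongr
    · exact (ContinuousLinearMap.le_opNorm _ _).trans (by gcongr; exact hA _ ht)
    · exact (ContinuousLinearMap.le_opNorm _ _).trans (by gcongr; exact hB _ ht)

/-- The radius is left as a filter variable so that bounds for several coefficients can be met by
one ball. -/
theorem exists_ball_norm_le {F : Type*} [NormedAddCommGroup F] {U : Set (ℝ × ℝ)} (hU : IsOpen U)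
    {A : ℝ × ℝ → F} (hA : ContinuousOn A U) {z : ℝ × ℝ} (hz : z ∈ U) :
    ∀ᶠ δ in nhdsWithin (0 : ℝ) (Set.Ioi 0), Metric.ball z δ ⊆ U ∧
      ∀ w ∈ Metric.ball z δ, ‖A w‖ ≤ ‖A z‖ + 1 := by
  have h : ∀ᶠ w in nhds z, w ∈ U ∧ ‖A w‖ ≤ ‖A z‖ + 1 :=
    (hU.eventually_mem hz).and (((hA.continuousAt (hU.mem_nhds hz)).norm.eventually_lt
      continuousAt_const (lt_add_one _)).mono fun w hw => hw.le)
  obtain ⟨δ, hδ, h⟩ := Metric.eventually_nhds_iff_ball.1 h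
  filter_upwards [Ioc_mem_nhdsGT hδ] with r hr
  exact ⟨fun w hw => (h w (Metric.ball_subset_ball hr.2 hw)).1,
    fun w hw => (h w (Metric.ball_subset_ball hr.2 hw)).2⟩

/-- The difference of two solutions is a solution. If it vanishes at a point it vanishes on a ball
around it, so U is covered by the open set of points near which it vanishes and the open set where
it does not; connectedness excludes the second. -/
theorem IsLinearSolution.eqOn {A B : ℝ × ℝ → V →L[ℝ] V} {U : Set (ℝ × ℝ)} (hU : IsOpen U)
    (hc : IsPreconnected U) (hA : ContinuousOn A U) (hB : ContinuousOn B U) {v w : ℝ × ℝ → V}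
    (hv : IsLinearSolution A B U v) (hw : IsLinearSolution A B U w) {z₀ : ℝ × ℝ} (hz₀ : z₀ ∈ U)
    (h₀ : v z₀ = w z₀) : Set.EqOn v w U := by
  have hd := hv.sub hw
  set d := fun z => v z - w z
  have hdc : ContinuousOn d U := fun z hz =>
    (hd z hz).differentiableAt.continuousAt.continuousWithinAt
  have hloc : ∀ z ∈ U, d z = 0 → ∀ᶠ y in nhds z, d y = 0 := by
    intro z hz h
    obtain ⟨δ, ⟨⟨h1, h2⟩, -, h3⟩, hδ⟩ := ((exists_ball_norm_le hU hA hz).and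
      (exists_ball_norm_le hU hB hz)).and self_mem_nhdsWithin |>.exists
    refine Metric.eventually_nhds_iff_ball.2 ⟨δ, hδ, fun y hy => ?_⟩
    exact (hd.mono h1).eq_zero_of_convex (convex_ball z δ)
      (fun w hw => (h2 w hw).trans (le_max_left _ _)) (fun w hw => (h3 w hw).trans (le_max_right _ _))
      (Metric.mem_ball_self hδ) h hy
  by_contra hne
  obtain ⟨z₁, hz₁, hne⟩ : ∃ z ∈ U, v z ≠ w z := by simpa [Set.EqOn] using hne
  have hT : IsOpen (U ∩ d ⁻¹' {0}ᶜ) := hdc.isOpen_inter_preimage hU isOpen_compl_singleton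
  obtain ⟨z, -, hz1, hz2⟩ := hc _ _ (isOpen_setOfPred_eventually_nhds (p := fun y => d y = 0)) hT
    (fun z hz => (eq_or_ne (d z) 0).imp (hloc z hz) fun h => ⟨hz, h⟩)
    ⟨z₀, hz₀, hloc z₀ hz₀ (sub_eq_zero.2 h₀)⟩ ⟨z₁, hz₁, hz₁, sub_ne_zero.2 hne⟩
  exact hz2.2 hz1.self_of_nhds

theorem HasGrad.hasDerivAt_fst {v : ℝ × ℝ → V} {P Q : V} {x y : ℝ} (hv : HasGrad v P Q (x, y)) :
    HasDerivAt (fun s => v (s, y)) P x := by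
  have h := HasGrad.hasDerivAt_line (z := (0, y)) (h := (1, 0)) (t := x) (by simpa using hv)
  simpa using h

theorem HasGrad.hasDerivAt_snd {v : ℝ × ℝ → V} {P Q : V} {x y : ℝ} (hv : HasGrad v P Q (x, y)) :
    HasDerivAt (fun t => v (x, t)) Q y := by
  have h := HasGrad.hasDerivAt_line (z := (x, 0)) (h := (0, 1)) (t := y) (by simpa using hv)
  simpa using h

variable [CompleteSpace V]

/-- A compatible linear total differential equation is locally solvable, uniformly in the
point where the initial value is prescribed. -/
theorem exists_ball_forall_exists_solution {A B : ℝ × ℝ → V →L[ℝ] V} {U : Set (ℝ × ℝ)}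
    (hU : IsOpen U) (hA : ContDiffOn ℝ 1 A U) (hB : ContDiffOn ℝ 1 B U)
    (hcomp : ∀ z ∈ U, ∀ ξ, dy A z ξ + A z (B z ξ) = dx B z ξ + B z (A z ξ))
    {z₁ : ℝ × ℝ} (hz₁ : z₁ ∈ U) :
    ∃ δ > 0, Metric.ball z₁ δ ⊆ U ∧ ∀ w ∈ Metric.ball z₁ δ, ∀ ξ, ∃ v, v w = ξ ∧
      IsLinearSolution A B (Metric.ball z₁ δ) v := by
  have hAy := (contDiffOn_dy hU hA (m := 0) (by simp)).continuousOn
  have hBx := (contDiffOn_dx hU hB (m := 0) (by simp)).continuousOn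
  obtain ⟨δ, ⟨⟨h1, h2⟩, ⟨-, h3⟩, ⟨-, h4⟩, -, h5⟩, hδ⟩ :=
    ((exists_ball_norm_le hU hA.continuousOn hz₁).and
    ((exists_ball_norm_le hU hB.continuousOn hz₁).and ((exists_ball_norm_le hU hAy hz₁).and
    (exists_ball_norm_le hU hBx hz₁)))).and self_mem_nhdsWithin |>.exists
  replace hδ : 0 < δ := hδ
  obtain ⟨M, hM0, hMA, hMB, hMAy, hMBx⟩ : ∃ M : ℝ, 0 < M ∧ ‖A z₁‖ + 1 ≤ M ∧ ‖B z₁‖ + 1 ≤ M ∧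
      ‖dy A z₁‖ + 1 ≤ M ∧ ‖dx B z₁‖ + 1 ≤ M := by
    refine ⟨‖A z₁‖ + ‖B z₁‖ + ‖dy A z₁‖ + ‖dx B z₁‖ + 1, by positivity, ?_, ?_, ?_, ?_⟩ <;>
      linarith [norm_nonneg (A z₁), norm_nonneg (B z₁), norm_nonneg (dy A z₁),
        norm_nonneg (dx B z₁)]
  -- The three terms provide R ≤ 1, MR ≤ 1/8, and that a square of half-side R centred in the ball
  -- of radius R/2 stays in the ball of radius δ. Conversely any point of the R/2-ball is within R
  -- of any chosen initial point w, so a single ball serves all of them.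
  let R := min 1 (min (1 / (8 * M)) (δ / 3))
  have hR : 0 < R := by positivity
  have hR1 : R ≤ 1 := min_le_left _ _
  have hRM : M * R ≤ 1 / 8 := by
    have : R ≤ 1 / (8 * M) := (min_le_right _ _).trans (min_le_left _ _)
    rw [le_div_iff₀ (by positivity)] at this
    linarith
  have hRδ : R ≤ δ / 3 := (min_le_right _ _).trans (min_le_right _ _)
  refine ⟨R / 2, by positivity, (Metric.ball_subset_ball (by linarith)).trans h1,
    fun w hw ξ => ?_⟩
  let c : ℝ → ℝ → ℝ := fun m x => max (m - R) (min (m + R) x)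
  have hcc : ∀ m, Continuous (c m) := fun m => by fun_prop
  have hcm : ∀ m x, |c m x - m| ≤ R := fun m x => by
    rw [abs_le]
    constructor
    · have := le_max_left (m - R) (min (m + R) x); simp only [c]; linarith
    · have : c m x ≤ m + R := max_le (by linarith) (min_le_left _ _)
      linarith
  have hcx : ∀ m x, |x - m| < R → c m x = x := fun m x h => by
    rw [abs_lt] at h
    simp only [c]
    rw [min_eq_right (by linarith), max_eq_right (by linarith)]
  -- Composition with this retraction onto the square makes the coefficients continuous and bounded
  -- on the whole plane without changing them on the square.
  let π : ℝ × ℝ → ℝ × ℝ := fun z => (c w.1 z.1, c w.2 z.2)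
  have hπc : Continuous π := by fun_prop
  have hπ : ∀ z, π z ∈ Metric.ball z₁ δ := fun z => by
    have : dist (π z) w ≤ R := by
      rw [Prod.dist_eq, Real.dist_eq, Real.dist_eq]
      exact max_le (hcm _ _) (hcm _ _)
    rw [Metric.mem_ball] at hw ⊢
    linarith [dist_triangle (π z) w z₁]
  have hπU : ∀ z, π z ∈ U := fun z => h1 (hπ z)
  have hπx : ∀ x y, |x - w.1| < R → |y - w.2| < R → π (x, y) = (x, y) := fun x y hx hy => by
    simp [π, hcx _ _ hx, hcx _ _ hy]
  have hcont : ∀ {F : ℝ × ℝ → V →L[ℝ] V}, ContinuousOn F U → Continuous (F ∘ π) := fun hF =>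
    hF.comp_continuous hπc hπU
  have hnhds : ∀ {m x : ℝ}, |x - m| < R → ∀ᶠ s in nhds x, |s - m| < R := fun {m x} h =>
    (continuous_abs.comp (continuous_sub_right m)).continuousAt.eventually_lt continuousAt_const h
  have hAd : ∀ x y, |x - w.1| < R → |y - w.2| < R →
      HasDerivAt (fun t => (A ∘ π) (x, t)) ((dy A ∘ π) (x, y)) y := by
    intro x y hx hy
    have hmem := hπU (x, y)
    simp only [Function.comp_apply, hπx x y hx hy] at hmem ⊢
    refine (hA.hasGrad hU le_rfl hmem).hasDerivAt_snd.congr_of_eventuallyEq ?_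
    filter_upwards [hnhds hy] with t ht
    rw [hπx x t hx ht]
  have hBd : ∀ x y, |x - w.1| < R → |y - w.2| < R →
      HasDerivAt (fun s => (B ∘ π) (s, y)) ((dx B ∘ π) (x, y)) x := by
    intro x y hx hy
    have hmem := hπU (x, y)
    simp only [Function.comp_apply, hπx x y hx hy] at hmem ⊢
    refine (hB.hasGrad hU le_rfl hmem).hasDerivAt_fst.congr_of_eventuallyEq ?_
    filter_upwards [hnhds hx] with t ht
    rw [hπx t y ht hy]
  obtain ⟨v, hv0, hv⟩ := exists_solution_square_aux (hcont hA.continuousOn)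
    (hcont hB.continuousOn) (hcont hAy) (hcont hBx) hR hR1
    (fun z => (h2 _ (hπ z)).trans hMA) (fun z => (h3 _ (hπ z)).trans hMB)
    (fun z => (h4 _ (hπ z)).trans hMAy) (fun z => (h5 _ (hπ z)).trans hMBx) hRM hAd hBd
    (fun x y hx hy => hcomp _ (hπU (x, y))) ξ
  refine ⟨v, hv0, fun z hz => ?_⟩
  have hzw : dist z w < R := by
    have := dist_triangle_right z w z₁
    rw [Metric.mem_ball] at hz hw
    linarith
  rw [Prod.dist_eq, max_lt_iff, Real.dist_eq, Real.dist_eq] at hzw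
  have := hv z.1 z.2 hzw.1 hzw.2
  rwa [Function.comp_apply, Function.comp_apply, hπx _ _ hzw.1 hzw.2] at this

/-- The fibre of the covering space of germs of solutions: the vector space with the discrete
topology. -/
def DiscreteFiber (V : Type*) := V

instance (V : Type*) : TopologicalSpace (DiscreteFiber V) := ⊥

instance (V : Type*) : DiscreteTopology (DiscreteFiber V) := ⟨rfl⟩

/-- A compatible linear total differential equation is globally solvable on a simply connected
domain. -/
theorem exists_isLinearSolution {A B : ℝ × ℝ → V →L[ℝ] V} {U : Set (ℝ × ℝ)} (hU : IsOpen U)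
    (hUc : IsSimplyConnected U) (hA : ContDiffOn ℝ 1 A U) (hB : ContDiffOn ℝ 1 B U)
    (hcomp : ∀ z ∈ U, ∀ ξ, dy A z ξ + A z (B z ξ) = dx B z ξ + B z (A z ξ))
    {z₀ : ℝ × ℝ} (hz₀ : z₀ ∈ U) (ξ : V) : ∃ v, v z₀ = ξ ∧ IsLinearSolution A B U v := by
  -- Here `sol i z v` is a solution on the ball around i with the value v at z.
  choose! δ hδ hball sol hsol0 hsol using fun z₁ (hz₁ : z₁ ∈ U) =>
    exists_ball_forall_exists_solution hU hA hB hcomp hz₁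
  -- two solutions on a convex subset that agree at a point are equal
  have huniq : ∀ {S : Set (ℝ × ℝ)}, IsOpen S → Convex ℝ S → S ⊆ U → ∀ {v w : ℝ × ℝ → V},
      IsLinearSolution A B S v → IsLinearSolution A B S w → ∀ {z}, z ∈ S → v z = w z →
      ∀ {z'}, z' ∈ S → v z' = w z' := fun hS hSc hSU _ _ hv hw _ hz h _ hz' =>
    hv.eqOn hS hSc.isPreconnected (hA.continuousOn.mono hSU) (hB.continuousOn.mono hSU) hw hz h hz'
  have hself : ∀ i ∈ U, i ∈ Metric.ball i (δ i) := fun i hi => Metric.mem_ball_self (hδ i hi)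
  have hloc : ∀ i ∈ U, ∀ z ∈ Metric.ball i (δ i), ∀ v z', z' ∈ Metric.ball i (δ i) →
      sol i i (sol i z v i) z' = sol i z v z' := fun i hi z hz v z' hz' =>
    huniq Metric.isOpen_ball (convex_ball _ _) (hball i hi)
      (hsol i hi i (hself i hi) _) (hsol i hi z hz v) (hself i hi) (hsol0 i hi i (hself i hi) _) hz'
  have hloc' : ∀ i ∈ U, ∀ z ∈ Metric.ball i (δ i), ∀ v w, w ∈ Metric.ball i (δ i) →
      sol i z (sol i w v z) i = sol i w v i := fun i hi z hz v w hw =>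
    huniq Metric.isOpen_ball (convex_ball _ _) (hball i hi)
      (hsol i hi z hz _) (hsol i hi w hw v) hz (hsol0 i hi z hz _) (hself i hi)
  -- The bundle of germs of solutions: chart i records a germ by the value that its solution on the
  -- i-th ball takes at the centre i. A change of charts evaluates at z and continues within the
  -- other ball.
  let Z : FiberBundleCore U U (DiscreteFiber V) :=
    { baseSet := fun i => {z | (z : ℝ × ℝ) ∈ Metric.ball (i : ℝ × ℝ) (δ i)}
      isOpen_baseSet := fun i => Metric.isOpen_ball.preimage continuous_subtype_val
      indexAt := id
      mem_baseSet_at := fun x => hself x x.2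
      coordChange := fun i j z v => (sol j z (sol i i v z) j : V)
      coordChange_self := fun i x hx v => by
        exact (hloc' i i.2 x hx v i (hself i i.2)).trans (hsol0 i i.2 i (hself i i.2) v)
      continuousOn_coordChange := by
        -- On the convex intersection of two balls, two solutions that agree at one point agree
        -- everywhere, so the change of charts does not depend on the base point there and is
        -- locally constant.
        rintro i j ⟨z, v⟩ ⟨⟨hzi, hzj⟩, -⟩
        refine ContinuousAt.continuousWithinAt ?_
        let c : DiscreteFiber V := sol j z (sol i i v z) j
        refine (continuousAt_const (y := c)).congr ?_
        have h1 : ∀ᶠ q : U × DiscreteFiber V in nhds (z, v),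
            (q.1 : ℝ × ℝ) ∈ Metric.ball (i : ℝ × ℝ) (δ i) ∩ Metric.ball (j : ℝ × ℝ) (δ j) :=
          (continuous_subtype_val.comp continuous_fst).continuousAt.eventually
            ((Metric.isOpen_ball.inter Metric.isOpen_ball).eventually_mem ⟨hzi, hzj⟩)
        have h2 : ∀ᶠ q : U × DiscreteFiber V in nhds (z, v), q.2 = v :=
          continuous_snd.continuousAt.eventually
            ((isOpen_discrete ({v} : Set (DiscreteFiber V))).eventually_mem (Set.mem_singleton v))
        filter_upwards [h1, h2] with q hq hqv
        obtain ⟨q, v'⟩ := q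
        obtain rfl : v' = v := hqv
        -- the solutions through `z` and `q` in the `j`-th ball agree
        have e1 := huniq (Metric.isOpen_ball.inter Metric.isOpen_ball)
          ((convex_ball _ _).inter (convex_ball _ _))
          (Set.inter_subset_left.trans (hball i i.2))
          ((hsol i i.2 i (hself i i.2) v').mono Set.inter_subset_left)
          ((hsol j j.2 z hzj (sol i i v' z)).mono Set.inter_subset_right)
          (z := (z : ℝ × ℝ)) ⟨hzi, hzj⟩ (hsol0 j j.2 z hzj _).symm hq
        have e2 := hloc' j j.2 q hq.2 (sol i i v' z) z hzj
        exact e2.symm.trans (congrArg (fun y : V => sol j q y j) e1.symm)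
      coordChange_comp := by
        rintro i j k x ⟨⟨hi, hj⟩, hk⟩ v
        change sol k x (sol j j (sol j x (sol i i v x) j) x) k = sol k x (sol i i v x) k
        rw [hloc j j.2 x hj _ x hj, hsol0 j j.2 x hj] }
  -- Discrete fibres make the bundle a covering. Over a simply connected, locally path connected
  -- base the identity lifts to a section, which is the global solution.
  have hcov : IsCoveringMap Z.proj :=
    IsFiberBundle.isCoveringMap fun x => ⟨Z.localTriv x, hself x x.2⟩
  have := hUc.simplyConnectedSpace
  have := hU.locallyPathConnectedSpace
  obtain ⟨F, ⟨hF0, hF⟩, -⟩ := hcov.existsUnique_continuousMap_lifts (ContinuousMap.id U) ⟨z₀, hz₀⟩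
    ⟨⟨z₀, hz₀⟩, (ξ : V)⟩ rfl
  have hF1 : ∀ z, (F z).1 = z := fun z => congrFun hF z
  -- Each point is the centre of its own chart, so the fibre coordinate of the section is the value
  -- of the solution at that point.
  let s : U → V := fun z => (F z).2
  classical
  let v : ℝ × ℝ → V := fun z => if hz : z ∈ U then s ⟨z, hz⟩ else 0
  refine ⟨v, ?_, fun z₁ hz₁ => ?_⟩
  · have hs : s ⟨z₀, hz₀⟩ = ξ := congrArg (fun q : Z.TotalSpace => (q.2 : V)) hF0
    exact (dif_pos hz₀).trans hs
  have hcont : ContinuousAt (fun z => (Z.localTriv ⟨z₁, hz₁⟩ (F z)).2) ⟨z₁, hz₁⟩ := by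
    refine continuous_snd.continuousAt.comp (ContinuousAt.comp ?_ F.continuous.continuousAt)
    refine (Z.localTriv ⟨z₁, hz₁⟩).continuousAt ?_
    rw [Bundle.Trivialization.mem_source]
    have : Z.proj (F ⟨z₁, hz₁⟩) = ⟨z₁, hz₁⟩ := hF1 _
    rw [this]
    exact hself z₁ hz₁
  have hval : ∀ z : U, (Z.localTriv ⟨z₁, hz₁⟩ (F z)).2 = sol z₁ z (s z) z₁ := fun z => by
    rw [FiberBundleCore.localTriv_apply]
    change sol z₁ (F z).1 (sol (F z).1 (F z).1 (s z) (F z).1) z₁ = _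
    rw [hF1, hsol0 z z.2 z (hself z z.2)]
  have hev : ∀ᶠ z : U in nhds ⟨z₁, hz₁⟩, sol z₁ z (s z) z₁ = s ⟨z₁, hz₁⟩ := by
    -- The fibre is discrete, so continuity of the section in the chart z₁ means that near z₁ it is
    -- represented by one single solution.
    have h := hcont.eventually (p := fun w => w = (Z.localTriv ⟨z₁, hz₁⟩ (F ⟨z₁, hz₁⟩)).2)
      (by simp [nhds_discrete])
    filter_upwards [h] with z hz
    rw [hval, hval] at hz
    exact hz.trans (hsol0 z₁ hz₁ z₁ (hself z₁ hz₁) _)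
  have hevU : v =ᶠ[nhds z₁] sol z₁ z₁ (s ⟨z₁, hz₁⟩) := by
    have h1 : ∀ᶠ z in nhds z₁, ∀ hz : z ∈ U, sol z₁ z (s ⟨z, hz⟩) z₁ = s ⟨z₁, hz₁⟩ := by
      rw [nhds_subtype_eq_comap, Filter.eventually_comap] at hev
      filter_upwards [hev] with z hz hzU
      exact hz ⟨z, hzU⟩ rfl
    filter_upwards [h1, hU.eventually_mem hz₁,
      Metric.isOpen_ball.eventually_mem (hself z₁ hz₁)] with z hz hzU hzb
    simp only [v, hzU, dif_pos]
    rw [← hz hzU, hloc z₁ hz₁ z hzb _ z hzb, hsol0 z₁ hz₁ z hzb]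
  have h := hsol z₁ hz₁ z₁ (hself z₁ hz₁) (s ⟨z₁, hz₁⟩) z₁ (hself z₁ hz₁)
  exact h.congr hevU (by rw [hevU.self_of_nhds]) (by rw [hevU.self_of_nhds])

end GlobalFrobenius

/-! ### Pointwise algebra of the Lelieuvre formulae. -/

section LelieuvreAlgebra

variable {𝕜 : Type*} [RCLike 𝕜] {ε : ℝ}

/-- Cramer's rule: up to the factor `vol u v w`, the three cross products form the dual basis. -/
theorem vol_smul_eq (hε : ε = 1 ∨ ε = -1) (u v w x : Vec 𝕜) :
    vol u v w • x = dot ε x u • cross ε v w + dot ε x v • cross ε w u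
      + dot ε x w • cross ε u v := by
  rcases hε with rfl | rfl <;> ext i <;> fin_cases i <;> simp [cross_eq, dot_eq, vol_eq] <;> ring

theorem eq_of_dot_eq (hε : ε = 1 ∨ ε = -1) {u v w x y : Vec 𝕜} (hV : vol u v w ≠ 0)
    (hu : dot ε x u = dot ε y u) (hv : dot ε x v = dot ε y v) (hw : dot ε x w = dot ε y w) :
    x = y := by
  refine smul_right_injective _ hV ?_
  simp only [vol_smul_eq hε, hu, hv, hw]

/-- Expand u × (u × v) = 0. For non-isotropic u it says that v is a multiple of u. -/
theorem smul_eq_of_cross_eq_zero (hε : ε = 1 ∨ ε = -1) {u v : Vec 𝕜} (h : cross ε u v = 0) :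
    dot ε u u • v = dot ε u v • u := by
  have := cross_cross hε u u v
  rw [h] at this
  have h0 : cross ε u (0 : Vec 𝕜) = 0 := by ext i; fin_cases i <;> simp [cross_eq]
  rw [h0] at this
  exact (sub_eq_zero.1 this.symm).symm

/-- Scalar products of the derivatives of the position vector given by the Lelieuvre formulae. -/
theorem lelieuvre_dot (hε : ε = 1 ∨ ε = -1) (a b c : 𝕜) (N X Y : Vec 𝕜) :
    dot ε N (cross ε (b • Y + c • X) N) = 0 ∧ dot ε N (cross ε N (a • X + c • Y)) = 0 ∧
    dot ε X (cross ε (b • Y + c • X) N) = b * vol N X Y ∧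
    dot ε Y (cross ε (b • Y + c • X) N) = -(c * vol N X Y) ∧
    dot ε X (cross ε N (a • X + c • Y)) = -(c * vol N X Y) ∧
    dot ε Y (cross ε N (a • X + c • Y)) = a * vol N X Y := by
  simp only [dot_cross hε, vol_eq, Pi.add_apply, Pi.smul_apply, smul_eq_mul]
  refine ⟨?_, ?_, ?_, ?_, ?_, ?_⟩ <;> ring

/-- The two tangent vectors have the cross product ΔV·N with V = vol(N, X, Y); Lagrange's identity
gives its square. -/
theorem lelieuvre_detI (hε : ε = 1 ∨ ε = -1) (a b c : 𝕜) (N X Y : Vec 𝕜) :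
    dot ε (cross ε (b • Y + c • X) N) (cross ε (b • Y + c • X) N) *
        dot ε (cross ε N (a • X + c • Y)) (cross ε N (a • X + c • Y)) -
      dot ε (cross ε (b • Y + c • X) N) (cross ε N (a • X + c • Y)) ^ 2
      = dot ε N N * ((a * b - c ^ 2) * vol N X Y) ^ 2 := by
  obtain ⟨h1, -, h3, h4, -, -⟩ := lelieuvre_dot hε a b c N X Y
  have hW : cross ε (cross ε (b • Y + c • X) N) (cross ε N (a • X + c • Y))
      = ((a * b - c ^ 2) * vol N X Y) • N := by
    rw [cross_cross hε, dot_comm _ N, h1, zero_smul, sub_zero, dot_comm, dot_add_left,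
      dot_smul_left, dot_smul_left, h3, h4]
    congr 1
    ring
  have h := dot_cross_cross hε (cross ε (b • Y + c • X) N) (cross ε N (a • X + c • Y))
    (cross ε (b • Y + c • X) N) (cross ε N (a • X + c • Y))
  rw [hW, dot_smul_left, dot_smul_right] at h
  rw [dot_comm (cross ε N (a • X + c • Y)) (cross ε (b • Y + c • X) N)] at h
  linear_combination -h

/-- Both sides have the same products with the basis N, X, Y. The symmetry Y·S = X·T is what allows
the same coefficient c in the two formulae. -/
theorem lelieuvre_of_dot (hε : ε = 1 ∨ ε = -1) {N X Y S T : Vec 𝕜} (hV : vol N X Y ≠ 0)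
    (hS : dot ε N S = 0) (hT : dot ε N T = 0) (hST : dot ε Y S = dot ε X T) :
    S = cross ε ((dot ε X S / vol N X Y) • Y + (-dot ε Y S / vol N X Y) • X) N ∧
    T = cross ε N ((dot ε Y T / vol N X Y) • X + (-dot ε Y S / vol N X Y) • Y) := by
  obtain ⟨h1, h2, h3, h4, h5, h6⟩ := lelieuvre_dot hε (dot ε Y T / vol N X Y)
    (dot ε X S / vol N X Y) (-dot ε Y S / vol N X Y) N X Y
  constructor <;> refine eq_of_dot_eq hε hV ?_ ?_ ?_ <;> rw [dot_comm, dot_comm (cross _ _ _)]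
  · rw [h1, hS]
  · rw [h3]; field_simp
  · rw [h4]; field_simp
  · rw [h2, hT]
  · rw [h5, ← hST]; field_simp
  · rw [h6]; field_simp

/-- As N is orthogonal to S and T, the vector S × T is parallel to N; pair this with X × Y. With S,
T the tangent vectors and X, Y the derivatives of N, the determinant on the left is that of the
second fundamental form, so curvature forces vol(N, N_x, N_y) ≠ 0. -/
theorem dot_mul_det_eq (hε : ε = 1 ∨ ε = -1) {N X Y S T : Vec 𝕜}
    (hS : dot ε N S = 0) (hT : dot ε N T = 0) :
    dot ε N N * (dot ε X S * dot ε Y T - dot ε X T * dot ε Y S) = vol N X Y * vol N S T := by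
  have hW : cross ε N (cross ε S T) = 0 := by rw [cross_cross hε, hS, hT]; simp
  have h := congrArg (dot ε (cross ε X Y)) (smul_eq_of_cross_eq_zero hε hW)
  rw [dot_smul_right, dot_smul_right, dot_cross_cross hε, dot_cross_left hε, dot_cross hε] at h
  linear_combination h

end LelieuvreAlgebra

/-! ### Fundamental forms of a surface given by the Lelieuvre formulae. -/

section LelieuvreAnalysis

variable {𝕜 : Type*} [RCLike 𝕜] {ε : ℝ} {U : Set (ℝ × ℝ)}

theorem real_smul_vec (t : ℝ) (v : Vec 𝕜) : t • v = (t : 𝕜) • v :=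
  RCLike.real_smul_eq_coe_smul t v

/-- If `R` has the normal field `N`, the second derivatives of `R` in the direction of `N` are given
by first derivatives. -/
theorem dot_second_derivatives (hU : IsOpen U) {R N : ℝ × ℝ → Vec 𝕜} (hR : ContDiffOn ℝ 2 R U)
    (hN : ContDiffOn ℝ 1 N U) (h : ∀ z ∈ U, dot ε (N z) (dx R z) = 0 ∧ dot ε (N z) (dy R z) = 0)
    {z : ℝ × ℝ} (hz : z ∈ U) :
    dot ε (N z) (dx (dx R) z) = -dot ε (dx N z) (dx R z) ∧
    dot ε (N z) (dy (dx R) z) = -dot ε (dy N z) (dx R z) ∧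
    dot ε (N z) (dy (dx R) z) = -dot ε (dx N z) (dy R z) ∧
    dot ε (N z) (dy (dy R) z) = -dot ε (dy N z) (dy R z) := by
  have hN' := hN.hasGrad hU le_rfl hz
  have hx := ((contDiffOn_dx hU hR (m := 1) (by norm_num [one_add_one_eq_two])).hasGrad hU le_rfl hz)
  have hy := ((contDiffOn_dy hU hR (m := 1) (by norm_num [one_add_one_eq_two])).hasGrad hU le_rfl hz)
  obtain ⟨h1, h2⟩ := (hN'.dot ε hx).unique (hasGrad_const 0 z)
    (by filter_upwards [hU.eventually_mem hz] with w hw using (h w hw).1.symm)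
  obtain ⟨h3, h4⟩ := (hN'.dot ε hy).unique (hasGrad_const 0 z)
    (by filter_upwards [hU.eventually_mem hz] with w hw using (h w hw).2.symm)
  rw [← dx_dy_comm hU hR le_rfl hz] at h3
  refine ⟨?_, ?_, ?_, ?_⟩
  · linear_combination h1
  · linear_combination h2
  · linear_combination h3
  · linear_combination h4

theorem Lelieuvre.normal (hε : ε = 1 ∨ ε = -1) {a b c : ℝ × ℝ → ℝ} {N R : ℝ × ℝ → Vec 𝕜}
    (h : Lelieuvre ε U a b c N R) {z : ℝ × ℝ} (hz : z ∈ U) :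
    dot ε (N z) (dx R z) = 0 ∧ dot ε (N z) (dy R z) = 0 := by
  obtain ⟨-, -, hx, hy⟩ := h z hz
  simp only [real_smul_vec] at hx hy
  obtain ⟨h1, h2, -⟩ := lelieuvre_dot hε (a z : 𝕜) (b z) (c z) (N z) (dx N z) (dy N z)
  rw [hx, hy]
  exact ⟨h1, h2⟩

theorem Lelieuvre.dots (hε : ε = 1 ∨ ε = -1) {a b c : ℝ × ℝ → ℝ} {N R : ℝ × ℝ → Vec 𝕜}
    (h : Lelieuvre ε U a b c N R) {z : ℝ × ℝ} (hz : z ∈ U) :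
    dot ε (dx N z) (dx R z) = b z * vol (N z) (dx N z) (dy N z) ∧
    dot ε (dy N z) (dx R z) = -(c z * vol (N z) (dx N z) (dy N z)) ∧
    dot ε (dy N z) (dy R z) = a z * vol (N z) (dx N z) (dy N z) := by
  obtain ⟨-, -, hx, hy⟩ := h z hz
  simp only [real_smul_vec] at hx hy
  obtain ⟨-, -, h3, h4, -, h6⟩ := lelieuvre_dot hε (a z : 𝕜) (b z) (c z) (N z) (dx N z) (dy N z)
  rw [hx, hy]
  exact ⟨h3, h4, h6⟩

theorem Lelieuvre.detI_eq (hε : ε = 1 ∨ ε = -1) {a b c : ℝ × ℝ → ℝ} {N R : ℝ × ℝ → Vec 𝕜}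
    (h : Lelieuvre ε U a b c N R) {z : ℝ × ℝ} (hz : z ∈ U) :
    detI ε R z = dot ε (N z) (N z) * (disc a b c z * vol (N z) (dx N z) (dy N z)) ^ 2 := by
  obtain ⟨-, -, hx, hy⟩ := h z hz
  simp only [real_smul_vec] at hx hy
  rw [detI, hx, hy, lelieuvre_detI hε]
  simp [disc]

/-- The second fundamental form of a surface given by the Lelieuvre formulae, with respect to the
unit normal `n = l N`. -/
theorem Lelieuvre.second_form (hε : ε = 1 ∨ ε = -1) (hU : IsOpen U) {a b c : ℝ × ℝ → ℝ}
    {N R n : ℝ × ℝ → Vec 𝕜} (h : Lelieuvre ε U a b c N R) (hR : ContDiffOn ℝ 2 R U)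
    (hN : ContDiffOn ℝ 1 N U) {z : ℝ × ℝ} (hz : z ∈ U) {l : 𝕜} (hn : n z = l • N z) :
    formE ε R n z = -(l * vol (N z) (dx N z) (dy N z)) * b z ∧
    formF ε R n z = (l * vol (N z) (dx N z) (dy N z)) * c z ∧
    formG ε R n z = -(l * vol (N z) (dx N z) (dy N z)) * a z ∧
    detII ε R n z = (l * vol (N z) (dx N z) (dy N z)) ^ 2 * disc a b c z := by
  obtain ⟨h1, h2, h3⟩ := h.dots hε hz
  obtain ⟨e1, e2, -, e4⟩ := dot_second_derivatives hU hR hN (fun z hz => h.normal hε hz) hz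
  have hE : formE ε R n z = -(l * vol (N z) (dx N z) (dy N z)) * b z := by
    rw [formE, hn, dot_smul_left, e1, h1]; ring
  have hF : formF ε R n z = (l * vol (N z) (dx N z) (dy N z)) * c z := by
    rw [formF, hn, dot_smul_left, e2, h2]; ring
  have hG : formG ε R n z = -(l * vol (N z) (dx N z) (dy N z)) * a z := by
    rw [formG, hn, dot_smul_left, e4, h3]; ring
  refine ⟨hE, hF, hG, ?_⟩
  rw [detII, hE, hF, hG]
  simp only [disc]
  push_cast
  ring

end LelieuvreAnalysis

/-! ### Existence, uniqueness and regularity of the Lelieuvre coefficients. -/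

section LelieuvreExistence

variable {ε : ℝ} {D : Set (ℝ × ℝ)} {R N n : ℝ × ℝ → Vec ℝ} {r : ℝ × ℝ → ℝ}

/-- The normal field of a Bianchi surface and its derivatives are linearly independent. -/
theorem IsBianchiSurface.vol_ne_zero (hε : ε = 1 ∨ ε = -1) (hD : IsOpen D)
    (hB : IsBianchiSurface ε D R n) (hR : ContDiffOn ℝ 2 R D) (hN : ContDiffOn ℝ 1 N D)
    (hnN : ∀ z ∈ D, ∃ l : ℝ, l ≠ 0 ∧ n z = l • N z) {z : ℝ × ℝ} (hz : z ∈ D) :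
    vol (N z) (dx N z) (dy N z) ≠ 0 ∧ dot ε (dy N z) (dx R z) = dot ε (dx N z) (dy R z) := by
  have hnormal : ∀ z ∈ D, dot ε (N z) (dx R z) = 0 ∧ dot ε (N z) (dy R z) = 0 := fun z hz => by
    obtain ⟨l, hl, h⟩ := hnN z hz
    have := hB.normal z hz
    rw [h, dot_smul_left, dot_smul_left] at this
    exact ⟨(mul_eq_zero.1 this.1).resolve_left hl, (mul_eq_zero.1 this.2).resolve_left hl⟩
  obtain ⟨l, hl, h⟩ := hnN z hz
  obtain ⟨e1, e2, e3, e4⟩ := dot_second_derivatives hD hR hN hnormal hz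
  have hsymm : dot ε (dy N z) (dx R z) = dot ε (dx N z) (dy R z) := by linarith
  refine ⟨fun hV => hB.curved z hz ?_, hsymm⟩
  have h0 := dot_mul_det_eq hε (X := dx N z) (Y := dy N z) (hnormal z hz).1 (hnormal z hz).2
  rw [hV, zero_mul] at h0
  have hNN : dot ε (N z) (N z) ≠ 0 := fun h1 => by
    have := hB.unit z hz
    rw [h, dot_smul_left, dot_smul_right, h1] at this
    norm_num at this
  have h1 := (mul_eq_zero.1 h0).resolve_left hNN
  -- With vol(N, N_x, N_y) = 0 the preceding identity makes the determinant of the second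
  -- fundamental form vanish, contrary to K ≠ 0.
  rw [detII, formE, formF, formG, h, dot_smul_left, dot_smul_left, dot_smul_left, e1, e2, e4]
  linear_combination l ^ 2 * (h1 - dot ε (dy N z) (dx R z) * hsymm)

theorem IsBianchiSurface.exists_lelieuvre (hε : ε = 1 ∨ ε = -1) (hD : IsOpen D)
    (hB : IsBianchiSurface ε D R n) (hR : ContDiffOn ℝ 2 R D) (hN : ContDiffOn ℝ 1 N D)
    (hnN : ∀ z ∈ D, ∃ l : ℝ, l ≠ 0 ∧ n z = l • N z) :
    ∃ a b c : ℝ × ℝ → ℝ, Lelieuvre ε D a b c N R := by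
  refine ⟨fun z => dot ε (dy N z) (dy R z) / vol (N z) (dx N z) (dy N z),
    fun z => dot ε (dx N z) (dx R z) / vol (N z) (dx N z) (dy N z),
    fun z => -dot ε (dy N z) (dx R z) / vol (N z) (dx N z) (dy N z), fun z hz => ?_⟩
  obtain ⟨hV, hsymm⟩ := hB.vol_ne_zero hε hD hR hN hnN hz
  obtain ⟨l, hl, h⟩ := hnN z hz
  have hnormal := hB.normal z hz
  rw [h, dot_smul_left, dot_smul_left] at hnormal
  exact ⟨(hR.hasGrad hD (by norm_num) hz).differentiableAt,
    (hN.hasGrad hD le_rfl hz).differentiableAt,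
    lelieuvre_of_dot hε hV ((mul_eq_zero.1 hnormal.1).resolve_left hl)
      ((mul_eq_zero.1 hnormal.2).resolve_left hl) hsymm⟩

/-- Explicit quotients of this kind give the uniqueness of a, b, c as well as their regularity. -/
theorem Lelieuvre.eq_div (hε : ε = 1 ∨ ε = -1) {a b c : ℝ × ℝ → ℝ}
    (h : Lelieuvre ε D a b c N R) (hV : ∀ z ∈ D, vol (N z) (dx N z) (dy N z) ≠ 0) :
    (∀ z ∈ D, a z = dot ε (dy N z) (dy R z) / vol (N z) (dx N z) (dy N z)) ∧
    (∀ z ∈ D, b z = dot ε (dx N z) (dx R z) / vol (N z) (dx N z) (dy N z)) ∧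
    (∀ z ∈ D, c z = -dot ε (dy N z) (dx R z) / vol (N z) (dx N z) (dy N z)) := by
  refine ⟨fun z hz => ?_, fun z hz => ?_, fun z hz => ?_⟩ <;>
    obtain ⟨h1, h2, h3⟩ := h.dots hε hz <;> rw [eq_div_iff (hV z hz)]
  · simpa using h3.symm
  · simpa using h1.symm
  · rw [h2]; simp

theorem Lelieuvre.contDiffOn (hε : ε = 1 ∨ ε = -1) (hD : IsOpen D) {a b c : ℝ × ℝ → ℝ}
    (h : Lelieuvre ε D a b c N R) (hV : ∀ z ∈ D, vol (N z) (dx N z) (dy N z) ≠ 0)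
    {k : WithTop ℕ∞} (hR : ContDiffOn ℝ (k + 1) R D) (hN : ContDiffOn ℝ (k + 1) N D) :
    ContDiffOn ℝ k a D ∧ ContDiffOn ℝ k b D ∧ ContDiffOn ℝ k c D := by
  obtain ⟨ha, hb, hc⟩ := h.eq_div hε hV
  have hRx := contDiffOn_dx hD hR le_rfl
  have hRy := contDiffOn_dy hD hR le_rfl
  have hNx := contDiffOn_dx hD hN le_rfl
  have hNy := contDiffOn_dy hD hN le_rfl
  have hVc := contDiffOn_vol (hN.of_le le_self_add) hNx hNy
  exact ⟨((contDiffOn_dot ε hNy hRy).div hVc hV).congr ha,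
    ((contDiffOn_dot ε hNx hRx).div hVc hV).congr hb,
    ((contDiffOn_dot ε hNy hRx).neg.div hVc hV).congr hc⟩

/-- The normal field in the Lelieuvre formulae solves a self-adjoint equation. -/
theorem Lelieuvre.selfAdjointEq (hε : ε = 1 ∨ ε = -1) (hD : IsOpen D) {a b c : ℝ × ℝ → ℝ}
    (h : Lelieuvre ε D a b c N R) (hr : ∀ z ∈ D, dot ε (N z) (N z) ≠ 0)
    (ha : ContDiffOn ℝ 1 a D) (hb : ContDiffOn ℝ 1 b D) (hc : ContDiffOn ℝ 1 c D)
    (hR : ContDiffOn ℝ 2 R D) (hN : ContDiffOn ℝ 2 N D) :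
    ∃ f : ℝ × ℝ → ℝ, SelfAdjointEq D a b c f N := by
  let w : ℝ × ℝ → Vec ℝ := fun z => a z • dx N z + c z • dy N z
  let u : ℝ × ℝ → Vec ℝ := fun z => b z • dy N z + c z • dx N z
  refine ⟨fun z => dot ε (N z) (dx w z + dy u z) / dot ε (N z) (N z), fun z hz => ?_⟩
  have h12 : (1 : WithTop ℕ∞) + 1 ≤ 2 := by norm_num [one_add_one_eq_two]
  have hNx := contDiffOn_dx hD hN h12
  have hNy := contDiffOn_dy hD hN h12
  have hN0 := hN.hasGrad hD (by norm_num) hz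
  have hw : HasGrad w (dx w z) (dy w z) z := ((ha.smul hNx).add (hc.smul hNy)).hasGrad hD le_rfl hz
  have hu : HasGrad u (dx u z) (dy u z) z := ((hb.smul hNy).add (hc.smul hNx)).hasGrad hD le_rfl hz
  refine ⟨hN0.differentiableAt, hw.differentiableAt, hu.differentiableAt, ?_⟩
  have e1 := (hu.cross ε hN0).congr (g := dx R)
    (by filter_upwards [hD.eventually_mem hz] with y hy using (h y hy).2.2.1) rfl rfl
  have e2 := (hN0.cross ε hw).congr (g := dy R)
    (by filter_upwards [hD.eventually_mem hz] with y hy using (h y hy).2.2.2) rfl rfl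
  have e3 := dx_dy_comm hD hR le_rfl hz
  rw [e1.dy_eq, e2.dx_eq] at e3
  -- Equality of the mixed derivatives of R: the terms without second derivatives of N both equal c
  -- times N_x × N_y-type products and cancel, leaving N × (w_x + u_y) = 0.
  have e4 : cross ε (N z) (dx w z + dy u z) = 0 := by
    have h1 : cross ε (u z) (dy N z) = cross ε (dx N z) (w z) := by
      simp only [u, w, cross_add_left, cross_add_right, cross_smul_left, cross_smul_right,
        cross_self, smul_zero, zero_add]
    rw [h1, cross_anticomm (dy u z)] at e3
    rw [cross_add_right]
    have h2 : cross ε (dx N z) (w z) + (cross ε (N z) (dx w z) + cross ε (N z) (dy u z))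
        = cross ε (dx N z) (w z) := by
      rw [← add_assoc, ← e3]; abel
    simpa using h2
  have e5 := smul_eq_of_cross_eq_zero hε e4
  change dx w z + dy u z = (dot ε (N z) (dx w z + dy u z) / dot ε (N z) (N z)) • N z
  rw [div_eq_inv_mul, mul_smul, ← e5, smul_smul, inv_mul_cancel₀ (hr z hz), one_smul]

end LelieuvreExistence

/-! ### Normalized coefficients and the system for p. -/

section Conformal

theorem sign_mul_self_eq_abs (t : ℝ) : Real.sign t * t = |t| := by
  rcases lt_trichotomy t 0 with h | rfl | h
  · rw [Real.sign_of_neg h, abs_of_neg h]; ring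
  · simp
  · rw [Real.sign_of_pos h, abs_of_pos h]; ring

theorem sign_mul_sign {t : ℝ} (h : t ≠ 0) : Real.sign t * Real.sign t = 1 := by
  rcases Real.sign_apply_eq_of_ne_zero t h with h | h <;> rw [h] <;> norm_num

theorem hasDerivAt_sqrt_abs {t : ℝ} (h : t ≠ 0) :
    HasDerivAt (fun s => √|s|) (Real.sign t / (2 * √|t|)) t := by
  refine HasDerivAt.sqrt ?_ (abs_ne_zero.2 h)
  rcases lt_or_gt_of_ne h with h | h
  · rw [Real.sign_of_neg h]; exact hasDerivAt_abs_neg h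
  · rw [Real.sign_of_pos h]; exact hasDerivAt_abs_pos h

theorem HasGrad.sqrt_abs {f : ℝ × ℝ → ℝ} {P Q : ℝ} {z : ℝ × ℝ} (h : HasGrad f P Q z)
    (h0 : f z ≠ 0) : HasGrad (fun w => √|f w|) (Real.sign (f z) / (2 * √|f z|) * P)
      (Real.sign (f z) / (2 * √|f z|) * Q) z :=
  .of_hasFDerivAt ((hasDerivAt_sqrt_abs h0).comp_hasFDerivAt z h) (by simp) (by simp)

variable {a b c : ℝ × ℝ → ℝ} {U : Set (ℝ × ℝ)}

theorem contDiffOn_disc {n : WithTop ℕ∞} (ha : ContDiffOn ℝ n a U) (hb : ContDiffOn ℝ n b U)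
    (hc : ContDiffOn ℝ n c U) : ContDiffOn ℝ n (disc a b c) U :=
  (ha.mul hb).sub (hc.pow 2)

theorem contDiffOn_sqrt_abs {n : WithTop ℕ∞} {f : ℝ × ℝ → ℝ} (hf : ContDiffOn ℝ n f U)
    (h0 : ∀ z ∈ U, f z ≠ 0) : ContDiffOn ℝ n (fun z => √|f z|) U := by
  refine ContDiffOn.sqrt (fun z hz => ?_) (fun z hz => abs_ne_zero.2 (h0 z hz))
  have hc := (hf z hz).continuousWithinAt
  rcases lt_or_gt_of_ne (h0 z hz) with h | h
  · refine (hf z hz).neg.congr_of_eventuallyEq ?_ (abs_of_neg h)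
    filter_upwards [hc.eventually_lt continuousWithinAt_const h] with w hw using abs_of_neg hw
  · refine (hf z hz).congr_of_eventuallyEq ?_ (abs_of_pos h)
    filter_upwards [continuousWithinAt_const.eventually_lt hc h] with w hw using abs_of_pos hw

theorem sqrt_abs_pos {t : ℝ} (h : t ≠ 0) : 0 < √|t| := Real.sqrt_pos.2 (abs_pos.2 h)

theorem contDiffOn_conformal {n : WithTop ℕ∞} {u : ℝ × ℝ → ℝ} (hu : ContDiffOn ℝ n u U)
    (hd : ContDiffOn ℝ n (disc a b c) U) (h0 : ∀ z ∈ U, disc a b c z ≠ 0) :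
    ContDiffOn ℝ n (conformal a b c u) U :=
  hu.div (contDiffOn_sqrt_abs hd h0) fun z hz => (sqrt_abs_pos (h0 z hz)).ne'

theorem conformal_disc {z : ℝ × ℝ} (h0 : disc a b c z ≠ 0) :
    conformal a b c a z * conformal a b c b z - conformal a b c c z ^ 2
      = Real.sign (disc a b c z) := by
  have h1 := (sqrt_abs_pos h0).ne'
  have h2 : √|disc a b c z| ^ 2 = |disc a b c z| := Real.sq_sqrt (abs_nonneg _)
  have h3 := sign_mul_self_eq_abs (disc a b c z)
  have h4 : a z * b z - c z ^ 2 = disc a b c z := rfl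
  have h5 := sign_mul_sign h0
  simp only [conformal]
  rw [div_mul_div_comm, div_pow, ← sq, ← sub_div, h4, h2, div_eq_iff (abs_ne_zero.2 h0), ← h3,
    ← mul_assoc, h5, one_mul]

/-- The conormal derivative `A u,ₓ + C u,ᵧ` for the form with coefficients `A`, `B`, `C`. -/
noncomputable def fluxX {E : Type*} [NormedAddCommGroup E] [NormedSpace ℝ E] (a c : ℝ × ℝ → ℝ)
    (u : ℝ × ℝ → E) (z : ℝ × ℝ) : E := a z • dx u z + c z • dy u z

/-- The conormal derivative `B u,ᵧ + C u,ₓ` for the form with coefficients `A`, `B`, `C`. -/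
noncomputable def fluxY {E : Type*} [NormedAddCommGroup E] [NormedSpace ℝ E] (b c : ℝ × ℝ → ℝ)
    (u : ℝ × ℝ → E) (z : ℝ × ℝ) : E := b z • dy u z + c z • dx u z

variable {𝕜 : Type*} [RCLike 𝕜] {r : ℝ × ℝ → ℝ}

/-- The system for `p`, solved for the derivatives of `p`. -/
theorem pSystem_iff (h0 : ∀ z ∈ U, disc a b c z ≠ 0) {p : ℝ × ℝ → 𝕜} :
    PSystem U a b c r p ↔ ∀ z ∈ U, HasGrad p
      ((fluxY (conformal a b c b) (conformal a b c c) (fun w => r w * √|disc a b c w|) z : ℝ) : 𝕜)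
      ((-fluxX (conformal a b c a) (conformal a b c c) (fun w => r w * √|disc a b c w|) z : ℝ) : 𝕜)
      z := by
  refine forall₂_congr fun z hz => ?_
  have h1 : ((conformal a b c a z * conformal a b c b z - conformal a b c c z ^ 2 : ℝ) : 𝕜)
      = (Real.sign (disc a b c z) : ℝ) := by rw [conformal_disc (h0 z hz)]
  have h2 : ((Real.sign (disc a b c z) * Real.sign (disc a b c z) : ℝ) : 𝕜) = 1 := by
    rw [sign_mul_sign (h0 z hz)]; simp
  have hA : a z / √|disc a b c z| = conformal a b c a z := rfl
  have hB : b z / √|disc a b c z| = conformal a b c b z := rfl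
  have hC : c z / √|disc a b c z| = conformal a b c c z := rfl
  simp only [hA, hB, hC, fluxX, fluxY, smul_eq_mul]
  generalize conformal a b c a z = A at *
  generalize conformal a b c b z = B at *
  generalize conformal a b c c z = C at *
  generalize Real.sign (disc a b c z) = σ at *
  generalize dx (fun w => r w * √|disc a b c w|) z = ρx at *
  generalize dy (fun w => r w * √|disc a b c w|) z = ρy at *
  push_cast at h1 h2 ⊢
  -- The matrix with rows (C, B) and (−A, −C) has determinant AB − C² = sgn Δ, so the system can be
  -- solved for the two derivatives of p.
  constructor
  · rintro ⟨hp, e1, e2⟩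
    refine hp.hasGrad.congr_grad ?_ ?_
    · linear_combination (C * ρx + B * ρy - dx p z) * h2 - dx p z * σ * h1 - σ * C * e1 - σ * B * e2
    · linear_combination -(A * ρx + C * ρy + dy p z) * h2 - dy p z * σ * h1 + σ * A * e1
        + σ * C * e2
  · intro h
    refine ⟨h.differentiableAt, ?_, ?_⟩ <;> rw [h.dx_eq, h.dy_eq]
    · linear_combination -(ρx : 𝕜) * h1
    · linear_combination -(ρy : 𝕜) * h1

end Conformal

/-! ### The operator *d*d as a self-adjoint operator. -/

section Star

variable {𝕜 : Type*} [RCLike 𝕜] {E : Type*} [NormedAddCommGroup E] [NormedSpace ℝ E]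
  [NormedSpace 𝕜 E] [IsScalarTower ℝ 𝕜 E]

/-- If s times the inverse matrix of the quadratic form is τ times the matrix of A, C, B with
constant τ, then *du is τ times the one-form with components −(Bu_y + Cu_x) and Au_x + Cu_y. The
function u' stands for a local formula for u that is easier to differentiate. -/
theorem starDStarD_eq {e f g s : ℝ × ℝ → 𝕜} {A B C : ℝ × ℝ → ℝ} {τ : 𝕜} {u u' : ℝ × ℝ → E}
    {z : ℝ × ℝ} (hu : u =ᶠ[nhds z] u')
    (hA : ∀ᶠ w in nhds z, s w * (g w / (e w * g w - f w ^ 2)) = τ * A w)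
    (hC : ∀ᶠ w in nhds z, s w * (-f w / (e w * g w - f w ^ 2)) = τ * C w)
    (hB : ∀ᶠ w in nhds z, s w * (e w / (e w * g w - f w ^ 2)) = τ * B w)
    (hX : DifferentiableAt ℝ (fluxX A C u') z) (hY : DifferentiableAt ℝ (fluxY B C u') z) :
    starDStarD e f g s u z = (s z)⁻¹ • τ • (dx (fluxX A C u') z + dy (fluxY B C u') z) := by
  have hτ := hasGrad_const τ z
  have hdu := hu.fderiv (𝕜 := ℝ)
  have h2 := (hτ.smul hX.hasGrad).congr (g := (star₁ e f g s (d₀ u)).2) (by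
    filter_upwards [hA, hC, hdu] with w hA hC hdu
    simp only [star₁, d₀, dx, dy, fluxX, smul_add, smul_smul, hA, hC, hdu,
      RCLike.real_smul_eq_coe_smul (K := 𝕜)]) rfl rfl
  have h1 := (hτ.smul hY.hasGrad).neg.congr (g := (star₁ e f g s (d₀ u)).1) (by
    filter_upwards [hB, hC, hdu] with w hB hC hdu
    simp only [star₁, d₀, dx, dy, fluxY, smul_add, smul_smul, hB, hC, hdu,
      RCLike.real_smul_eq_coe_smul (K := 𝕜)]
    rw [add_comm]) rfl rfl
  simp only [starDStarD, star₂, d₁, h2.dx_eq, h1.dy_eq, zero_smul, zero_add, sub_neg_eq_add,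
    smul_add]

variable {ε : ℝ} {U : Set (ℝ × ℝ)} {a b c : ℝ × ℝ → ℝ}

/-- The operator `*d*d` of a surface given by the Lelieuvre formulae is, up to a factor, the
self-adjoint operator with the normalized coefficients. -/
theorem Lelieuvre.starDStarD_eq (hε : ε = 1 ∨ ε = -1) (hU : IsOpen U) {N R n : ℝ × ℝ → Vec 𝕜}
    (h : Lelieuvre ε U a b c N R) (hR : ContDiffOn ℝ 2 R U) (hN : ContDiffOn ℝ 1 N U)
    {l s : ℝ × ℝ → 𝕜} (hn : ∀ z ∈ U, n z = l z • N z) (hd : ∀ z ∈ U, disc a b c z ≠ 0)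
    (hV : ∀ z ∈ U, l z * vol (N z) (dx N z) (dy N z) ≠ 0) {z : ℝ × ℝ} (hz : z ∈ U) {τ : 𝕜}
    (hτ : ∀ᶠ w in nhds z, s w * (√|disc a b c w| : ℝ)
      = -(τ * (l w * vol (N w) (dx N w) (dy N w)) * (disc a b c w : ℝ)))
    {u u' : ℝ × ℝ → E} (hu : u =ᶠ[nhds z] u')
    (hX : DifferentiableAt ℝ (fluxX (conformal a b c a) (conformal a b c c) u') z)
    (hY : DifferentiableAt ℝ (fluxY (conformal a b c b) (conformal a b c c) u') z) :
    starDStarD (formE ε R n) (formF ε R n) (formG ε R n) s u z = (s z)⁻¹ • τ •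
      (dx (fluxX (conformal a b c a) (conformal a b c c) u') z
        + dy (fluxY (conformal a b c b) (conformal a b c c) u') z) := by
  -- Since det II = (lV)²Δ, an entry −lV·m of the adjugate of II becomes, after division by det II
  -- and multiplication by s, the normalized coefficient τm/√|Δ|.
  have key : ∀ᶠ w in nhds z, ∀ m m' : ℝ × ℝ → ℝ, ∀ y : 𝕜,
      y = -(l w * vol (N w) (dx N w) (dy N w)) * (m w : 𝕜) →
      s w * (y / (formE ε R n w * formG ε R n w - formF ε R n w ^ 2))
        = τ * (conformal a b c m w : ℝ) := by
    filter_upwards [hτ, hU.eventually_mem hz] with w hτ hw m m' y hy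
    obtain ⟨-, -, -, hII⟩ := h.second_form hε hU hR hN hw (hn w hw)
    rw [detII] at hII
    have h1 : ((√|disc a b c w| : ℝ) : 𝕜) ≠ 0 := by
      exact_mod_cast (sqrt_abs_pos (hd w hw)).ne'
    have h2 : ((disc a b c w : ℝ) : 𝕜) ≠ 0 := by exact_mod_cast hd w hw
    have h3 := hV w hw
    rw [hII, hy, conformal]
    generalize l w * vol (N w) (dx N w) (dy N w) = V at *
    push_cast
    field_simp
    linear_combination -(m w : 𝕜) * hτ
  have hmem := hU.eventually_mem hz
  refine Bianchi.starDStarD_eq hu ?_ ?_ ?_ hX hY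
  · filter_upwards [key, hmem] with w hw hwU
    exact hw a a _ (h.second_form hε hU hR hN hwU (hn w hwU)).2.2.1
  · filter_upwards [key, hmem] with w hw hwU
    refine hw c c _ ?_
    rw [(h.second_form hε hU hR hN hwU (hn w hwU)).2.1]
    ring
  · filter_upwards [key, hmem] with w hw hwU
    exact hw b b _ (h.second_form hε hU hR hN hwU (hn w hwU)).1

end Star

/-! ### Bootstrapping of regularity, compatibility on jets, potentials of closed one-forms. -/

section Potential

variable {E : Type*} [NormedAddCommGroup E] [NormedSpace ℝ E] {U : Set (ℝ × ℝ)} {k : ℕ∞}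

/-- Regularity is gained one order at a time. As k may be ∞, the induction runs over finite orders
below k. -/
theorem contDiffOn_of_forall_succ {f : ℝ × ℝ → E} (hf : ContinuousOn f U)
    (h : ∀ m : ℕ, ((m + 1 : ℕ) : ℕ∞) ≤ k → ContDiffOn ℝ m f U →
      ContDiffOn ℝ ((m + 1 : ℕ) : WithTop ℕ∞) f U) : ContDiffOn ℝ k f U := by
  rw [contDiffOn_iff_forall_nat_le]
  intro m
  induction m with
  | zero => intro _; exact_mod_cast contDiffOn_zero.2 hf
  | succ m ih =>
    intro hm
    exact h m hm (ih ((Nat.cast_le.2 m.le_succ).trans hm))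

theorem contDiffOn_of_hasGrad (hU : IsOpen U) {f P Q : ℝ × ℝ → E}
    (hf : ∀ z ∈ U, HasGrad f (P z) (Q z) z)
    (hPQ : ∀ m : ℕ, ((m + 1 : ℕ) : ℕ∞) ≤ k → ContDiffOn ℝ m f U →
      ContDiffOn ℝ m P U ∧ ContDiffOn ℝ m Q U) : ContDiffOn ℝ k f U := by
  refine contDiffOn_of_forall_succ
    (fun z hz => (hf z hz).differentiableAt.continuousAt.continuousWithinAt) fun m hm h => ?_
  obtain ⟨hP, hQ⟩ := hPQ m hm h
  exact contDiffOn_succ_of_partial hU (fun z hz => (hf z hz).differentiableAt)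
    (hP.congr fun z hz => (hf z hz).dx_eq) (hQ.congr fun z hz => (hf z hz).dy_eq)

theorem IsLinearSolution.contDiffOn (hU : IsOpen U) {A B : ℝ × ℝ → E →L[ℝ] E} {v : ℝ × ℝ → E}
    (hv : IsLinearSolution A B U v)
    (hA : ∀ m : ℕ, ((m + 1 : ℕ) : ℕ∞) ≤ k → ContDiffOn ℝ m A U)
    (hB : ∀ m : ℕ, ((m + 1 : ℕ) : ℕ∞) ≤ k → ContDiffOn ℝ m B U) : ContDiffOn ℝ k v U :=
  contDiffOn_of_hasGrad hU hv fun m hm h => ⟨(hA m hm).clm_apply h, (hB m hm).clm_apply h⟩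

theorem HasGrad.clm_apply {A : ℝ × ℝ → E →L[ℝ] E} {P Q : E →L[ℝ] E} {v : ℝ × ℝ → E} {p q : E}
    {z : ℝ × ℝ} (hA : HasGrad A P Q z) (hv : HasGrad v p q z) :
    HasGrad (fun w => A w (v w)) (P (v z) + A z p) (Q (v z) + A z q) z :=
  .of_hasFDerivAt (HasFDerivAt.clm_apply hA hv) (by simp [add_comm]) (by simp [add_comm])

/-- The compatibility condition of a linear total differential equation can be checked on
functions that solve the equation to first order at a point. -/
theorem compatible_of_jets {A B : ℝ × ℝ → E →L[ℝ] E} {z : ℝ × ℝ}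
    (hA : DifferentiableAt ℝ A z) (hB : DifferentiableAt ℝ B z)
    (h : ∀ v : ℝ × ℝ → E, HasGrad v (A z (v z)) (B z (v z)) z →
      dy (fun w => A w (v w)) z = dx (fun w => B w (v w)) z) (ξ : E) :
    dy A z ξ + A z (B z ξ) = dx B z ξ + B z (A z ξ) := by
  -- The affine function with the value ξ at z and the derivatives required by the equation there.
  let v : ℝ × ℝ → E := fun w => ξ + (w.1 - z.1) • A z ξ + (w.2 - z.2) • B z ξ
  have hvz : v z = ξ := by simp [v]
  have hv : HasGrad v (A z (v z)) (B z (v z)) z := by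
    rw [hvz]
    refine .of_hasFDerivAt (L := (ContinuousLinearMap.fst ℝ ℝ ℝ).smulRight (A z ξ)
      + (ContinuousLinearMap.snd ℝ ℝ ℝ).smulRight (B z ξ)) ?_ (by simp) (by simp)
    exact ((((ContinuousLinearMap.fst ℝ ℝ ℝ).hasFDerivAt.sub_const z.1).smul_const
      (A z ξ)).const_add ξ).add
      (((ContinuousLinearMap.snd ℝ ℝ ℝ).hasFDerivAt.sub_const z.2).smul_const (B z ξ))
  have := h v hv
  rw [(hA.hasGrad.clm_apply hv).dy_eq, (hB.hasGrad.clm_apply hv).dx_eq] at this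
  simpa only [hvz] using this

/-- A closed form is integrated by the linear Frobenius theorem after homogenization: an auxiliary
second component with zero differential and initial value 1 turns dp = ω into a homogeneous system.
-/
theorem exists_potential (hU : IsOpen U) (hUc : IsSimplyConnected U) {ω₁ ω₂ : ℝ × ℝ → ℝ}
    (h₁ : ContDiffOn ℝ 1 ω₁ U) (h₂ : ContDiffOn ℝ 1 ω₂ U) (h : ∀ z ∈ U, dy ω₁ z = dx ω₂ z)
    {z₀ : ℝ × ℝ} (hz₀ : z₀ ∈ U) :
    ∃ p : ℝ × ℝ → ℝ, p z₀ = 0 ∧ ∀ z ∈ U, HasGrad p (ω₁ z) (ω₂ z) z := by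
  let A : (ℝ × ℝ → ℝ) → ℝ × ℝ → ℝ × ℝ →L[ℝ] ℝ × ℝ := fun ω z =>
    (ContinuousLinearMap.snd ℝ ℝ ℝ).smulRight (ω z, 0)
  have hA : ∀ {ω : ℝ × ℝ → ℝ}, ContDiffOn ℝ 1 ω U → ContDiffOn ℝ 1 (A ω) U := fun hω =>
    contDiffOn_const.smulRight (hω.prodMk contDiffOn_const)
  obtain ⟨v, hv0, hv⟩ := exists_isLinearSolution hU hUc (hA h₁) (hA h₂) (fun z hz =>
    compatible_of_jets ((hA h₁).hasGrad hU le_rfl hz).differentiableAt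
      ((hA h₂).hasGrad hU le_rfl hz).differentiableAt (fun v hv => by
    have hv2 := hv.clm (ContinuousLinearMap.snd ℝ ℝ ℝ)
    have h1 := ((hv2.mul (𝕜 := ℝ) (h₁.hasGrad hU le_rfl hz)).clm (ContinuousLinearMap.inl ℝ ℝ ℝ))
    have h2 := ((hv2.mul (𝕜 := ℝ) (h₂.hasGrad hU le_rfl hz)).clm (ContinuousLinearMap.inl ℝ ℝ ℝ))
    have e1 := (h1.congr (g := fun w => A ω₁ w (v w)) (.of_forall fun w => by simp [A]) rfl
      rfl).dy_eq
    have e2 := (h2.congr (g := fun w => A ω₂ w (v w)) (.of_forall fun w => by simp [A]) rfl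
      rfl).dx_eq
    rw [e1, e2]
    simp [A, h z hz])) hz₀ (0, 1)
  have hUp := hUc.isPathConnected.isConnected.isPreconnected
  have hv2 : ∀ z ∈ U, (v z).2 = 1 := fun z hz => by
    have h1 : ∀ z ∈ U, HasGrad (fun w => (v w).2) (0 : ℝ) 0 z := fun z hz =>
      ((hv z hz).clm (ContinuousLinearMap.snd ℝ ℝ ℝ)).congr_grad (by simp [A]) (by simp [A])
    have := eqOn_of_grad_eq hU hUp h1 (fun z _ => hasGrad_const (0 : ℝ) z) hz₀ hz
    simp only [hv0, sub_self, sub_eq_zero] at this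
    exact this
  refine ⟨fun z => (v z).1, by simp [hv0], fun z hz => ?_⟩
  exact ((hv z hz).clm (ContinuousLinearMap.fst ℝ ℝ ℝ)).congr_grad (by simp [A, hv2 z hz])
    (by simp [A, hv2 z hz])

end Potential

/-! ### Gauss curvature and the scalar Bianchi condition in terms of a, b, c. -/

section Curvature

variable {𝕜 : Type*} [RCLike 𝕜] {ε : ℝ} {U : Set (ℝ × ℝ)} {a b c : ℝ × ℝ → ℝ}

theorem Lelieuvre.gaussK_eq (hε : ε = 1 ∨ ε = -1) (hU : IsOpen U) {N R n : ℝ × ℝ → Vec 𝕜}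
    (h : Lelieuvre ε U a b c N R) (hR : ContDiffOn ℝ 2 R U) (hN : ContDiffOn ℝ 1 N U)
    {z : ℝ × ℝ} (hz : z ∈ U) {l : 𝕜} (hn : n z = l • N z) (hd : disc a b c z ≠ 0)
    (hV : vol (N z) (dx N z) (dy N z) ≠ 0) :
    gaussK ε R n z = l ^ 2 / (dot ε (N z) (N z) * (disc a b c z : ℝ)) := by
  have hd' : ((disc a b c z : ℝ) : 𝕜) ≠ 0 := by exact_mod_cast hd
  rw [gaussK, h.detI_eq hε hz, (h.second_form hε hU hR hN hz hn).2.2.2]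
  -- For isotropic N both sides are zero by the convention on division.
  rcases eq_or_ne (dot ε (N z) (N z)) 0 with h0 | h0
  · simp [h0]
  · field_simp

theorem rpow_neg_quarter_sq {y : ℝ} (hy : 0 ≤ y) : ((y⁻¹) ^ (-(1 / 4) : ℝ)) ^ 2 = √y := by
  rw [← Real.rpow_natCast, ← Real.rpow_mul (inv_nonneg.2 hy), Real.inv_rpow hy, ← Real.rpow_neg hy,
    Real.sqrt_eq_rpow]
  norm_num

theorem IsBianchiSurface.disc_ne_zero (hε : ε = 1 ∨ ε = -1) (hU : IsOpen U) {N R n : ℝ × ℝ → Vec 𝕜}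
    (hB : IsBianchiSurface ε U R n) (h : Lelieuvre ε U a b c N R) (hN : ContDiffOn ℝ 1 N U)
    {z : ℝ × ℝ} (hz : z ∈ U) {l : 𝕜} (hn : n z = l • N z) : disc a b c z ≠ 0 := by
  intro h0
  have := hB.curved z hz
  rw [(h.second_form hε hU hB.contDiffOn_position hN hz hn).2.2.2, h0] at this
  simp at this

/-- A continuous function with values ±1 is locally constant, so it may be treated as a constant
when differentiating. -/
theorem eventually_eq_of_sq_eq_one {f : ℝ × ℝ → ℝ} (hU : IsOpen U) (hf : ContinuousOn f U)
    (h : ∀ z ∈ U, f z ^ 2 = 1) {z : ℝ × ℝ} (hz : z ∈ U) : ∀ᶠ w in nhds z, f w = f z := by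
  have hc := hf.continuousAt (hU.mem_nhds hz)
  rcases sq_eq_one_iff.1 (h z hz) with h1 | h1
  · filter_upwards [continuousAt_const.eventually_lt hc (by rw [h1]; exact one_pos : (0 : ℝ) < f z),
      hU.eventually_mem hz] with w hw hwU
    rcases sq_eq_one_iff.1 (h w hwU) with h2 | h2
    · rw [h1, h2]
    · linarith
  · filter_upwards [hc.eventually_lt continuousAt_const (by rw [h1]; norm_num : f z < (0 : ℝ)),
      hU.eventually_mem hz] with w hw hwU
    rcases sq_eq_one_iff.1 (h w hwU) with h2 | h2
    · linarith
    · rw [h1, h2]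

/-- The scalar condition on a Bianchi surface in terms of the Lelieuvre coefficients. -/
theorem IsBianchiSurface.div_flux_eq_zero (hε : ε = 1 ∨ ε = -1) (hU : IsOpen U)
    {N R n : ℝ × ℝ → Vec ℝ} {r : ℝ × ℝ → ℝ} (hB : IsBianchiSurface ε U R n)
    (h : Lelieuvre ε U a b c N R) (hN : ContDiffOn ℝ 1 N U) (hr : ∀ z ∈ U, r z = dot ε (N z) (N z))
    (hr0 : ∀ z ∈ U, 0 < r z) (hn : ∀ z ∈ U, n z = (√(r z))⁻¹ • N z)
    (hV : ∀ z ∈ U, vol (N z) (dx N z) (dy N z) ≠ 0)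
    (ha : ContDiffOn ℝ 2 a U) (hb : ContDiffOn ℝ 2 b U) (hc : ContDiffOn ℝ 2 c U)
    (hr2 : ContDiffOn ℝ 2 r U) (hd : ∀ z ∈ U, disc a b c z ≠ 0) {z : ℝ × ℝ} (hz : z ∈ U) :
    dx (fluxX (conformal a b c a) (conformal a b c c) (fun w => r w * √|disc a b c w|)) z
      + dy (fluxY (conformal a b c b) (conformal a b c c) (fun w => r w * √|disc a b c w|)) z
      = 0 := by
  obtain ⟨s, hs, hsII, f, hf⟩ := hB.bianchi
  have hR := hB.contDiffOn_position
  have hd2 := contDiffOn_disc ha hb hc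
  have h12 : (1 : WithTop ℕ∞) + 1 ≤ 2 := by norm_num [one_add_one_eq_two]
  have hρ : ContDiffOn ℝ 2 (fun w => r w * √|disc a b c w|) U :=
    hr2.mul (contDiffOn_sqrt_abs hd2 hd)
  have hA := (contDiffOn_conformal ha hd2 hd).of_le (m := 1) (by norm_num)
  have hBc := (contDiffOn_conformal hb hd2 hd).of_le (m := 1) (by norm_num)
  have hC := (contDiffOn_conformal hc hd2 hd).of_le (m := 1) (by norm_num)
  have hX := ((hA.smul (contDiffOn_dx hU hρ h12)).add (hC.smul (contDiffOn_dy hU hρ h12))).hasGrad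
    hU le_rfl hz
  have hY := ((hBc.smul (contDiffOn_dy hU hρ h12)).add (hC.smul (contDiffOn_dx hU hρ h12))).hasGrad
    hU le_rfl hz
  let l : ℝ × ℝ → ℝ := fun z => (√(r z))⁻¹
  have hl : ∀ z ∈ U, l z ≠ 0 := fun z hz => (inv_pos.2 (Real.sqrt_pos.2 (hr0 z hz))).ne'
  have hl2 : ∀ z ∈ U, l z ^ 2 * r z = 1 := fun z hz => by
    simp only [l]
    rw [inv_pow, Real.sq_sqrt (hr0 z hz).le, inv_mul_cancel₀ (hr0 z hz).ne']
  have hlV : ∀ z ∈ U, l z * vol (N z) (dx N z) (dy N z) ≠ 0 := fun z hz =>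
    mul_ne_zero (hl z hz) (hV z hz)
  -- The factor between the Hodge dual of II and the normalized coefficients. It is continuous with
  -- square 1, hence a locally constant sign.
  let τ : ℝ × ℝ → ℝ := fun w => -(s w * √|disc a b c w|)
    / (l w * vol (N w) (dx N w) (dy N w) * disc a b c w)
  -- Since s is real, its square can only be whichever of ±det II is positive.
  have hs2 : ∀ z ∈ U, s z ^ 2 = (l z * vol (N z) (dx N z) (dy N z)) ^ 2 * |disc a b c z| := by
    intro z hz
    have e := (h.second_form hε hU hR hN hz (hn z hz)).2.2.2
    have h0 := sq_nonneg (s z)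
    have h1 : 0 < (l z * vol (N z) (dx N z) (dy N z)) ^ 2 := by
      have := hlV z hz; positivity
    rcases lt_or_gt_of_ne (hd z hz) with h2 | h2
    · rw [abs_of_neg h2]
      rcases hsII z hz with h3 | h3 <;> rw [e] at h3
      · have := mul_neg_of_pos_of_neg h1 h2
        simp only [RCLike.ofReal_real_eq_id, id, l] at h3 this
        linarith
      · rw [h3]; simp [l]
    · rw [abs_of_pos h2]
      rcases hsII z hz with h3 | h3 <;> rw [e] at h3
      · rw [h3]; simp [l]
      · have := mul_pos h1 h2
        simp only [RCLike.ofReal_real_eq_id, id, l] at h3 this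
        linarith
  have hτ2 : ∀ z ∈ U, τ z ^ 2 = 1 := fun z hz => by
    have h1 := hlV z hz
    have h2 := hd z hz
    simp only [τ]
    rw [div_pow, neg_sq, mul_pow, hs2 z hz, Real.sq_sqrt (abs_nonneg _), mul_assoc, ← sq, sq_abs,
      mul_pow _ (disc a b c z), div_self (by positivity)]
  have hsc : ContinuousOn τ U := by
    have hVc := (contDiffOn_vol (hN.of_le zero_le_one) (contDiffOn_dx (m := 0) hU hN (by simp))
      (contDiffOn_dy (m := 0) hU hN (by simp))).continuousOn
    have hlc : ContinuousOn l U :=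
      hr2.continuousOn.sqrt.inv₀ fun z hz => (Real.sqrt_pos.2 (hr0 z hz)).ne'
    exact (hs.continuousOn.mul (contDiffOn_sqrt_abs hd2 hd).continuousOn).neg.div
      ((hlc.mul hVc).mul hd2.continuousOn) fun z hz => mul_ne_zero (hlV z hz) (hd z hz)
  have hτ : ∀ᶠ w in nhds z, s w * √|disc a b c w|
      = -(τ z * (l w * vol (N w) (dx N w) (dy N w)) * disc a b c w) := by
    filter_upwards [eventually_eq_of_sq_eq_one hU hsc hτ2 hz, hU.eventually_mem hz] with w hw hwU
    rw [← hw]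
    simp only [τ]
    rw [mul_assoc, div_mul_cancel₀ _ (mul_ne_zero (hlV w hwU) (hd w hwU)), neg_neg]
  -- As 1/|K| = r²|Δ|, the product 𝒩·𝒩 = |K|^(−1/2) is r√|Δ|.
  have hu : (fun w => dot ε (distinguished ε R n w) (distinguished ε R n w)) =ᶠ[nhds z]
      fun w => r w * √|disc a b c w| := by
    filter_upwards [hU.eventually_mem hz] with w hw
    have e1 := h.gaussK_eq hε hU hR hN hw (hn w hw) (hd w hw) (hV w hw)
    have e2 : ‖gaussK ε R n w‖ = (r w ^ 2 * |disc a b c w|)⁻¹ := by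
      rw [e1, ← hr w hw]
      have h2 := (hr0 w hw)
      have h1 : (√(r w))⁻¹ ^ 2 = (r w)⁻¹ := by rw [inv_pow, Real.sq_sqrt h2.le]
      rw [h1, norm_div, norm_mul, norm_inv, Real.norm_of_nonneg h2.le]
      simp only [RCLike.ofReal_real_eq_id, id, Real.norm_eq_abs]
      field_simp
    have h3 : (0 : ℝ) ≤ r w ^ 2 * |disc a b c w| := by positivity
    rw [distinguished, dot_smul_left, dot_smul_right, hn w hw, dot_smul_left, dot_smul_right,
      ← hr w hw, e2]
    have h4 := rpow_neg_quarter_sq h3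
    rw [Real.sqrt_mul (by positivity), Real.sqrt_sq (hr0 w hw).le] at h4
    have h5 := hl2 w hw
    simp only [l] at h5
    rw [← h4]
    linear_combination ((r w ^ 2 * |disc a b c w|)⁻¹ ^ (-(1 / 4) : ℝ)) ^ 2 * h5
  have e := h.starDStarD_eq hε hU hR hN hn hd hlV hz hτ hu hX.differentiableAt hY.differentiableAt
  rw [(hf z hz).2] at e
  have hs0 : s z ≠ 0 := fun h0 => by
    have h1 := hs2 z hz
    have h2 := hlV z hz
    have h3 := hd z hz
    rw [h0] at h1
    have : 0 < (l z * vol (N z) (dx N z) (dy N z)) ^ 2 * |disc a b c z| := by positivity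
    rw [← h1] at this
    simp at this
  have hτ0 : τ z ≠ 0 := fun h0 => by simpa [h0] using hτ2 z hz
  exact ((smul_eq_zero.1 ((smul_eq_zero.1 e.symm).resolve_left (inv_ne_zero hs0))).resolve_left hτ0)

end Curvature

/-! ### The linear system for X = θN' and the self-adjoint equation for θ. -/

section MoutardCore

variable {𝕜 : Type*} [RCLike 𝕜]

/-- The coefficients `a`, `b`, `c` of a self-adjoint equation with solution `N` and potential `f`,
together with a solution `p` of the system that governs the scalar product of `N` and its
transform. -/
structure MoutardData (ε : ℝ) (k : ℕ∞) (U : Set (ℝ × ℝ)) (a b c f p : ℝ × ℝ → 𝕜)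
    (N : ℝ × ℝ → Vec 𝕜) : Prop where
  isOpen : IsOpen U
  two_le : 2 ≤ k
  contDiffOn_a : ContDiffOn ℝ k a U
  contDiffOn_b : ContDiffOn ℝ k b U
  contDiffOn_c : ContDiffOn ℝ k c U
  contDiffOn_p : ContDiffOn ℝ k p U
  contDiffOn_N : ContDiffOn ℝ ((k : WithTop ℕ∞) + 1) N U
  eqN : ∀ z ∈ U, dx (fun w => a w • dx N w + c w • dy N w) z
    + dy (fun w => c w • dx N w + b w • dy N w) z = f z • N z
  eqp₁ : ∀ z ∈ U, c z * dx p z + b z * dy p z = -((a z * b z - c z ^ 2) * dot ε (N z) (dx N z)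
    + dx (fun w => dot ε (N w) (N w) * (a w * b w - c w ^ 2) / 2) z)
  eqp₂ : ∀ z ∈ U, a z * dx p z + c z * dy p z = (a z * b z - c z ^ 2) * dot ε (N z) (dy N z)
    + dy (fun w => dot ε (N w) (N w) * (a w * b w - c w ^ 2) / 2) z
  p_ne : ∀ z ∈ U, p z ≠ 0
  q_ne : ∀ z ∈ U, p z ^ 2 + dot ε (N z) (N z) * (dot ε (N z) (N z) * (a z * b z - c z ^ 2)) ≠ 0

variable (ε : ℝ) (a b c p : ℝ × ℝ → 𝕜) (N : ℝ × ℝ → Vec 𝕜)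

/-- `θ` as a linear function of `X = θ N'`. -/
noncomputable def thetaOf (X : Vec 𝕜) (z : ℝ × ℝ) : 𝕜 := dot ε X (N z) / p z

/-- The right-hand side `p θ,ₓ + r (c θ,ₓ + b θ,ᵧ)` of the first equation for the derivatives
of `θ`. -/
noncomputable def rhs₁ (X : Vec 𝕜) (z : ℝ × ℝ) : 𝕜 :=
  dot ε X (dx N z)
    + thetaOf ε p N X z * (dot ε (c z • dx N z + b z • dy N z) (N z) - dx p z)

/-- The right-hand side `p θ,ᵧ - r (a θ,ₓ + c θ,ᵧ)` of the second equation for the derivatives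
of `θ`. -/
noncomputable def rhs₂ (X : Vec 𝕜) (z : ℝ × ℝ) : 𝕜 :=
  dot ε X (dy N z)
    - thetaOf ε p N X z * (dot ε (a z • dx N z + c z • dy N z) (N z) + dy p z)

/-- The derivative `θ,ₓ` as a linear function of `X`. -/
noncomputable def thetaX (X : Vec 𝕜) (z : ℝ × ℝ) : 𝕜 :=
  (p z * rhs₁ ε b c p N X z
    - dot ε (N z) (N z) * (c z * rhs₁ ε b c p N X z + b z * rhs₂ ε a c p N X z))
  / (p z ^ 2 + dot ε (N z) (N z) * (dot ε (N z) (N z) * (a z * b z - c z ^ 2)))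

/-- The derivative `θ,ᵧ` as a linear function of `X`. -/
noncomputable def thetaY (X : Vec 𝕜) (z : ℝ × ℝ) : 𝕜 :=
  (p z * rhs₂ ε a c p N X z
    + dot ε (N z) (N z) * (a z * rhs₁ ε b c p N X z + c z * rhs₂ ε a c p N X z))
  / (p z ^ 2 + dot ε (N z) (N z) * (dot ε (N z) (N z) * (a z * b z - c z ^ 2)))

/-- The derivative `X,ₓ` as a linear function of `X`. -/
noncomputable def moutardX (X : Vec 𝕜) (z : ℝ × ℝ) : Vec 𝕜 :=
  thetaOf ε p N X z • (c z • dx N z + b z • dy N z)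
    - (c z * thetaX ε a b c p N X z + b z * thetaY ε a b c p N X z) • N z

/-- The derivative `X,ᵧ` as a linear function of `X`. -/
noncomputable def moutardY (X : Vec 𝕜) (z : ℝ × ℝ) : Vec 𝕜 :=
  -(thetaOf ε p N X z • (a z • dx N z + c z • dy N z))
    + (a z * thetaX ε a b c p N X z + c z * thetaY ε a b c p N X z) • N z

variable {ε a b c p N} {k : ℕ∞} {U : Set (ℝ × ℝ)} {f : ℝ × ℝ → 𝕜}

/-- The first two equations are the differentiated relation pθ = X·N with the prescribed dX;
`thetaX` and `thetaY` solve them by Cramer's rule with determinant p² + r²Δ. The last two are their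
combinations with weights (a, c) and (c, b), in which the system for p replaces the derivatives of p
by those of m = rΔ/2. -/
theorem MoutardData.theta_eqs (h : MoutardData ε k U a b c f p N) {z : ℝ × ℝ} (hz : z ∈ U)
    (X : Vec 𝕜) :
    p z * thetaX ε a b c p N X z + dot ε (N z) (N z) *
      (c z * thetaX ε a b c p N X z + b z * thetaY ε a b c p N X z) = rhs₁ ε b c p N X z ∧
    p z * thetaY ε a b c p N X z - dot ε (N z) (N z) *
      (a z * thetaX ε a b c p N X z + c z * thetaY ε a b c p N X z) = rhs₂ ε a c p N X z ∧
    p z * (a z * thetaX ε a b c p N X z + c z * thetaY ε a b c p N X z)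
      + 2 * (dot ε (N z) (N z) * (a z * b z - c z ^ 2) / 2) * thetaY ε a b c p N X z
      = dot ε X (a z • dx N z + c z • dy N z) - thetaOf ε p N X z *
        dy (fun w => dot ε (N w) (N w) * (a w * b w - c w ^ 2) / 2) z ∧
    p z * (c z * thetaX ε a b c p N X z + b z * thetaY ε a b c p N X z)
      - 2 * (dot ε (N z) (N z) * (a z * b z - c z ^ 2) / 2) * thetaX ε a b c p N X z
      = dot ε X (c z • dx N z + b z • dy N z) + thetaOf ε p N X z *
        dx (fun w => dot ε (N w) (N w) * (a w * b w - c w ^ 2) / 2) z := by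
  have hq := h.q_ne z hz
  have e1 := h.eqp₁ z hz
  have e2 := h.eqp₂ z hz
  have hα : thetaX ε a b c p N X z * (p z ^ 2 + dot ε (N z) (N z) * (dot ε (N z) (N z) *
      (a z * b z - c z ^ 2))) = p z * rhs₁ ε b c p N X z
        - dot ε (N z) (N z) * (c z * rhs₁ ε b c p N X z + b z * rhs₂ ε a c p N X z) :=
    div_mul_cancel₀ _ hq
  have hβ : thetaY ε a b c p N X z * (p z ^ 2 + dot ε (N z) (N z) * (dot ε (N z) (N z) *
      (a z * b z - c z ^ 2))) = p z * rhs₂ ε a c p N X z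
        + dot ε (N z) (N z) * (a z * rhs₁ ε b c p N X z + c z * rhs₂ ε a c p N X z) :=
    div_mul_cancel₀ _ hq
  have h1 : p z * thetaX ε a b c p N X z + dot ε (N z) (N z) *
      (c z * thetaX ε a b c p N X z + b z * thetaY ε a b c p N X z) = rhs₁ ε b c p N X z := by
    refine mul_right_cancel₀ hq ?_
    linear_combination (p z + dot ε (N z) (N z) * c z) * hα + dot ε (N z) (N z) * b z * hβ
  have h2 : p z * thetaY ε a b c p N X z - dot ε (N z) (N z) *
      (a z * thetaX ε a b c p N X z + c z * thetaY ε a b c p N X z) = rhs₂ ε a c p N X z := by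
    refine mul_right_cancel₀ hq ?_
    linear_combination (p z - dot ε (N z) (N z) * c z) * hβ - dot ε (N z) (N z) * a z * hα
  refine ⟨h1, h2, ?_, ?_⟩
  · simp only [rhs₁, rhs₂, dot_add_left, dot_add_right, dot_smul_left, dot_smul_right,
      dot_comm (dx N z) (N z), dot_comm (dy N z) (N z)] at h1 h2 ⊢
    linear_combination a z * h1 + c z * h2 - thetaOf ε p N X z * e2
  · simp only [rhs₁, rhs₂, dot_add_left, dot_add_right, dot_smul_left, dot_smul_right,
      dot_comm (dx N z) (N z), dot_comm (dy N z) (N z)] at h1 h2 ⊢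
    linear_combination c z * h1 + b z * h2 - thetaOf ε p N X z * e1

theorem MoutardData.one_le (h : MoutardData ε k U a b c f p N) : (1 : WithTop ℕ∞) ≤ k := by
  have := h.two_le
  exact_mod_cast (one_le_two.trans this)

theorem MoutardData.two_le' (h : MoutardData ε k U a b c f p N) : (2 : WithTop ℕ∞) ≤ k := by
  exact (WithTop.coe_le_coe.2 h.two_le : ((2 : ℕ∞) : WithTop ℕ∞) ≤ k)

theorem MoutardData.contDiffOn_m (h : MoutardData ε k U a b c f p N) :
    ContDiffOn ℝ k (fun w => dot ε (N w) (N w) * (a w * b w - c w ^ 2) / 2) U :=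
  ((contDiffOn_dot ε (h.contDiffOn_N.of_le le_self_add) (h.contDiffOn_N.of_le le_self_add)).mul
    ((h.contDiffOn_a.mul h.contDiffOn_b).sub (h.contDiffOn_c.pow 2))).div_const 2

/-- The derivatives of `θ`, at a point where `X` solves the linear system to first order. -/
theorem MoutardData.hasGrad_theta (h : MoutardData ε k U a b c f p N) {z : ℝ × ℝ} (hz : z ∈ U)
    {X : ℝ × ℝ → Vec 𝕜}
    (hX : HasGrad X (moutardX ε a b c p N (X z) z) (moutardY ε a b c p N (X z) z) z) :
    HasGrad (fun w => thetaOf ε p N (X w) w) (thetaX ε a b c p N (X z) z)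
      (thetaY ε a b c p N (X z) z) z := by
  have hN := h.contDiffOn_N.hasGrad h.isOpen le_add_self hz
  have hp := h.contDiffOn_p.hasGrad h.isOpen h.one_le hz
  have hp0 := h.p_ne z hz
  obtain ⟨h1, h2, -, -⟩ := h.theta_eqs hz (X z)
  have hθ : thetaOf ε p N (X z) z * p z = dot ε (X z) (N z) := div_mul_cancel₀ _ hp0
  refine ((hX.dot ε hN).div hp hp0).congr_grad ?_ ?_ <;> rw [div_eq_iff (pow_ne_zero 2 hp0)]
  · simp only [rhs₁, moutardX, dot_add_left, dot_sub_left, dot_smul_left,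
      dot_comm (dx N z) (N z), dot_comm (dy N z) (N z)] at h1 ⊢
    linear_combination -p z * h1 + dx p z * hθ
  · simp only [rhs₂, moutardY, dot_add_left, dot_neg_left, dot_smul_left,
      dot_comm (dx N z) (N z), dot_comm (dy N z) (N z)] at h2 ⊢
    linear_combination -p z * h2 + dy p z * hθ

/-- Differentiability of X at the single point suffices, as needed for testing compatibility on
jets. -/
theorem MoutardData.differentiableAt_theta (h : MoutardData ε k U a b c f p N) {z : ℝ × ℝ}
    (hz : z ∈ U) {X : ℝ × ℝ → Vec 𝕜} (hX : DifferentiableAt ℝ X z) :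
    DifferentiableAt ℝ (fun w => thetaX ε a b c p N (X w) w) z ∧
    DifferentiableAt ℝ (fun w => thetaY ε a b c p N (X w) w) z := by
  have hU := h.isOpen
  have hX := hX.hasGrad
  have hN := h.contDiffOn_N.hasGrad hU le_add_self hz
  have hNx := (contDiffOn_dx hU h.contDiffOn_N le_rfl).hasGrad hU h.one_le hz
  have hNy := (contDiffOn_dy hU h.contDiffOn_N le_rfl).hasGrad hU h.one_le hz
  have hp := h.contDiffOn_p.hasGrad hU h.one_le hz
  have h11 : (1 : WithTop ℕ∞) + 1 ≤ k := by rw [one_add_one_eq_two]; exact h.two_le'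
  have hpx := (contDiffOn_dx hU h.contDiffOn_p h11).hasGrad hU le_rfl hz
  have hpy := (contDiffOn_dy hU h.contDiffOn_p h11).hasGrad hU le_rfl hz
  have ha := h.contDiffOn_a.hasGrad hU h.one_le hz
  have hb := h.contDiffOn_b.hasGrad hU h.one_le hz
  have hc := h.contDiffOn_c.hasGrad hU h.one_le hz
  have hθ := (hX.dot ε hN).div hp (h.p_ne z hz)
  have hE1 := (hX.dot ε hNx).add (hθ.mul ((((hc.smul hNx).add (hb.smul hNy)).dot ε hN).sub hpx))
  have hE2 := (hX.dot ε hNy).sub (hθ.mul ((((ha.smul hNx).add (hc.smul hNy)).dot ε hN).add hpy))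
  have hr := hN.dot ε hN
  have hq := (hp.mul hp).add (hr.mul (hr.mul ((ha.mul hb).sub (hc.mul hc))))
  have hq0 := h.q_ne z hz
  simp only [sq] at hq0
  refine ⟨(((hp.mul hE1).sub (hr.mul ((hc.mul hE1).add (hb.mul hE2)))).div hq
    hq0).differentiableAt.congr_of_eventuallyEq (.of_forall fun w => ?_),
    (((hp.mul hE2).add (hr.mul ((ha.mul hE1).add (hc.mul hE2)))).div hq
    hq0).differentiableAt.congr_of_eventuallyEq (.of_forall fun w => ?_)⟩ <;>
    simp only [thetaX, thetaY, rhs₁, rhs₂, thetaOf, sq]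

/-- At a point where `X` solves the linear system to first order, `θ` solves the self-adjoint
equation. -/
theorem MoutardData.theta_selfAdjoint (h : MoutardData ε k U a b c f p N) {z : ℝ × ℝ} (hz : z ∈ U)
    {X : ℝ × ℝ → Vec 𝕜}
    (hX : HasGrad X (moutardX ε a b c p N (X z) z) (moutardY ε a b c p N (X z) z) z) :
    dx (fun w => a w * thetaX ε a b c p N (X w) w + c w * thetaY ε a b c p N (X w) w) z
      + dy (fun w => c w * thetaX ε a b c p N (X w) w + b w * thetaY ε a b c p N (X w) w) z
      = f z * thetaOf ε p N (X z) z := by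
  have hU := h.isOpen
  have hN := h.contDiffOn_N.hasGrad hU le_add_self hz
  have hNx := (contDiffOn_dx hU h.contDiffOn_N le_rfl).hasGrad hU h.one_le hz
  have hNy := (contDiffOn_dy hU h.contDiffOn_N le_rfl).hasGrad hU h.one_le hz
  have hp := h.contDiffOn_p.hasGrad hU h.one_le hz
  have h11 : (1 : WithTop ℕ∞) + 1 ≤ k := by rw [one_add_one_eq_two]; exact h.two_le'
  have hpx := (contDiffOn_dx hU h.contDiffOn_p h11).hasGrad hU le_rfl hz
  have hpy := (contDiffOn_dy hU h.contDiffOn_p h11).hasGrad hU le_rfl hz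
  have hm := h.contDiffOn_m.hasGrad hU h.one_le hz
  have hmx := (contDiffOn_dx hU h.contDiffOn_m h11).hasGrad hU le_rfl hz
  have hmy := (contDiffOn_dy hU h.contDiffOn_m h11).hasGrad hU le_rfl hz
  have ha := h.contDiffOn_a.hasGrad hU h.one_le hz
  have hb := h.contDiffOn_b.hasGrad hU h.one_le hz
  have hc := h.contDiffOn_c.hasGrad hU h.one_le hz
  have hθ := h.hasGrad_theta hz hX
  obtain ⟨hα, hβ⟩ := h.differentiableAt_theta hz hX.differentiableAt
  have hα := hα.hasGrad
  have hβ := hβ.hasGrad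
  have hA := ((ha.mul hα).add (hc.mul hβ)).differentiableAt.hasGrad
  have hB := ((hc.mul hα).add (hb.mul hβ)).differentiableAt.hasGrad
  have hw := ((ha.smul hNx).add (hc.smul hNy)).differentiableAt.hasGrad
  have hu := ((hc.smul hNx).add (hb.smul hNy)).differentiableAt.hasGrad
  have hr := hN.dot ε hN
  have hmem := hU.eventually_mem hz
  have h2 := hasGrad_const (2 : 𝕜) z
  -- The first and fourth identities of `theta_eqs` are differentiated in y, the second and third in
  -- x.
  obtain ⟨-, eI⟩ := ((hp.mul hα).add (hr.mul hB)).unique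
    ((hX.dot ε hNx).add (hθ.mul ((hu.dot ε hN).sub hpx)))
    (by filter_upwards [hmem] with w hw using (h.theta_eqs hw (X w)).1.symm)
  obtain ⟨eII, -⟩ := ((hp.mul hβ).sub (hr.mul hA)).unique
    ((hX.dot ε hNy).sub (hθ.mul ((hw.dot ε hN).add hpy)))
    (by filter_upwards [hmem] with w hw using (h.theta_eqs hw (X w)).2.1.symm)
  obtain ⟨eIII, -⟩ := ((hp.mul hA).add ((h2.mul hm).mul hβ)).unique
    ((hX.dot ε hw).sub (hθ.mul hmy))
    (by filter_upwards [hmem] with w hw using (h.theta_eqs hw (X w)).2.2.1.symm)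
  obtain ⟨-, eIV⟩ := ((hp.mul hB).sub ((h2.mul hm).mul hα)).unique
    ((hX.dot ε hu).add (hθ.mul hmx))
    (by filter_upwards [hmem] with w hw using (h.theta_eqs hw (X w)).2.2.2.symm)
  have e1 := h.eqp₁ z hz
  have e2 := h.eqp₂ z hz
  have hq := h.q_ne z hz
  have ef : dot ε (dx (fun w => a w • dx N w + c w • dy N w) z) (N z)
      + dot ε (dy (fun w => c w • dx N w + b w • dy N w) z) (N z) = f z * dot ε (N z) (N z) := by
    rw [← dot_add_left, h.eqN z hz, dot_smul_left]
  have efX : dot ε (X z) (dx (fun w => a w • dx N w + c w • dy N w) z)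
      + dot ε (X z) (dy (fun w => c w • dx N w + b w • dy N w) z)
      = f z * (thetaOf ε p N (X z) z * p z) := by
    rw [← dot_add_right, h.eqN z hz, dot_smul_right, thetaOf, div_mul_cancel₀ _ (h.p_ne z hz)]
  have symN := dx_dy_comm hU h.contDiffOn_N (h.two_le'.trans le_self_add) hz
  have symp := dx_dy_comm hU h.contDiffOn_p h.two_le' hz
  have symm := dx_dy_comm hU h.contDiffOn_m h.two_le' hz
  rw [symN, symp] at eI
  rw [symm] at eIV
  simp only [moutardX, moutardY, dot_add_left, dot_add_right, dot_sub_left, dot_neg_left,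
    dot_smul_left, dot_smul_right, dot_comm (dx N z) (N z), dot_comm (dy N z) (N z),
    dot_comm (dy N z) (dx N z)] at eI eII eIII eIV
  set S₁ := dx (fun w => a w * thetaX ε a b c p N (X w) w + c w * thetaY ε a b c p N (X w) w) z
  set S₂ := dy (fun w => c w * thetaX ε a b c p N (X w) w + b w * thetaY ε a b c p N (X w) w) z
  -- X solves the system only to first order at z, so `thetaX` and `thetaY` need not have equal
  -- cross derivatives. Both this asymmetry and the defect of the self-adjoint equation are unknowns
  -- of the homogeneous linear equations `K1`, `K2`, whose determinant is p² + r²Δ.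
  have K1 : p z * (dy (fun w => thetaX ε a b c p N (X w) w) z
      - dx (fun w => thetaY ε a b c p N (X w) w) z) + dot ε (N z) (N z) * (S₁ + S₂)
      = dot ε (N z) (N z) * (f z * thetaOf ε p N (X z) z) := by
    linear_combination eI - eII + thetaOf ε p N (X z) z * ef
  have K2 : p z * (S₁ + S₂) - 2 * (dot ε (N z) (N z) * (a z * b z - c z ^ 2) / 2) *
      (dy (fun w => thetaX ε a b c p N (X w) w) z
      - dx (fun w => thetaY ε a b c p N (X w) w) z) = p z * (f z * thetaOf ε p N (X z) z) := by
    linear_combination eIII + eIV + efX - thetaX ε a b c p N (X z) z * e2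
      - thetaY ε a b c p N (X z) z * e1
  refine mul_right_cancel₀ hq ?_
  linear_combination p z * K2 + dot ε (N z) (N z) * (a z * b z - c z ^ 2) * K1

end MoutardCore

/-! ### Solvability, regularity and first integral of the system for X. -/

section MoutardSystem

variable {𝕜 : Type*} [RCLike 𝕜] {ε : ℝ} {k : ℕ∞} {U : Set (ℝ × ℝ)} {a b c f p : ℝ × ℝ → 𝕜}
  {N : ℝ × ℝ → Vec 𝕜}

theorem contDiffOn_div' {m : WithTop ℕ∞} {u v : ℝ × ℝ → 𝕜} (hu : ContDiffOn ℝ m u U)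
    (hv : ContDiffOn ℝ m v U) (h0 : ∀ z ∈ U, v z ≠ 0) : ContDiffOn ℝ m (fun z => u z / v z) U := by
  simp only [div_eq_mul_inv]
  exact hu.mul (hv.inv h0)

theorem MoutardData.contDiffOn_thetaOf (h : MoutardData ε k U a b c f p N) {m : WithTop ℕ∞}
    (hm : m ≤ k) {X : ℝ × ℝ → Vec 𝕜} (hX : ContDiffOn ℝ m X U) :
    ContDiffOn ℝ m (fun w => thetaOf ε p N (X w) w) U :=
  contDiffOn_div' (contDiffOn_dot ε hX (h.contDiffOn_N.of_le (hm.trans le_self_add)))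
    (h.contDiffOn_p.of_le hm) h.p_ne

/-- One order of differentiability is lost because the derivatives of p enter; integrating the
system restores it. -/
theorem MoutardData.contDiffOn_theta' (h : MoutardData ε k U a b c f p N) {m : WithTop ℕ∞}
    (hm : m + 1 ≤ k) {X : ℝ × ℝ → Vec 𝕜} (hX : ContDiffOn ℝ m X U) :
    ContDiffOn ℝ m (fun w => thetaX ε a b c p N (X w) w) U ∧
    ContDiffOn ℝ m (fun w => thetaY ε a b c p N (X w) w) U := by
  have hU := h.isOpen
  have hm' : m ≤ k := le_self_add.trans hm
  have hN := h.contDiffOn_N.of_le (hm'.trans le_self_add)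
  have hNx := (contDiffOn_dx hU h.contDiffOn_N le_rfl).of_le hm'
  have hNy := (contDiffOn_dy hU h.contDiffOn_N le_rfl).of_le hm'
  have hp := h.contDiffOn_p.of_le hm'
  have hpx := contDiffOn_dx hU h.contDiffOn_p hm
  have hpy := contDiffOn_dy hU h.contDiffOn_p hm
  have ha := h.contDiffOn_a.of_le hm'
  have hb := h.contDiffOn_b.of_le hm'
  have hc := h.contDiffOn_c.of_le hm'
  have hθ := h.contDiffOn_thetaOf hm' hX
  have hE1 := (contDiffOn_dot ε hX hNx).add (hθ.mul
    ((contDiffOn_dot ε ((hc.smul hNx).add (hb.smul hNy)) hN).sub hpx))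
  have hE2 := (contDiffOn_dot ε hX hNy).sub (hθ.mul
    ((contDiffOn_dot ε ((ha.smul hNx).add (hc.smul hNy)) hN).add hpy))
  have hr := contDiffOn_dot ε hN hN
  have hq := (hp.pow 2).add (hr.mul (hr.mul ((ha.mul hb).sub (hc.pow 2))))
  exact ⟨contDiffOn_div' ((hp.mul hE1).sub (hr.mul ((hc.mul hE1).add (hb.mul hE2)))) hq h.q_ne,
    contDiffOn_div' ((hp.mul hE2).add (hr.mul ((ha.mul hE1).add (hc.mul hE2)))) hq h.q_ne⟩

theorem MoutardData.contDiffOn_moutard (h : MoutardData ε k U a b c f p N) {m : WithTop ℕ∞}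
    (hm : m + 1 ≤ k) {X : ℝ × ℝ → Vec 𝕜} (hX : ContDiffOn ℝ m X U) :
    ContDiffOn ℝ m (fun w => moutardX ε a b c p N (X w) w) U ∧
    ContDiffOn ℝ m (fun w => moutardY ε a b c p N (X w) w) U := by
  have hU := h.isOpen
  have hm' : m ≤ k := le_self_add.trans hm
  have hN := h.contDiffOn_N.of_le (hm'.trans le_self_add)
  have hNx := (contDiffOn_dx hU h.contDiffOn_N le_rfl).of_le hm'
  have hNy := (contDiffOn_dy hU h.contDiffOn_N le_rfl).of_le hm'
  have ha := h.contDiffOn_a.of_le hm'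
  have hb := h.contDiffOn_b.of_le hm'
  have hc := h.contDiffOn_c.of_le hm'
  have hθ := h.contDiffOn_thetaOf hm' hX
  obtain ⟨hα, hβ⟩ := h.contDiffOn_theta' hm hX
  exact ⟨(hθ.smul ((hc.smul hNx).add (hb.smul hNy))).sub
      (((hc.mul hα).add (hb.mul hβ)).smul hN),
    (hθ.smul ((ha.smul hNx).add (hc.smul hNy))).neg.add
      (((ha.mul hα).add (hc.mul hβ)).smul hN)⟩

variable (ε a b c p N) in
theorem moutard_add (X Y : Vec 𝕜) (z : ℝ × ℝ) :
    moutardX ε a b c p N (X + Y) z = moutardX ε a b c p N X z + moutardX ε a b c p N Y z ∧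
    moutardY ε a b c p N (X + Y) z = moutardY ε a b c p N X z + moutardY ε a b c p N Y z := by
  have hθ : thetaOf ε p N (X + Y) z = thetaOf ε p N X z + thetaOf ε p N Y z := by
    simp only [thetaOf, dot_add_left, add_div]
  have h1 : rhs₁ ε b c p N (X + Y) z = rhs₁ ε b c p N X z + rhs₁ ε b c p N Y z := by
    simp only [rhs₁, hθ, dot_add_left]; ring
  have h2 : rhs₂ ε a c p N (X + Y) z = rhs₂ ε a c p N X z + rhs₂ ε a c p N Y z := by
    simp only [rhs₂, hθ, dot_add_left]; ring
  have h3 : thetaX ε a b c p N (X + Y) z = thetaX ε a b c p N X z + thetaX ε a b c p N Y z := by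
    simp only [thetaX, h1, h2]; ring
  have h4 : thetaY ε a b c p N (X + Y) z = thetaY ε a b c p N X z + thetaY ε a b c p N Y z := by
    simp only [thetaY, h1, h2]; ring
  constructor
  · simp only [moutardX, hθ, h3, h4]; module
  · simp only [moutardY, hθ, h3, h4]; module

variable (ε a b c p N) in
theorem moutard_smul (t : 𝕜) (X : Vec 𝕜) (z : ℝ × ℝ) :
    moutardX ε a b c p N (t • X) z = t • moutardX ε a b c p N X z ∧
    moutardY ε a b c p N (t • X) z = t • moutardY ε a b c p N X z := by
  have hθ : thetaOf ε p N (t • X) z = t * thetaOf ε p N X z := by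
    simp only [thetaOf, dot_smul_left, mul_div_assoc]
  have h1 : rhs₁ ε b c p N (t • X) z = t * rhs₁ ε b c p N X z := by
    simp only [rhs₁, hθ, dot_smul_left]; ring
  have h2 : rhs₂ ε a c p N (t • X) z = t * rhs₂ ε a c p N X z := by
    simp only [rhs₂, hθ, dot_smul_left]; ring
  have h3 : thetaX ε a b c p N (t • X) z = t * thetaX ε a b c p N X z := by
    simp only [thetaX, h1, h2]; ring
  have h4 : thetaY ε a b c p N (t • X) z = t * thetaY ε a b c p N X z := by
    simp only [thetaY, h1, h2]; ring
  constructor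
  · simp only [moutardX, hθ, h3, h4]; module
  · simp only [moutardY, hθ, h3, h4]; module

variable (ε a b c p N) in
/-- The coefficient of `dx` in the linear system for `X`. -/
noncomputable def moutardOpX (z : ℝ × ℝ) : Vec 𝕜 →L[ℝ] Vec 𝕜 :=
  LinearMap.toContinuousLinearMap
    { toFun := fun X => moutardX ε a b c p N X z
      map_add' := fun X Y => (moutard_add ε a b c p N X Y z).1
      map_smul' := fun t X => by
        simpa only [real_smul_vec, RingHom.id_apply] using (moutard_smul ε a b c p N (t : 𝕜) X z).1 }

variable (ε a b c p N) in
/-- The coefficient of `dy` in the linear system for `X`. -/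
noncomputable def moutardOpY (z : ℝ × ℝ) : Vec 𝕜 →L[ℝ] Vec 𝕜 :=
  LinearMap.toContinuousLinearMap
    { toFun := fun X => moutardY ε a b c p N X z
      map_add' := fun X Y => (moutard_add ε a b c p N X Y z).2
      map_smul' := fun t X => by
        simpa only [real_smul_vec, RingHom.id_apply] using (moutard_smul ε a b c p N (t : 𝕜) X z).2 }

@[simp] theorem moutardOpX_apply (X : Vec 𝕜) (z : ℝ × ℝ) :
    moutardOpX ε a b c p N z X = moutardX ε a b c p N X z := rfl

@[simp] theorem moutardOpY_apply (X : Vec 𝕜) (z : ℝ × ℝ) :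
    moutardOpY ε a b c p N z X = moutardY ε a b c p N X z := rfl

theorem MoutardData.contDiffOn_op (h : MoutardData ε k U a b c f p N) {m : WithTop ℕ∞}
    (hm : m + 1 ≤ k) : ContDiffOn ℝ m (moutardOpX ε a b c p N) U ∧
      ContDiffOn ℝ m (moutardOpY ε a b c p N) U :=
  ⟨contDiffOn_clm_apply.2 fun _ => (h.contDiffOn_moutard hm contDiffOn_const).1,
    contDiffOn_clm_apply.2 fun _ => (h.contDiffOn_moutard hm contDiffOn_const).2⟩

/-- In the difference of the cross derivatives the terms bilinear in dθ and dN cancel by symmetry of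
the coefficient matrix. What remains is θ times the self-adjoint operator on N minus N times that
operator on θ, and both equal fθN. -/
theorem MoutardData.compatible (h : MoutardData ε k U a b c f p N) {z : ℝ × ℝ} (hz : z ∈ U)
    (ξ : Vec 𝕜) :
    dy (moutardOpX ε a b c p N) z ξ + moutardOpX ε a b c p N z (moutardOpY ε a b c p N z ξ)
      = dx (moutardOpY ε a b c p N) z ξ
        + moutardOpY ε a b c p N z (moutardOpX ε a b c p N z ξ) := by
  have hU := h.isOpen
  have h11 : (1 : WithTop ℕ∞) + 1 ≤ k := by rw [one_add_one_eq_two]; exact h.two_le'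
  obtain ⟨hA, hB⟩ := h.contDiffOn_op h11
  refine compatible_of_jets (hA.hasGrad hU le_rfl hz).differentiableAt
    (hB.hasGrad hU le_rfl hz).differentiableAt (fun X hX => ?_) ξ
  simp only [moutardOpX_apply, moutardOpY_apply] at hX ⊢
  have hN := h.contDiffOn_N.hasGrad hU le_add_self hz
  have hNx := (contDiffOn_dx hU h.contDiffOn_N le_rfl).hasGrad hU h.one_le hz
  have hNy := (contDiffOn_dy hU h.contDiffOn_N le_rfl).hasGrad hU h.one_le hz
  have ha := h.contDiffOn_a.hasGrad hU h.one_le hz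
  have hb := h.contDiffOn_b.hasGrad hU h.one_le hz
  have hc := h.contDiffOn_c.hasGrad hU h.one_le hz
  have hθ := h.hasGrad_theta hz hX
  obtain ⟨hα, hβ⟩ := h.differentiableAt_theta hz hX.differentiableAt
  have hα := hα.hasGrad
  have hβ := hβ.hasGrad
  have hA := ((ha.mul hα).add (hc.mul hβ)).differentiableAt.hasGrad
  have hB := ((hc.mul hα).add (hb.mul hβ)).differentiableAt.hasGrad
  have hw := ((ha.smul hNx).add (hc.smul hNy)).differentiableAt.hasGrad
  have hu := ((hc.smul hNx).add (hb.smul hNy)).differentiableAt.hasGrad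
  have e1 := ((hθ.smul hu).sub (hB.smul hN)).dy_eq
  have e2 := ((hθ.smul hw).neg.add (hA.smul hN)).dx_eq
  have e3 := h.theta_selfAdjoint hz hX
  have e4 := h.eqN z hz
  change dy (fun w => thetaOf ε p N (X w) w • (c w • dx N w + b w • dy N w)
    - (c w * thetaX ε a b c p N (X w) w + b w * thetaY ε a b c p N (X w) w) • N w) z
    = dx (fun w => -(thetaOf ε p N (X w) w • (a w • dx N w + c w • dy N w))
    + (a w * thetaX ε a b c p N (X w) w + c w * thetaY ε a b c p N (X w) w) • N w) z
  rw [e1, e2]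
  rw [← eq_sub_iff_add_eq'] at e3 e4
  rw [e3, e4]
  module

/-- Solutions of the linear system for `X = θ N'`. -/
def MoutardSystem (ε : ℝ) (U : Set (ℝ × ℝ)) (a b c p : ℝ × ℝ → 𝕜) (N X : ℝ × ℝ → Vec 𝕜) : Prop :=
  ∀ z ∈ U, HasGrad X (moutardX ε a b c p N (X z) z) (moutardY ε a b c p N (X z) z) z

theorem moutardSystem_iff {X : ℝ × ℝ → Vec 𝕜} : MoutardSystem ε U a b c p N X ↔
    IsLinearSolution (moutardOpX ε a b c p N) (moutardOpY ε a b c p N) U X := Iff.rfl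

theorem MoutardSystem.contDiffOn (h : MoutardData ε k U a b c f p N) {X : ℝ × ℝ → Vec 𝕜}
    (hX : MoutardSystem ε U a b c p N X) : ContDiffOn ℝ k X U :=
  (moutardSystem_iff.1 hX).contDiffOn h.isOpen
    (fun m hm => (h.contDiffOn_op (by exact_mod_cast hm)).1)
    (fun m hm => (h.contDiffOn_op (by exact_mod_cast hm)).2)

theorem MoutardData.exists_moutardSystem (h : MoutardData ε k U a b c f p N)
    (hUc : IsSimplyConnected U) {z₀ : ℝ × ℝ} (hz₀ : z₀ ∈ U) (ξ : Vec 𝕜) :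
    ∃ X, X z₀ = ξ ∧ MoutardSystem ε U a b c p N X := by
  have h11 : (1 : WithTop ℕ∞) + 1 ≤ k := by rw [one_add_one_eq_two]; exact h.two_le'
  exact exists_isLinearSolution h.isOpen hUc (h.contDiffOn_op h11).1 (h.contDiffOn_op h11).2
    (fun z hz ξ => h.compatible hz ξ) hz₀ ξ

theorem MoutardSystem.eqOn (h : MoutardData ε k U a b c f p N) (hU : IsPreconnected U)
    {X Y : ℝ × ℝ → Vec 𝕜} (hX : MoutardSystem ε U a b c p N X) (hY : MoutardSystem ε U a b c p N Y)
    {z₀ : ℝ × ℝ} (hz₀ : z₀ ∈ U) (h₀ : X z₀ = Y z₀) : Set.EqOn X Y U := by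
  have h11 : (1 : WithTop ℕ∞) + 1 ≤ k := by rw [one_add_one_eq_two]; exact h.two_le'
  exact (moutardSystem_iff.1 hX).eqOn h.isOpen hU (h.contDiffOn_op h11).1.continuousOn
    (h.contDiffOn_op h11).2.continuousOn (moutardSystem_iff.1 hY) hz₀ h₀

/-- The quadratic first integral of the linear system. -/
noncomputable def firstIntegral (ε : ℝ) (a b c p : ℝ × ℝ → 𝕜) (N : ℝ × ℝ → Vec 𝕜) (X : Vec 𝕜)
    (z : ℝ × ℝ) : 𝕜 :=
  dot ε X X + 2 * thetaOf ε p N X z ^ 2 * (dot ε (N z) (N z) * (a z * b z - c z ^ 2) / 2)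

/-- The last two identities of `theta_eqs` express X·(cN_x + bN_y) and X·(aN_x + cN_y) so that the
derivatives of X·X are exactly those of −2mθ², m = rΔ/2. -/
theorem MoutardSystem.hasGrad_firstIntegral (h : MoutardData ε k U a b c f p N)
    {X : ℝ × ℝ → Vec 𝕜} (hX : MoutardSystem ε U a b c p N X) {z : ℝ × ℝ} (hz : z ∈ U) :
    HasGrad (fun w => firstIntegral ε a b c p N (X w) w) 0 0 z := by
  have hm := h.contDiffOn_m.hasGrad h.isOpen h.one_le hz
  have hθ := h.hasGrad_theta hz (hX z hz)
  obtain ⟨-, -, h3, h4⟩ := h.theta_eqs hz (X z)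
  have hθp : thetaOf ε p N (X z) z * p z = dot ε (X z) (N z) := div_mul_cancel₀ _ (h.p_ne z hz)
  refine (((hX z hz).dot ε (hX z hz)).add (((hasGrad_const (2 : 𝕜) z).mul (hθ.mul hθ)).mul
    hm)).congr (.of_forall fun w => by simp only [firstIntegral, sq]) ?_ ?_
  · simp only [moutardX, dot_add_left, dot_sub_left, dot_smul_left, dot_add_right, dot_sub_right,
      dot_smul_right, dot_comm (dx N z), dot_comm (dy N z), dot_comm (N z) (X z)] at h4 ⊢
    linear_combination 2 * (c z * thetaX ε a b c p N (X z) z + b z * thetaY ε a b c p N (X z) z)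
      * hθp - 2 * thetaOf ε p N (X z) z * h4
  · simp only [moutardY, dot_add_left, dot_neg_left, dot_smul_left, dot_add_right, dot_neg_right,
      dot_smul_right, dot_comm (dx N z), dot_comm (dy N z), dot_comm (N z) (X z)] at h3 ⊢
    linear_combination -2 * (a z * thetaX ε a b c p N (X z) z + c z * thetaY ε a b c p N (X z) z)
      * hθp + 2 * thetaOf ε p N (X z) z * h3

end MoutardSystem

/-! ### Real normal fields of Bianchi surfaces and the integration of p. -/

section NormalField

variable {𝕜 : Type*} [RCLike 𝕜]

theorem dot_ofRealVec (ε : ℝ) (u v : Vec ℝ) :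
    dot ε (ofRealVec 𝕜 u) (ofRealVec 𝕜 v) = ((dot ε u v : ℝ) : 𝕜) := by
  simp [dot_eq, ofRealVec]

theorem ofRealVec_smul (t : ℝ) (u : Vec ℝ) : ofRealVec 𝕜 (t • u) = (t : 𝕜) • ofRealVec 𝕜 u := by
  ext i; simp [ofRealVec]

theorem ofRealVec_add (u v : Vec ℝ) : ofRealVec 𝕜 (u + v) = ofRealVec 𝕜 u + ofRealVec 𝕜 v := by
  ext i; simp [ofRealVec]

theorem ofRealVec_cross (ε : ℝ) (u v : Vec ℝ) :
    ofRealVec 𝕜 (cross ε u v) = cross ε (ofRealVec 𝕜 u) (ofRealVec 𝕜 v) := by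
  ext i; fin_cases i <;> simp [ofRealVec, cross_eq]

/-- A real normal field `N` with `N · N = r > 0` that satisfies the normal field equations of
Bianchi surfaces. -/
structure BianchiNormal (ε : ℝ) (k : ℕ∞) (U : Set (ℝ × ℝ)) (a b c f r : ℝ × ℝ → ℝ)
    (N : ℝ × ℝ → Vec ℝ) : Prop where
  isOpen : IsOpen U
  two_le : 2 ≤ k
  contDiffOn_a : ContDiffOn ℝ k a U
  contDiffOn_b : ContDiffOn ℝ k b U
  contDiffOn_c : ContDiffOn ℝ k c U
  contDiffOn_N : ContDiffOn ℝ ((k : WithTop ℕ∞) + 1) N U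
  eqN : SelfAdjointEq U a b c f N
  r_eq : ∀ z ∈ U, r z = dot ε (N z) (N z)
  r_pos : ∀ z ∈ U, 0 < r z
  disc_ne : ∀ z ∈ U, disc a b c z ≠ 0
  div_flux : ∀ z ∈ U,
    dx (fluxX (conformal a b c a) (conformal a b c c) (fun w => r w * √|disc a b c w|)) z
      + dy (fluxY (conformal a b c b) (conformal a b c c) (fun w => r w * √|disc a b c w|)) z = 0

variable {ε : ℝ} {k : ℕ∞} {U : Set (ℝ × ℝ)} {a b c f r : ℝ × ℝ → ℝ} {N : ℝ × ℝ → Vec ℝ}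

namespace BianchiNormal

theorem mono (h : BianchiNormal ε k U a b c f r N) {V : Set (ℝ × ℝ)} (hV : IsOpen V)
    (hVU : V ⊆ U) : BianchiNormal ε k V a b c f r N where
  isOpen := hV
  two_le := h.two_le
  contDiffOn_a := h.contDiffOn_a.mono hVU
  contDiffOn_b := h.contDiffOn_b.mono hVU
  contDiffOn_c := h.contDiffOn_c.mono hVU
  contDiffOn_N := h.contDiffOn_N.mono hVU
  eqN z hz := h.eqN z (hVU hz)
  r_eq z hz := h.r_eq z (hVU hz)
  r_pos z hz := h.r_pos z (hVU hz)
  disc_ne z hz := h.disc_ne z (hVU hz)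
  div_flux z hz := h.div_flux z (hVU hz)

theorem one_le (h : BianchiNormal ε k U a b c f r N) : (1 : WithTop ℕ∞) ≤ k := by
  have := h.two_le
  exact_mod_cast (one_le_two.trans this)

theorem one_add_one_le (h : BianchiNormal ε k U a b c f r N) :
    (1 : WithTop ℕ∞) + 1 ≤ k := by
  rw [one_add_one_eq_two]
  exact (WithTop.coe_le_coe.2 h.two_le : ((2 : ℕ∞) : WithTop ℕ∞) ≤ k)

theorem contDiffOn_r (h : BianchiNormal ε k U a b c f r N) :
    ContDiffOn ℝ ((k : WithTop ℕ∞) + 1) r U :=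
  (contDiffOn_dot ε h.contDiffOn_N h.contDiffOn_N).congr h.r_eq

theorem contDiffOn_flux (h : BianchiNormal ε k U a b c f r N) {m : WithTop ℕ∞} (hm : m + 1 ≤ k) :
    ContDiffOn ℝ m (fluxX (conformal a b c a) (conformal a b c c)
      (fun w => r w * √|disc a b c w|)) U ∧
    ContDiffOn ℝ m (fluxY (conformal a b c b) (conformal a b c c)
      (fun w => r w * √|disc a b c w|)) U := by
  have hU := h.isOpen
  have hm' : m ≤ k := le_self_add.trans hm
  have hd := contDiffOn_disc h.contDiffOn_a h.contDiffOn_b h.contDiffOn_c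
  have hρ := (h.contDiffOn_r.of_le le_self_add).mul (contDiffOn_sqrt_abs hd h.disc_ne)
  have hA := (contDiffOn_conformal h.contDiffOn_a hd h.disc_ne).of_le hm'
  have hB := (contDiffOn_conformal h.contDiffOn_b hd h.disc_ne).of_le hm'
  have hC := (contDiffOn_conformal h.contDiffOn_c hd h.disc_ne).of_le hm'
  have hρx := contDiffOn_dx hU hρ hm
  have hρy := contDiffOn_dy hU hρ hm
  exact ⟨(hA.smul hρx).add (hC.smul hρy), (hB.smul hρy).add (hC.smul hρx)⟩

theorem contDiffOn_p (h : BianchiNormal ε k U a b c f r N) {p : ℝ × ℝ → 𝕜}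
    (hp : PSystem U a b c r p) : ContDiffOn ℝ k p U := by
  refine contDiffOn_of_hasGrad h.isOpen ((pSystem_iff h.disc_ne).1 hp) fun m hm _ => ?_
  obtain ⟨h1, h2⟩ := h.contDiffOn_flux (m := m) (by exact_mod_cast hm)
  exact ⟨contDiffOn_ofReal h2, contDiffOn_ofReal h1.neg⟩

theorem existsUnique_p (h : BianchiNormal ε k U a b c f r N) (hUc : IsSimplyConnected U)
    {z₀ : ℝ × ℝ} (hz₀ : z₀ ∈ U) (κ : 𝕜) :
    ∃ p : ℝ × ℝ → 𝕜, ContDiffOn ℝ k p U ∧ PSystem U a b c r p ∧ p z₀ = κ ∧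
      ∀ p₁ : ℝ × ℝ → 𝕜, PSystem U a b c r p₁ → p₁ z₀ = κ → Set.EqOn p₁ p U := by
  have hU := h.isOpen
  obtain ⟨h1, h2⟩ := h.contDiffOn_flux h.one_add_one_le
  -- The form dp is real and is closed precisely by the scalar normal field equation; only the
  -- constant of integration lies in `𝕜`.
  obtain ⟨p, hp0, hp⟩ := exists_potential hU hUc h2 h1.neg (fun z hz => by
    have e1 := (h1.hasGrad hU le_rfl hz).neg.dx_eq
    have e2 := h.div_flux z hz
    exact Eq.trans (by linarith) e1.symm) hz₀
  have hsys : PSystem U a b c r (fun z => κ + (p z : 𝕜)) := (pSystem_iff h.disc_ne).2 fun z hz =>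
    ((hasGrad_const κ z).add (hp z hz).ofReal).congr_grad (zero_add _) (zero_add _)
  refine ⟨_, h.contDiffOn_p hsys, hsys, by simp [hp0], fun p₁ hp₁ h₁ z hz => ?_⟩
  have := eqOn_of_grad_eq hU hUc.isPathConnected.isConnected.isPreconnected
    ((pSystem_iff h.disc_ne).1 hp₁) ((pSystem_iff h.disc_ne).1 hsys) hz₀ hz
  simpa [h₁, hp0, sub_eq_iff_eq_add, add_comm] using this

/-- Applying the coefficient matrix to the conjugate differential of r√|Δ| returns its gradient up
to sgn Δ·√|Δ|, and sgn Δ·√|Δ|(r√|Δ|)_x = Δr_x + rΔ_x/2. This rids the system for p of square roots.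
-/
theorem flux_eqs (h : BianchiNormal ε k U a b c f r N) {z : ℝ × ℝ} (hz : z ∈ U) :
    c z * fluxY (conformal a b c b) (conformal a b c c) (fun w => r w * √|disc a b c w|) z
      + b z * -fluxX (conformal a b c a) (conformal a b c c) (fun w => r w * √|disc a b c w|) z
      = -(disc a b c z * dot ε (N z) (dx N z)
        + dx (fun w => dot ε (N w) (N w) * disc a b c w / 2) z) ∧
    a z * fluxY (conformal a b c b) (conformal a b c c) (fun w => r w * √|disc a b c w|) z
      + c z * -fluxX (conformal a b c a) (conformal a b c c) (fun w => r w * √|disc a b c w|) z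
      = disc a b c z * dot ε (N z) (dy N z)
        + dy (fun w => dot ε (N w) (N w) * disc a b c w / 2) z := by
  have hU := h.isOpen
  have hd := (contDiffOn_disc h.contDiffOn_a h.contDiffOn_b h.contDiffOn_c).hasGrad hU h.one_le hz
  have hN := h.contDiffOn_N.hasGrad hU le_add_self hz
  have hr := (hN.dot ε hN).congr (g := r)
    (by filter_upwards [hU.eventually_mem hz] with w hw using h.r_eq w hw) rfl rfl
  have hd0 := h.disc_ne z hz
  have hρ := hr.mul (hd.sqrt_abs hd0)
  have hm := ((hN.dot ε hN).mul hd).div (hasGrad_const (2 : ℝ) z) two_ne_zero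
  have e := conformal_disc hd0
  have e0 := (sqrt_abs_pos hd0).ne'
  have e1 : √|disc a b c z| ^ 2 = Real.sign (disc a b c z) * disc a b c z := by
    rw [Real.sq_sqrt (abs_nonneg _), sign_mul_self_eq_abs]
  have e2 := sign_mul_sign hd0
  have ea : a z = conformal a b c a z * √|disc a b c z| := (div_mul_cancel₀ _ e0).symm
  have eb : b z = conformal a b c b z * √|disc a b c z| := (div_mul_cancel₀ _ e0).symm
  have ec : c z = conformal a b c c z * √|disc a b c z| := (div_mul_cancel₀ _ e0).symm
  rw [hm.dx_eq, hm.dy_eq]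
  simp only [fluxX, fluxY, hρ.dx_eq, hρ.dy_eq, smul_eq_mul, h.r_eq z hz,
    dot_comm (dx N z) (N z), dot_comm (dy N z) (N z)]
  rw [ea, eb, ec]
  generalize conformal a b c a z = A at *
  generalize conformal a b c b z = B at *
  generalize conformal a b c c z = C at *
  generalize Real.sign (disc a b c z) = σ at *
  generalize √|disc a b c z| = s at *
  generalize disc a b c z = Δ at *
  have e3 : σ * s ^ 2 = Δ := by rw [e1, ← mul_assoc, e2, one_mul]
  constructor
  · field_simp
    linear_combination (-8 * dot ε (N z) (dx N z) * s ^ 2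
      - 2 * dot ε (N z) (N z) * σ * dx (disc a b c) z) * e - 8 * dot ε (N z) (dx N z) * e3
      - 2 * dot ε (N z) (N z) * dx (disc a b c) z * e2
  · field_simp
    linear_combination (8 * dot ε (N z) (dy N z) * s ^ 2
      + 2 * dot ε (N z) (N z) * σ * dy (disc a b c) z) * e + 8 * dot ε (N z) (dy N z) * e3
      + 2 * dot ε (N z) (N z) * dy (disc a b c) z * e2

/-- The real data are viewed over `𝕜`, since p and the transform may be complex. -/
theorem moutardData (h : BianchiNormal ε k U a b c f r N) {p : ℝ × ℝ → 𝕜}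
    (hp : PSystem U a b c r p)
    (hp0 : ∀ z ∈ U, p z ≠ 0 ∧ p z ^ 2 + (r z : 𝕜) ^ 2 * (disc a b c z : 𝕜) ≠ 0) :
    MoutardData ε k U (fun z => (a z : 𝕜)) (fun z => (b z : 𝕜)) (fun z => (c z : 𝕜))
      (fun z => (f z : 𝕜)) p (fun z => ofRealVec 𝕜 (N z)) := by
  have hU := h.isOpen
  have hNx : ∀ z ∈ U, dx (fun w => ofRealVec 𝕜 (N w)) z = ofRealVec 𝕜 (dx N z) := fun z hz =>
    (h.contDiffOn_N.hasGrad hU le_add_self hz).ofRealVec.dx_eq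
  have hNy : ∀ z ∈ U, dy (fun w => ofRealVec 𝕜 (N w)) z = ofRealVec 𝕜 (dy N z) := fun z hz =>
    (h.contDiffOn_N.hasGrad hU le_add_self hz).ofRealVec.dy_eq
  have hm : (fun w => dot ε (ofRealVec 𝕜 (N w)) (ofRealVec 𝕜 (N w))
      * ((a w : 𝕜) * (b w : 𝕜) - (c w : 𝕜) ^ 2) / 2)
      = fun w => ((dot ε (N w) (N w) * disc a b c w / 2 : ℝ) : 𝕜) := by
    funext w
    simp only [dot_ofRealVec, disc]
    push_cast
    rfl
  have hm' : ∀ z ∈ U, HasGrad (fun w => dot ε (N w) (N w) * disc a b c w / 2) _ _ z := fun z hz =>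
    (((contDiffOn_dot ε h.contDiffOn_N h.contDiffOn_N).of_le le_self_add).mul
      (contDiffOn_disc h.contDiffOn_a h.contDiffOn_b h.contDiffOn_c)).div_const 2 |>.hasGrad hU
      h.one_le hz
  exact
  { isOpen := hU
    two_le := h.two_le
    contDiffOn_a := contDiffOn_ofReal h.contDiffOn_a
    contDiffOn_b := contDiffOn_ofReal h.contDiffOn_b
    contDiffOn_c := contDiffOn_ofReal h.contDiffOn_c
    contDiffOn_p := h.contDiffOn_p hp
    contDiffOn_N := contDiffOn_ofRealVec h.contDiffOn_N
    eqN := fun z hz => by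
      obtain ⟨-, hw, hu, e⟩ := h.eqN z hz
      have hmem := hU.eventually_mem hz
      have e1 := (hw.hasGrad.ofRealVec (𝕜 := 𝕜)).congr
        (g := fun w => (a w : 𝕜) • dx (fun w => ofRealVec 𝕜 (N w)) w
          + (c w : 𝕜) • dy (fun w => ofRealVec 𝕜 (N w)) w) (by
        filter_upwards [hmem] with w hw
        rw [hNx w hw, hNy w hw, ofRealVec_add, ofRealVec_smul, ofRealVec_smul]) rfl rfl
      have e2 := (hu.hasGrad.ofRealVec (𝕜 := 𝕜)).congr
        (g := fun w => (c w : 𝕜) • dx (fun w => ofRealVec 𝕜 (N w)) w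
          + (b w : 𝕜) • dy (fun w => ofRealVec 𝕜 (N w)) w) (by
        filter_upwards [hmem] with w hw
        rw [hNx w hw, hNy w hw, ofRealVec_add, ofRealVec_smul, ofRealVec_smul, add_comm]) rfl rfl
      rw [e1.dx_eq, e2.dy_eq, ← ofRealVec_add, e, ofRealVec_smul]
    eqp₁ := fun z hz => by
      have hpz := (pSystem_iff h.disc_ne).1 hp z hz
      rw [hm, (hm' z hz).ofReal.dx_eq, hpz.dx_eq, hpz.dy_eq, hNx z hz, dot_ofRealVec]
      have := congrArg (fun t : ℝ => (t : 𝕜)) (h.flux_eqs hz).1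
      simp only [disc] at this ⊢
      push_cast at this ⊢
      exact this
    eqp₂ := fun z hz => by
      have hpz := (pSystem_iff h.disc_ne).1 hp z hz
      rw [hm, (hm' z hz).ofReal.dy_eq, hpz.dx_eq, hpz.dy_eq, hNy z hz, dot_ofRealVec]
      have := congrArg (fun t : ℝ => (t : 𝕜)) (h.flux_eqs hz).2
      simp only [disc] at this ⊢
      push_cast at this ⊢
      exact this
    p_ne := fun z hz => (hp0 z hz).1
    q_ne := fun z hz => by
      have := (hp0 z hz).2
      rw [dot_ofRealVec, ← h.r_eq z hz]
      rw [disc] at this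
      push_cast at this
      rwa [← mul_assoc, ← sq] }

end BianchiNormal

end NormalField

/-! ### Translation between the vector X and its components in the frame. -/

section Frame

variable {𝕜 : Type*} [RCLike 𝕜]

/-- The n_0-coefficient of the x-equation, with s = √r, `sx`, `sy` its derivatives, `ux`, `uy` the
sums p_μ⁰x^μ, q_μ⁰x^μ, and `E₁`, `E₂` the values of `rhs₁`, `rhs₂`. -/
theorem frame_coeff_x {p s a b c x0 sx sy px py ux uy q : 𝕜} (hp : p ≠ 0) (hq : q ≠ 0)
    (hqe : q = p ^ 2 + s ^ 2 * (s ^ 2 * (a * b - c ^ 2))) {E₁ E₂ : 𝕜}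
    (h1 : E₁ = (x0 * sx - s * ux) + x0 * s / p * (s * (c * sx + b * sy) - px))
    (h2 : E₂ = (x0 * sy - s * uy) - x0 * s / p * (s * (a * sx + c * sy) + py)) :
    p ^ 2 / q * (((s ^ 2 / p * c - 1) * ux + s ^ 2 / p * b * uy)
      + s ^ 2 / p ^ 2 * ((c + s ^ 2 / p * (a * b - c ^ 2)) * px + b * py) * x0) + ux
      = x0 * s / p * (c * sx + b * sy) - (c * ((p * E₁ - s ^ 2 * (c * E₁ + b * E₂)) / q)
        + b * ((p * E₂ + s ^ 2 * (a * E₁ + c * E₂)) / q)) * s := by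
  subst h1 h2
  field_simp
  subst hqe
  ring

theorem frame_coeff_y {p s a b c x0 sx sy px py ux uy q : 𝕜} (hp : p ≠ 0) (hq : q ≠ 0)
    (hqe : q = p ^ 2 + s ^ 2 * (s ^ 2 * (a * b - c ^ 2))) {E₁ E₂ : 𝕜}
    (h1 : E₁ = (x0 * sx - s * ux) + x0 * s / p * (s * (c * sx + b * sy) - px))
    (h2 : E₂ = (x0 * sy - s * uy) - x0 * s / p * (s * (a * sx + c * sy) + py)) :
    -(p ^ 2 / q) * (((s ^ 2 / p * c + 1) * uy + s ^ 2 / p * a * ux)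
      + s ^ 2 / p ^ 2 * ((c - s ^ 2 / p * (a * b - c ^ 2)) * py + a * px) * x0) + uy
      = -(x0 * s / p * (a * sx + c * sy)) + (a * ((p * E₁ - s ^ 2 * (c * E₁ + b * E₂)) / q)
        + c * ((p * E₂ + s ^ 2 * (a * E₁ + c * E₂)) / q)) * s := by
  subst h1 h2
  field_simp
  subst hqe
  ring

/-- An orthonormal frame along a surface adapted to the normal field `N`, with its rotation
coefficients. -/
structure AdaptedFrame (ε : ℝ) (k : ℕ∞) (U : Set (ℝ × ℝ)) (r : ℝ × ℝ → ℝ) (N : ℝ × ℝ → Vec ℝ)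
    (n : Fin 3 → ℝ × ℝ → Vec ℝ) (P Q : Fin 3 → Fin 3 → ℝ × ℝ → ℝ) : Prop where
  contDiffOn : ∀ A, ContDiffOn ℝ ((k : WithTop ℕ∞) + 1) (n A) U
  n_zero : ∀ z ∈ U, n 0 z = (√(r z))⁻¹ • N z
  frame : ∀ z ∈ U, ∀ A B,
    dot ε (n A z) (n B z) = if A = B then (if A = 0 then 1 else ε) else 0
  dx_eq : ∀ z ∈ U, ∀ A, dx (n A) z = ∑ B, P A B z • n B z
  dy_eq : ∀ z ∈ U, ∀ A, dy (n A) z = ∑ B, Q A B z • n B z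

/-- The vector field with components `x` with respect to the frame `n`. -/
def frameVec (x : Fin 3 → ℝ × ℝ → 𝕜) (n : Fin 3 → ℝ × ℝ → Vec ℝ) (z : ℝ × ℝ) : Vec 𝕜 :=
  ∑ A, x A z • ofRealVec 𝕜 (n A z)

variable {ε : ℝ} {k : ℕ∞} {U : Set (ℝ × ℝ)} {r : ℝ × ℝ → ℝ} {N : ℝ × ℝ → Vec ℝ}
  {n : Fin 3 → ℝ × ℝ → Vec ℝ} {P Q : Fin 3 → Fin 3 → ℝ × ℝ → ℝ}

namespace AdaptedFrame

theorem mono (h : AdaptedFrame ε k U r N n P Q) {V : Set (ℝ × ℝ)} (hVU : V ⊆ U) :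
    AdaptedFrame ε k V r N n P Q where
  contDiffOn A := (h.contDiffOn A).mono hVU
  n_zero z hz := h.n_zero z (hVU hz)
  frame z hz := h.frame z (hVU hz)
  dx_eq z hz := h.dx_eq z (hVU hz)
  dy_eq z hz := h.dy_eq z (hVU hz)

theorem dot_frameVec_left (h : AdaptedFrame ε k U r N n P Q) {z : ℝ × ℝ} (hz : z ∈ U)
    (x : Fin 3 → 𝕜) (A : Fin 3) :
    dot ε (∑ B, x B • ofRealVec 𝕜 (n B z)) (ofRealVec 𝕜 (n A z))
      = x A * (if A = 0 then 1 else (ε : 𝕜)) := by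
  simp only [Fin.sum_univ_three, dot_add_left, dot_smul_left, dot_ofRealVec, h.frame z hz]
  fin_cases A <;> simp

/-- The vector n_1 × n_2 is parallel to n_0. If its product with n_0 were zero it would vanish,
whereas Lagrange's identity gives its square as ε² = 1. -/
theorem vol_ne_zero (hε : ε = 1 ∨ ε = -1) (h : AdaptedFrame ε k U r N n P Q) {z : ℝ × ℝ}
    (hz : z ∈ U) :
    vol (ofRealVec 𝕜 (n 0 z)) (ofRealVec 𝕜 (n 1 z)) (ofRealVec 𝕜 (n 2 z)) ≠ 0 := by
  intro h0
  have hf : ∀ A B, dot ε (ofRealVec 𝕜 (n A z)) (ofRealVec 𝕜 (n B z))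
    = ((if A = B then (if A = 0 then 1 else ε) else 0 : ℝ) : 𝕜) := fun A B => by
    rw [dot_ofRealVec, h.frame z hz]
  set e₀ : Vec 𝕜 := ofRealVec 𝕜 (n 0 z)
  set e₁ : Vec 𝕜 := ofRealVec 𝕜 (n 1 z)
  set e₂ : Vec 𝕜 := ofRealVec 𝕜 (n 2 z)
  have h1 := smul_eq_of_cross_eq_zero hε (u := e₀) (v := cross ε e₁ e₂)
    (by rw [cross_cross hε, hf, hf]; simp)
  rw [dot_cross hε, h0, hf, zero_smul] at h1
  have h2 := dot_cross_cross hε e₁ e₂ e₁ e₂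
  rw [show cross ε e₁ e₂ = 0 by simpa using h1, dot_zero_left, hf, hf, hf, hf] at h2
  rcases hε with rfl | rfl <;> simp at h2

theorem sum_injective (hε : ε = 1 ∨ ε = -1) (h : AdaptedFrame ε k U r N n P Q) {z : ℝ × ℝ}
    (hz : z ∈ U) {x y : Fin 3 → 𝕜} (hxy : ∑ B, x B • ofRealVec 𝕜 (n B z)
      = ∑ B, y B • ofRealVec 𝕜 (n B z)) : x = y := by
  have hε0 : (ε : 𝕜) ≠ 0 := by rcases hε with rfl | rfl <;> simp
  funext A
  have h1 := h.dot_frameVec_left hz x A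
  rw [hxy, h.dot_frameVec_left hz y A] at h1
  refine (mul_right_cancel₀ ?_ h1).symm
  split_ifs
  exacts [one_ne_zero, hε0]

/-- The factor ε compensates n_μ·n_μ = ε, as ε² = 1. -/
theorem eq_sum (hε : ε = 1 ∨ ε = -1) (h : AdaptedFrame ε k U r N n P Q) {z : ℝ × ℝ} (hz : z ∈ U)
    (X : Vec 𝕜) : X = ∑ A, (dot ε X (ofRealVec 𝕜 (n A z)) * (if A = 0 then 1 else (ε : 𝕜)))
      • ofRealVec 𝕜 (n A z) := by
  have hε2 := cast_sq (𝕜 := 𝕜) hε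
  refine eq_of_dot_eq hε (h.vol_ne_zero hε hz) ?_ ?_ ?_ <;> rw [h.dot_frameVec_left hz] <;>
    simp <;> linear_combination -dot ε X _ * hε2

theorem hasGrad_frameVec (h : AdaptedFrame ε k U r N n P Q) (hU : IsOpen U) {z : ℝ × ℝ} (hz : z ∈ U)
    {x : Fin 3 → ℝ × ℝ → 𝕜} (hx : ∀ A, DifferentiableAt ℝ (x A) z) :
    HasGrad (frameVec x n)
      (∑ B, (dx (x B) z + ∑ A, x A z * (P A B z : 𝕜)) • ofRealVec 𝕜 (n B z))
      (∑ B, (dy (x B) z + ∑ A, x A z * (Q A B z : 𝕜)) • ofRealVec 𝕜 (n B z)) z := by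
  have hn := fun A => (h.contDiffOn A).hasGrad hU le_add_self hz
  refine (HasGrad.sum Finset.univ fun A _ => (hx A).hasGrad.smul ((hn A).ofRealVec (𝕜 := 𝕜))).congr
    (.of_forall fun w => rfl) ?_ ?_
  · simp only [h.dx_eq z hz, Fin.sum_univ_three, ofRealVec_add, ofRealVec_smul]
    module
  · simp only [h.dy_eq z hz, Fin.sum_univ_three, ofRealVec_add, ofRealVec_smul]
    module

/-- Differentiate the constant product n_0·n_μ. For μ = 0 this says that p_0⁰ and q_0⁰ vanish. -/
theorem coeff_symm (hε : ε = 1 ∨ ε = -1) (h : AdaptedFrame ε k U r N n P Q) (hU : IsOpen U)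
    {z : ℝ × ℝ} (hz : z ∈ U) (μ : Fin 3) :
    P 0 μ z = -(if μ = 0 then 1 else ε) * P μ 0 z ∧
    Q 0 μ z = -(if μ = 0 then 1 else ε) * Q μ 0 z := by
  have hn := fun A => (h.contDiffOn A).hasGrad hU le_add_self hz
  obtain ⟨e1, e2⟩ := ((hn 0).dot ε (hn μ)).unique (hasGrad_const (dot ε (n 0 z) (n μ z)) z)
    (by filter_upwards [hU.eventually_mem hz] with w hw; rw [h.frame w hw, h.frame z hz])
  have hε2 : ε * ε = 1 := by rcases hε with rfl | rfl <;> norm_num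
  simp only [h.dx_eq z hz, h.dy_eq z hz, Fin.sum_univ_three, dot_add_left, dot_smul_left,
    dot_add_right, dot_smul_right, h.frame z hz] at e1 e2
  fin_cases μ <;> simp at e1 e2 ⊢
  · constructor <;> linarith
  · constructor
    · linear_combination ε * e1 - P 0 1 z * hε2
    · linear_combination ε * e2 - Q 0 1 z * hε2
  · constructor
    · linear_combination ε * e1 - P 0 2 z * hε2
    · linear_combination ε * e2 - Q 0 2 z * hε2

theorem N_eq (h : AdaptedFrame ε k U r N n P Q) (hr : ∀ z ∈ U, 0 < r z) {z : ℝ × ℝ} (hz : z ∈ U) :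
    N z = √(r z) • n 0 z := by
  rw [h.n_zero z hz, smul_smul, mul_inv_cancel₀ (Real.sqrt_pos.2 (hr z hz)).ne', one_smul]

/-- The derivatives of the normal field in terms of the frame. -/
theorem hasGrad_N (hε : ε = 1 ∨ ε = -1) (h : AdaptedFrame ε k U r N n P Q) (hU : IsOpen U)
    (hr : ∀ z ∈ U, 0 < r z) {z : ℝ × ℝ} (hz : z ∈ U)
    (hs : DifferentiableAt ℝ (fun w => √(r w)) z) :
    HasGrad N (dx (fun w => √(r w)) z • n 0 z
        + √(r z) • (P 0 1 z • n 1 z + P 0 2 z • n 2 z))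
      (dy (fun w => √(r w)) z • n 0 z + √(r z) • (Q 0 1 z • n 1 z + Q 0 2 z • n 2 z)) z := by
  have hn := (h.contDiffOn 0).hasGrad hU le_add_self hz
  obtain ⟨h0, h0'⟩ := h.coeff_symm hε hU hz 0
  simp only [if_true, neg_mul, one_mul, self_eq_neg] at h0 h0'
  refine (hs.hasGrad.smul hn).congr
    (by filter_upwards [hU.eventually_mem hz] with w hw using h.N_eq hr hw) ?_ ?_
  · simp only [h.dx_eq z hz, Fin.sum_univ_three, h0, zero_smul, zero_add]
  · simp only [h.dy_eq z hz, Fin.sum_univ_three, h0', zero_smul, zero_add]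

theorem frame_eq (hε : ε = 1 ∨ ε = -1) (h : AdaptedFrame ε k U r N n P Q) {z : ℝ × ℝ} (hz : z ∈ U)
    {x y : Fin 3 → 𝕜} : ∑ B, x B • ofRealVec 𝕜 (n B z) = ∑ B, y B • ofRealVec 𝕜 (n B z) ↔
      x 0 = y 0 ∧ ∀ μ : Fin 2, x μ.succ = y μ.succ := by
  refine ⟨fun hxy => ?_, fun ⟨h0, h1⟩ => ?_⟩
  · rw [h.sum_injective hε hz hxy]
    exact ⟨rfl, fun _ => rfl⟩
  · rw [show x = y from funext fun A => Fin.cases h0 h1 A]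

end AdaptedFrame

variable {a b c f : ℝ × ℝ → ℝ} {p : ℝ × ℝ → 𝕜}

/-- The right-hand sides of the linear system for `X` in terms of the frame. -/
theorem moutard_frameVec (hε : ε = 1 ∨ ε = -1) (hN : BianchiNormal ε k U a b c f r N)
    (h : AdaptedFrame ε k U r N n P Q) {z : ℝ × ℝ} (hz : z ∈ U) (x : Fin 3 → ℝ × ℝ → 𝕜)
    (hp : p z ≠ 0) (hq : p z ^ 2 + (r z : 𝕜) ^ 2 * (disc a b c z : 𝕜) ≠ 0) :
    moutardX ε (fun z => (a z : 𝕜)) (fun z => (b z : 𝕜)) (fun z => (c z : 𝕜)) p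
      (fun z => ofRealVec 𝕜 (N z)) (frameVec x n z) z =
      ∑ B, (![p z ^ 2 / (p z ^ 2 + (r z : 𝕜) ^ 2 * (disc a b c z : 𝕜)) *
      ((∑ μ : Fin 2, (((r z : 𝕜) / p z * (c z : 𝕜) - 1) * (P μ.succ 0 z : 𝕜)
          + (r z : 𝕜) / p z * (b z : 𝕜) * (Q μ.succ 0 z : 𝕜)) * x μ.succ z)
        + (r z : 𝕜) / p z ^ 2 * (((c z : 𝕜) + (r z : 𝕜) / p z * (disc a b c z : 𝕜)) * dx p z
          + (b z : 𝕜) * dy p z) * x 0 z) + (P 1 0 z * x 1 z + P 2 0 z * x 2 z),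
        (r z : 𝕜) / p z * ((c z : 𝕜) * (P 0 1 z : 𝕜) + (b z : 𝕜) * (Q 0 1 z : 𝕜)) * x 0 z,
        (r z : 𝕜) / p z * ((c z : 𝕜) * (P 0 2 z : 𝕜) + (b z : 𝕜) * (Q 0 2 z : 𝕜)) * x 0 z] B)
        • ofRealVec 𝕜 (n B z) ∧
    moutardY ε (fun z => (a z : 𝕜)) (fun z => (b z : 𝕜)) (fun z => (c z : 𝕜)) p
      (fun z => ofRealVec 𝕜 (N z)) (frameVec x n z) z =
      ∑ B, (![-(p z ^ 2 / (p z ^ 2 + (r z : 𝕜) ^ 2 * (disc a b c z : 𝕜))) *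
      ((∑ μ : Fin 2, (((r z : 𝕜) / p z * (c z : 𝕜) + 1) * (Q μ.succ 0 z : 𝕜)
          + (r z : 𝕜) / p z * (a z : 𝕜) * (P μ.succ 0 z : 𝕜)) * x μ.succ z)
        + (r z : 𝕜) / p z ^ 2 * (((c z : 𝕜) - (r z : 𝕜) / p z * (disc a b c z : 𝕜)) * dy p z
          + (a z : 𝕜) * dx p z) * x 0 z) + (Q 1 0 z * x 1 z + Q 2 0 z * x 2 z),
        -((r z : 𝕜) / p z * ((a z : 𝕜) * (P 0 1 z : 𝕜) + (c z : 𝕜) * (Q 0 1 z : 𝕜)) * x 0 z),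
        -((r z : 𝕜) / p z * ((a z : 𝕜) * (P 0 2 z : 𝕜) + (c z : 𝕜) * (Q 0 2 z : 𝕜)) * x 0 z)] B)
        • ofRealVec 𝕜 (n B z) := by
  have hU := hN.isOpen
  have hr := hN.r_pos
  have hs : DifferentiableAt ℝ (fun w => √(r w)) z :=
    ((hN.contDiffOn_r.hasGrad hU le_add_self hz).differentiableAt).sqrt (hr z hz).ne'
  have hNz := (h.hasGrad_N hε hU hr hz hs).ofRealVec (𝕜 := 𝕜)
  obtain ⟨hP1, hQ1⟩ := h.coeff_symm hε hU hz 1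
  obtain ⟨hP2, hQ2⟩ := h.coeff_symm hε hU hz 2
  have hN0 : ofRealVec 𝕜 (N z) = ((√(r z) : ℝ) : 𝕜) • ofRealVec 𝕜 (n 0 z) := by
    rw [h.N_eq hr hz, ofRealVec_smul]
  have hrs : (r z : 𝕜) = ((√(r z) : ℝ) : 𝕜) ^ 2 := by
    rw [← RCLike.ofReal_pow, Real.sq_sqrt (hr z hz).le]
  have hd : ((disc a b c z : ℝ) : 𝕜) = (a z : 𝕜) * b z - (c z : 𝕜) ^ 2 := by
    simp [disc]
  have hNN : dot ε (ofRealVec 𝕜 (N z)) (ofRealVec 𝕜 (N z)) = ((√(r z) : ℝ) : 𝕜) ^ 2 := by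
    rw [dot_ofRealVec, ← hN.r_eq z hz, hrs]
  have hX := h.dot_frameVec_left (𝕜 := 𝕜) hz (fun A => x A z)
  have hX0 := hX 0
  have hX1 := hX 1
  have hX2 := hX 2
  have hf : ∀ A B, dot ε (ofRealVec 𝕜 (n A z)) (ofRealVec 𝕜 (n B z))
    = ((if A = B then (if A = 0 then 1 else ε) else 0 : ℝ) : 𝕜) := fun A B => by
    rw [dot_ofRealVec, h.frame z hz]
  have h10 := hf 1 0
  have h20 := hf 2 0
  have h00 := hf 0 0
  change dot ε (frameVec x n z) _ = _ at hX0 hX1 hX2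
  simp only [Fin.isValue, if_true, one_ne_zero, if_false, mul_one, RCLike.ofReal_zero,
    RCLike.ofReal_one, show (2 : Fin 3) ≠ 0 by decide] at hX0 hX1 hX2 h10 h20 h00 hP1 hP2 hQ1 hQ2
  have hε2 := cast_sq (𝕜 := 𝕜) hε
  simp only [ofRealVec_add, ofRealVec_smul] at hNz
  have hNx := hNz.dx_eq
  have hNy := hNz.dy_eq
  have hθ : thetaOf ε p (fun z => ofRealVec 𝕜 (N z)) (frameVec x n z) z
      = x 0 z * ((√(r z) : ℝ) : 𝕜) / p z := by
    rw [thetaOf, hN0, dot_smul_right, hX0, mul_comm]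
  have h1 : rhs₁ ε (fun z => (b z : 𝕜)) (fun z => (c z : 𝕜)) p (fun z => ofRealVec 𝕜 (N z))
      (frameVec x n z) z = (x 0 z * ((dx (fun w => √(r w)) z : ℝ) : 𝕜)
        - ((√(r z) : ℝ) : 𝕜) * (P 1 0 z * x 1 z + P 2 0 z * x 2 z))
        + x 0 z * ((√(r z) : ℝ) : 𝕜) / p z * (((√(r z) : ℝ) : 𝕜) *
          (c z * ((dx (fun w => √(r w)) z : ℝ) : 𝕜) + b z * ((dy (fun w => √(r w)) z : ℝ) : 𝕜))
            - dx p z) := by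
    simp only [rhs₁, hθ, hNx, hNy, hN0, dot_add_left, dot_add_right, dot_smul_left, dot_smul_right,
      hX0, hX1, hX2, h00, h10, h20, hP1, hP2]
    push_cast
    linear_combination -((√(r z) : ℝ) : 𝕜) * (P 1 0 z * x 1 z + P 2 0 z * x 2 z) * hε2
  have h2 : rhs₂ ε (fun z => (a z : 𝕜)) (fun z => (c z : 𝕜)) p (fun z => ofRealVec 𝕜 (N z))
      (frameVec x n z) z = (x 0 z * ((dy (fun w => √(r w)) z : ℝ) : 𝕜)
        - ((√(r z) : ℝ) : 𝕜) * (Q 1 0 z * x 1 z + Q 2 0 z * x 2 z))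
        - x 0 z * ((√(r z) : ℝ) : 𝕜) / p z * (((√(r z) : ℝ) : 𝕜) *
          (a z * ((dx (fun w => √(r w)) z : ℝ) : 𝕜) + c z * ((dy (fun w => √(r w)) z : ℝ) : 𝕜))
            + dy p z) := by
    simp only [rhs₂, hθ, hNx, hNy, hN0, dot_add_left, dot_add_right, dot_smul_left, dot_smul_right,
      hX0, hX1, hX2, h00, h10, h20, hQ1, hQ2]
    push_cast
    linear_combination -((√(r z) : ℝ) : 𝕜) * (Q 1 0 z * x 1 z + Q 2 0 z * x 2 z) * hε2
  rw [hd, hrs] at hq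
  rw [hd, hrs]
  have hq' : p z ^ 2 + (((√(r z) : ℝ) : 𝕜) ^ 2) ^ 2 * ((a z : 𝕜) * b z - (c z : 𝕜) ^ 2)
    = p z ^ 2 + ((√(r z) : ℝ) : 𝕜) ^ 2 * (((√(r z) : ℝ) : 𝕜) ^ 2
      * ((a z : 𝕜) * b z - (c z : 𝕜) ^ 2)) := by ring
  -- Only the n_0-components need algebra; the tangential ones come directly from the tangential
  -- part of dN.
  have k1 := frame_coeff_x hp hq hq' h1 h2
  have k2 := frame_coeff_y hp hq hq' h1 h2
  have key : ∀ {t t' : 𝕜} {u v w : Vec 𝕜}, t' = t → t' • u + v + w = t • u + v + w :=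
    fun h => by rw [h]
  simp only [Fin.sum_univ_three, Fin.sum_univ_two, Matrix.cons_val_zero, Matrix.cons_val_one,
    Matrix.cons_val_two, Matrix.tail_cons, Matrix.head_cons,
    show Fin.succ (0 : Fin 2) = 1 from rfl, show Fin.succ (1 : Fin 2) = 2 from rfl]
  constructor
  · refine Eq.trans ?_ (key (k1.symm.trans (by ring)))
    rw [moutardX, thetaX, thetaY, hθ, hNN, ← hq', hNx, hNy, hN0]
    module
  · refine Eq.trans ?_ (key (k2.symm.trans (by ring)))
    rw [moutardY, thetaX, thetaY, hθ, hNN, ← hq', hNx, hNy, hN0]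
    module

end Frame

/-! ### The linear system for the frame components. -/

section LinearSystem

variable {𝕜 : Type*} [RCLike 𝕜] {ε : ℝ} {k : ℕ∞} {U : Set (ℝ × ℝ)} {r : ℝ × ℝ → ℝ}
  {N : ℝ × ℝ → Vec ℝ} {n : Fin 3 → ℝ × ℝ → Vec ℝ} {P Q : Fin 3 → Fin 3 → ℝ × ℝ → ℝ}
  {a b c f : ℝ × ℝ → ℝ} {p : ℝ × ℝ → 𝕜} {x : Fin 3 → ℝ × ℝ → 𝕜}

/-- The linear system for the components of `X` with respect to an adapted frame. -/
theorem linearSystem_iff (hε : ε = 1 ∨ ε = -1) (hN : BianchiNormal ε k U a b c f r N)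
    (h : AdaptedFrame ε k U r N n P Q)
    (hp0 : ∀ z ∈ U, p z ≠ 0 ∧ p z ^ 2 + (r z : 𝕜) ^ 2 * (disc a b c z : 𝕜) ≠ 0)
    (hx : ∀ z ∈ U, ∀ A, DifferentiableAt ℝ (x A) z) :
    LinearSystem U a b c r P Q p x ↔
    MoutardSystem ε U (fun z => (a z : 𝕜)) (fun z => (b z : 𝕜)) (fun z => (c z : 𝕜)) p
      (fun z => ofRealVec 𝕜 (N z)) (frameVec x n) := by
  refine forall₂_congr fun z hz => ?_
  have hgrad := h.hasGrad_frameVec hN.isOpen hz (hx z hz)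
  obtain ⟨e1, e2⟩ := moutard_frameVec hε hN h hz x (hp0 z hz).1 (hp0 z hz).2
  obtain ⟨hP, hQ⟩ := h.coeff_symm hε hN.isOpen hz 0
  simp only [if_true, neg_mul, one_mul, self_eq_neg] at hP hQ
  have hiff : HasGrad (frameVec x n) (moutardX ε (fun z => (a z : 𝕜)) (fun z => (b z : 𝕜))
      (fun z => (c z : 𝕜)) p (fun z => ofRealVec 𝕜 (N z)) (frameVec x n z) z)
      (moutardY ε (fun z => (a z : 𝕜)) (fun z => (b z : 𝕜)) (fun z => (c z : 𝕜)) p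
      (fun z => ofRealVec 𝕜 (N z)) (frameVec x n z) z) z ↔ _ ∧ _ :=
    ⟨fun h' => hgrad.unique h' .rfl, fun ⟨h1, h2⟩ => hgrad.congr_grad h1 h2⟩
  rw [hiff, e1, e2, h.frame_eq hε hz, h.frame_eq hε hz]
  simp only [Fin.forall_fin_two, Fin.sum_univ_three, Fin.sum_univ_two, Matrix.cons_val_zero,
    Matrix.cons_val_one, Matrix.cons_val_two, Matrix.tail_cons, Matrix.head_cons, hP, hQ,
    show Fin.succ (0 : Fin 2) = 1 from rfl, show Fin.succ (1 : Fin 2) = 2 from rfl,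
    RCLike.ofReal_zero, mul_zero, zero_add]
  -- The derivative of the frame adds x^A p_A^B to the component derivatives. In the n_0-equation
  -- these terms stand on both sides and cancel; in the others they are moved across.
  have key : ∀ {u v w w' : 𝕜}, w = w' → (u = v ↔ u + w' = v + w) := fun h => by
    subst h; exact (add_left_inj _).symm
  have key' : ∀ {u v w : 𝕜}, (u = -w + v ↔ u + w = v) := by
    intro u v w; rw [eq_comm, neg_add_eq_iff_eq_add, eq_comm, add_comm]
  have key'' : ∀ {u v w : 𝕜}, (u = -w - v ↔ u + w = -v) := by
    intro u v w; rw [sub_eq_add_neg, key']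
  rw [key (u := dx (x 0) z) (w := (P 1 0 z : 𝕜) * x 1 z + P 2 0 z * x 2 z)
      (w' := x 1 z * P 1 0 z + x 2 z * P 2 0 z) (by ring),
    key (u := dy (x 0) z) (w := (Q 1 0 z : 𝕜) * x 1 z + Q 2 0 z * x 2 z)
      (w' := x 1 z * Q 1 0 z + x 2 z * Q 2 0 z) (by ring), key', key', key'', key'']
  simp only [and_assoc, hx z hz, implies_true, true_and]

theorem MoutardSystem.congr {a b c : ℝ × ℝ → 𝕜} {N X Y : ℝ × ℝ → Vec 𝕜} (hU : IsOpen U)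
    (hX : MoutardSystem ε U a b c p N X) (hXY : Set.EqOn Y X U) :
    MoutardSystem ε U a b c p N Y := fun z hz => by
  rw [hXY hz]
  exact (hX z hz).congr (by filter_upwards [hU.eventually_mem hz] with w hw using hXY hw) rfl rfl

theorem contDiffOn_frameVec_coeff {X : ℝ × ℝ → Vec 𝕜} (h : AdaptedFrame ε k U r N n P Q)
    (hX : ContDiffOn ℝ k X U) (A : Fin 3) :
    ContDiffOn ℝ k (fun z => dot ε (X z) (ofRealVec 𝕜 (n A z)) * (if A = 0 then 1 else (ε : 𝕜)))
      U :=
  (contDiffOn_dot ε hX (contDiffOn_ofRealVec ((h.contDiffOn A).of_le le_self_add))).mul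
    contDiffOn_const

/-- Existence and uniqueness are carried over from the system for X, to which (2) is equivalent by
the isomorphism that the frame provides. -/
theorem existsUnique_linearSystem (hε : ε = 1 ∨ ε = -1) (hN : BianchiNormal ε k U a b c f r N)
    (h : AdaptedFrame ε k U r N n P Q) (hp : PSystem U a b c r p)
    (hp0 : ∀ z ∈ U, p z ≠ 0 ∧ p z ^ 2 + (r z : 𝕜) ^ 2 * (disc a b c z : 𝕜) ≠ 0)
    (hUc : IsSimplyConnected U) {z₀ : ℝ × ℝ} (hz₀ : z₀ ∈ U) (ξ : Fin 3 → 𝕜) :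
    ∃ x : Fin 3 → ℝ × ℝ → 𝕜, (∀ A, ContDiffOn ℝ k (x A) U) ∧
      LinearSystem U a b c r P Q p x ∧ (∀ A, x A z₀ = ξ A) ∧
      ∀ x₁ : Fin 3 → ℝ × ℝ → 𝕜, LinearSystem U a b c r P Q p x₁ →
        (∀ A, x₁ A z₀ = ξ A) → ∀ A, Set.EqOn (x₁ A) (x A) U := by
  have hU := hN.isOpen
  have hM := hN.moutardData hp hp0
  obtain ⟨X, hX0, hX⟩ := hM.exists_moutardSystem hUc hz₀ (∑ B, ξ B • ofRealVec 𝕜 (n B z₀))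
  let x : Fin 3 → ℝ × ℝ → 𝕜 := fun A z =>
    dot ε (X z) (ofRealVec 𝕜 (n A z)) * (if A = 0 then 1 else (ε : 𝕜))
  have hxk : ∀ A, ContDiffOn ℝ k (x A) U := contDiffOn_frameVec_coeff h (hX.contDiffOn hM)
  have hxX : Set.EqOn (frameVec x n) X U := fun z hz => (h.eq_sum hε hz (X z)).symm
  have hxd : ∀ z ∈ U, ∀ A, DifferentiableAt ℝ (x A) z := fun z hz A =>
    ((hxk A).hasGrad hU hN.one_le hz).differentiableAt
  have hx := (linearSystem_iff hε hN h hp0 hxd).2 (hX.congr hU hxX)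
  have hx0 : ∀ A, x A z₀ = ξ A := fun A => by
    refine congrFun (h.sum_injective hε hz₀ (x := fun A => x A z₀) ?_) A
    exact (hxX hz₀).trans hX0
  refine ⟨x, hxk, hx, hx0, fun x₁ hx₁ h₁ A z hz => ?_⟩
  have hX₁ := (linearSystem_iff hε hN h hp0 fun z hz => (hx₁ z hz).1).1 hx₁
  have := hX₁.eqOn hM hUc.isPathConnected.isConnected.isPreconnected hX hz₀
    (by simp only [frameVec, h₁]; exact hX0.symm) hz
  exact congrFun (h.sum_injective hε hz (x := fun A => x₁ A z) (y := fun A => x A z)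
    (this.trans (hxX hz).symm)) A

theorem thetaOf_frameVec (hN : BianchiNormal ε k U a b c f r N)
    (h : AdaptedFrame ε k U r N n P Q) {z : ℝ × ℝ} (hz : z ∈ U) :
    thetaOf ε p (fun z => ofRealVec 𝕜 (N z)) (frameVec x n z) z = theta r p x z := by
  have hX0 := h.dot_frameVec_left (𝕜 := 𝕜) hz (fun A => x A z) 0
  change dot ε (frameVec x n z) _ = _ at hX0
  rw [thetaOf, theta, h.N_eq hN.r_pos hz, ofRealVec_smul, dot_smul_right, hX0, if_pos rfl, mul_one,
    mul_comm]

/-- With θ = x⁰√r/p the term rΔθ² of the first integral is (x⁰)²r²Δ/p². -/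
theorem constraint_eq (hN : BianchiNormal ε k U a b c f r N)
    (h : AdaptedFrame ε k U r N n P Q) {z : ℝ × ℝ} (hz : z ∈ U) :
    constraint ε a b c r p x z = firstIntegral ε (fun z => (a z : 𝕜)) (fun z => (b z : 𝕜))
      (fun z => (c z : 𝕜)) p (fun z => ofRealVec 𝕜 (N z)) (frameVec x n z) z := by
  have hX := h.dot_frameVec_left (𝕜 := 𝕜) hz (fun A => x A z)
  have hX0 := hX 0
  have hX1 := hX 1
  have hX2 := hX 2
  have hrs : ((√(r z) : ℝ) : 𝕜) ^ 2 = (r z : 𝕜) := by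
    rw [← RCLike.ofReal_pow, Real.sq_sqrt (hN.r_pos z hz).le]
  have hXX : dot ε (frameVec x n z) (frameVec x n z)
      = x 0 z ^ 2 + (ε : 𝕜) * (x 1 z ^ 2 + x 2 z ^ 2) := by
    have e : frameVec x n z = x 0 z • ofRealVec 𝕜 (n 0 z) + x 1 z • ofRealVec 𝕜 (n 1 z)
        + x 2 z • ofRealVec 𝕜 (n 2 z) := by simp only [frameVec, Fin.sum_univ_three]
    change dot ε (frameVec x n z) _ = _ at hX0 hX1 hX2
    simp only [Fin.isValue, if_true, one_ne_zero, if_false, mul_one,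
      show (2 : Fin 3) ≠ 0 by decide] at hX0 hX1 hX2
    refine (congrArg (dot ε (frameVec x n z)) e).trans ?_
    rw [dot_add_right, dot_add_right, dot_smul_right, dot_smul_right, dot_smul_right, hX0, hX1,
      hX2]
    ring
  rw [constraint, firstIntegral, hXX, thetaOf_frameVec hN h hz, dot_ofRealVec, ← hN.r_eq z hz,
    RCLike.real_smul_eq_coe_mul, theta, disc]
  push_cast
  rw [div_pow, mul_pow, hrs]
  ring

theorem constraint_const (hε : ε = 1 ∨ ε = -1) (hN : BianchiNormal ε k U a b c f r N)
    (h : AdaptedFrame ε k U r N n P Q) (hp : PSystem U a b c r p)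
    (hp0 : ∀ z ∈ U, p z ≠ 0 ∧ p z ^ 2 + (r z : 𝕜) ^ 2 * (disc a b c z : 𝕜) ≠ 0)
    (hx : LinearSystem U a b c r P Q p x) (hUc : IsPreconnected U) {z w : ℝ × ℝ} (hz : z ∈ U)
    (hw : w ∈ U) : constraint ε a b c r p x z = constraint ε a b c r p x w := by
  have hX := (linearSystem_iff hε hN h hp0 fun z hz => (hx z hz).1).1 hx
  have := eqOn_of_grad_eq hN.isOpen hUc
    (fun z hz => hX.hasGrad_firstIntegral (hN.moutardData hp hp0) hz)
    (fun z _ => hasGrad_const (0 : 𝕜) z) hz hw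
  rw [constraint_eq hN h hz, constraint_eq hN h hw]
  rw [sub_self, sub_eq_zero] at this
  exact this.symm

theorem newNormal_eq (hN : BianchiNormal ε k U a b c f r N)
    (hp0 : ∀ z ∈ U, p z ≠ 0) (hx0 : ∀ z ∈ U, x 0 z ≠ 0) {z : ℝ × ℝ} (hz : z ∈ U) :
    theta r p x z ≠ 0 ∧ newNormal r p x n z = (theta r p x z)⁻¹ • frameVec x n z := by
  have hs : ((√(r z) : ℝ) : 𝕜) ≠ 0 := by exact_mod_cast (Real.sqrt_pos.2 (hN.r_pos z hz)).ne'
  have h1 := hp0 z hz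
  have h2 := hx0 z hz
  refine ⟨by rw [theta]; positivity, ?_⟩
  rw [newNormal, frameVec, theta, Finset.smul_sum, Finset.smul_sum]
  refine Finset.sum_congr rfl fun A _ => ?_
  rw [smul_smul, smul_smul]
  congr 1
  field_simp

end LinearSystem

/-! ### From solutions with vanishing first integral to Moutard transforms. -/

section Transform

variable {𝕜 : Type*} [RCLike 𝕜]

/-- A transform `N'` of the normal field `N` of a Bianchi surface by an extended Moutard
transformation with the function `θ`, normalized by `N' · N' = -Δ r`. -/
structure BianchiTransform (ε : ℝ) (k : ℕ∞) (U : Set (ℝ × ℝ)) (a b c f r : ℝ × ℝ → ℝ)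
    (N : ℝ × ℝ → Vec ℝ) (θ : ℝ × ℝ → 𝕜) (N' : ℝ × ℝ → Vec 𝕜) : Prop where
  normal : BianchiNormal ε k U a b c f r N
  contDiffOn_theta : ContDiffOn ℝ k θ U
  contDiffOn_normal' : ContDiffOn ℝ k N' U
  moutard : Moutard U a b c θ (fun z => ofRealVec 𝕜 (N z)) N'
  dot_self : ∀ z ∈ U, dot ε (N' z) (N' z) = ((-(disc a b c z * r z) : ℝ) : 𝕜)

variable {ε : ℝ} {k : ℕ∞} {U : Set (ℝ × ℝ)} {a b c f r : ℝ × ℝ → ℝ} {N : ℝ × ℝ → Vec ℝ}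
  {p θ : ℝ × ℝ → 𝕜} {X N' : ℝ × ℝ → Vec 𝕜}

theorem BianchiNormal.selfAdjointEq_theta (h : BianchiNormal ε k U a b c f r N)
    (hM : MoutardData ε k U (fun z => (a z : 𝕜)) (fun z => (b z : 𝕜)) (fun z => (c z : 𝕜))
      (fun z => (f z : 𝕜)) p (fun z => ofRealVec 𝕜 (N z)))
    (hX : MoutardSystem ε U (fun z => (a z : 𝕜)) (fun z => (b z : 𝕜)) (fun z => (c z : 𝕜)) p
      (fun z => ofRealVec 𝕜 (N z)) X)
    (hθ : ∀ z ∈ U, θ z = thetaOf ε p (fun z => ofRealVec 𝕜 (N z)) (X z) z) :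
    ContDiffOn ℝ k θ U ∧ SelfAdjointEq U a b c (fun z => (f z : 𝕜)) θ := by
  have hU := h.isOpen
  refine ⟨(hM.contDiffOn_thetaOf le_rfl (hX.contDiffOn hM)).congr hθ, fun z hz => ?_⟩
  have hmem := hU.eventually_mem hz
  have hgrad : ∀ w ∈ U, HasGrad θ (thetaX ε (fun z => (a z : 𝕜)) (fun z => (b z : 𝕜))
      (fun z => (c z : 𝕜)) p (fun z => ofRealVec 𝕜 (N z)) (X w) w)
      (thetaY ε (fun z => (a z : 𝕜)) (fun z => (b z : 𝕜)) (fun z => (c z : 𝕜)) p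
      (fun z => ofRealVec 𝕜 (N z)) (X w) w) w := fun w hw =>
    (hM.hasGrad_theta hw (hX w hw)).congr
      (by filter_upwards [hU.eventually_mem hw] with v hv using hθ v hv) rfl rfl
  obtain ⟨hα, hβ⟩ := hM.differentiableAt_theta hz (hX z hz).differentiableAt
  have hα := hα.hasGrad
  have hβ := hβ.hasGrad
  have ha := hM.contDiffOn_a.hasGrad hU hM.one_le hz
  have hb := hM.contDiffOn_b.hasGrad hU hM.one_le hz
  have hc := hM.contDiffOn_c.hasGrad hU hM.one_le hz
  have e1 := ((ha.mul hα).add (hc.mul hβ)).differentiableAt.hasGrad.congr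
    (g := fun w => a w • dx θ w + c w • dy θ w) (by
    filter_upwards [hmem] with w hw
    rw [(hgrad w hw).dx_eq, (hgrad w hw).dy_eq, RCLike.real_smul_eq_coe_mul,
      RCLike.real_smul_eq_coe_mul]) rfl rfl
  have e2 := ((hc.mul hα).add (hb.mul hβ)).differentiableAt.hasGrad.congr
    (g := fun w => b w • dy θ w + c w • dx θ w) (by
    filter_upwards [hmem] with w hw
    rw [(hgrad w hw).dx_eq, (hgrad w hw).dy_eq, RCLike.real_smul_eq_coe_mul,
      RCLike.real_smul_eq_coe_mul, add_comm]) rfl rfl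
  refine ⟨(hgrad z hz).differentiableAt, e1.differentiableAt, e2.differentiableAt, ?_⟩
  rw [e1.dx_eq, e2.dy_eq, hM.theta_selfAdjoint hz (hX z hz), hθ z hz, smul_eq_mul]

/-- A solution of the linear system with vanishing first integral provides a transform. -/
theorem BianchiNormal.bianchiTransform (h : BianchiNormal ε k U a b c f r N)
    (hM : MoutardData ε k U (fun z => (a z : 𝕜)) (fun z => (b z : 𝕜)) (fun z => (c z : 𝕜))
      (fun z => (f z : 𝕜)) p (fun z => ofRealVec 𝕜 (N z)))
    (hX : MoutardSystem ε U (fun z => (a z : 𝕜)) (fun z => (b z : 𝕜)) (fun z => (c z : 𝕜)) p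
      (fun z => ofRealVec 𝕜 (N z)) X)
    (hθ : ∀ z ∈ U, θ z = thetaOf ε p (fun z => ofRealVec 𝕜 (N z)) (X z) z)
    (hθ0 : ∀ z ∈ U, θ z ≠ 0) (hN' : ∀ z ∈ U, N' z = (θ z)⁻¹ • X z)
    (h0 : ∀ z ∈ U, firstIntegral ε (fun z => (a z : 𝕜)) (fun z => (b z : 𝕜))
      (fun z => (c z : 𝕜)) p (fun z => ofRealVec 𝕜 (N z)) (X z) z = 0) :
    BianchiTransform ε k U a b c f r N θ N' ∧
      ∀ z ∈ U, dot ε (ofRealVec 𝕜 (N z)) (N' z) = p z := by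
  have hU := h.isOpen
  have hθk := (h.selfAdjointEq_theta hM hX hθ).1
  have hXk := hX.contDiffOn hM
  have hNk' : ContDiffOn ℝ k N' U := ((hθk.inv hθ0).smul hXk).congr hN'
  have hXN : ∀ z ∈ U, θ z • N' z = X z := fun z hz => by
    rw [hN' z hz, smul_smul, mul_inv_cancel₀ (hθ0 z hz), one_smul]
  refine ⟨⟨h, hθk, hNk', fun z hz => ?_, fun z hz => ?_⟩, fun z hz => ?_⟩
  · have hN := hM.contDiffOn_N.hasGrad hU le_add_self hz
    have hgrad := (hM.hasGrad_theta hz (hX z hz)).congr (g := θ)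
      (by filter_upwards [hU.eventually_mem hz] with v hv using hθ v hv) rfl rfl
    have e1 := (hX z hz).congr (g := fun w => θ w • N' w)
      (by filter_upwards [hU.eventually_mem hz] with v hv using hXN v hv) rfl rfl
    have e2 := (hgrad.inv (hθ0 z hz)).smul hN
    have h0 := hθ0 z hz
    refine ⟨hθ0 z hz, hgrad.differentiableAt, hN.differentiableAt,
      (hNk'.hasGrad hU h.one_le hz).differentiableAt, ?_, ?_⟩
    · rw [e1.dx_eq, e2.dx_eq, e2.dy_eq, moutardX, ← hθ z hz]
      simp only [real_smul_vec]
      ext i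
      simp only [Pi.add_apply, Pi.sub_apply, Pi.smul_apply, smul_eq_mul]
      field_simp
      ring
    · rw [e1.dy_eq, e2.dx_eq, e2.dy_eq, moutardY, ← hθ z hz]
      simp only [real_smul_vec]
      ext i
      simp only [Pi.add_apply, Pi.neg_apply, Pi.smul_apply, smul_eq_mul]
      field_simp
      ring
  -- Divided by θ², the vanishing of X·X + rΔθ² is N'·N' = −Δr.
  · have e := h0 z hz
    have h0 := hθ0 z hz
    rw [firstIntegral, ← hθ z hz, dot_ofRealVec, ← h.r_eq z hz] at e
    rw [hN' z hz, dot_smul_left, dot_smul_right, disc]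
    push_cast
    field_simp
    linear_combination e
  · have e := hθ z hz
    have h0 := hθ0 z hz
    rw [thetaOf, eq_div_iff (hM.p_ne z hz), dot_comm] at e
    rw [hN' z hz, dot_smul_right, ← e, inv_mul_cancel_left₀ h0]

end Transform

/-! ### The inverse Moutard relations and the equations for the transformed normal field. -/

section InverseTransform

variable {𝕜 : Type*} [RCLike 𝕜]

/-- Inverting the Moutard relations: a(θN')_x + c(θN')_y = θ²Δ(N/θ)_y and c(θN')_x + b(θN')_y =
−θ²Δ(N/θ)_x. Dividing by −Δθ and separating the derivatives of θ gives the fluxes of N' with primed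
coefficients. -/
theorem inverse_flux {θ Δ a b c α β : 𝕜} {v v₁ v₂ w₁ w₂ : Vec 𝕜} (hθ : θ ≠ 0) (hΔ : Δ ≠ 0)
    (hd : Δ = a * b - c ^ 2) (h1 : α • v + θ • v₁ = θ ^ 2 • (c • w₁ + b • w₂))
    (h2 : β • v + θ • v₂ = -(θ ^ 2 • (a • w₁ + c • w₂))) :
    (-a / Δ) • v₁ + (-c / Δ) • v₂
      = -(θ • w₂) + (((-a / Δ) * (-α / θ ^ 2) + (-c / Δ) * (-β / θ ^ 2)) * θ) • v ∧
    (-b / Δ) • v₂ + (-c / Δ) • v₁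
      = θ • w₁ + (((-b / Δ) * (-β / θ ^ 2) + (-c / Δ) * (-α / θ ^ 2)) * θ) • v := by
  constructor <;> ext i <;> have h1 := congrFun h1 i <;> have h2 := congrFun h2 i <;>
    simp only [Pi.add_apply, Pi.neg_apply, Pi.smul_apply, smul_eq_mul] at h1 h2 ⊢ <;> field_simp
  · rw [hd]
    linear_combination -a * h1 - c * h2
  · rw [hd]
    linear_combination -c * h1 - b * h2

/-- Taking the product of N with the Moutard relation removes the multiples of N, and the resulting
value of N × N'_x cancels R_x up to the stated terms. The coefficient g is arbitrary because N' × N'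
= 0. -/
theorem cross_flux_x (ε : ℝ) {θ b c α β : 𝕜} {u u₁ u₂ v v₁ : Vec 𝕜} (hθ : θ ≠ 0)
    (h1 : α • v + θ • v₁ = θ ^ 2 • (c • ((-α / θ ^ 2) • u + θ⁻¹ • u₁)
      + b • ((-β / θ ^ 2) • u + θ⁻¹ • u₂))) (g : 𝕜) :
    cross ε (b • u₂ + c • u₁) u + (cross ε u₁ v + cross ε u v₁)
      = cross ε (θ • ((-α / θ ^ 2) • u + θ⁻¹ • u₁) + g • v) v := by
  have h2 := congrArg (cross ε u) h1
  refine smul_right_injective _ hθ ?_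
  simp only [cross_add_left, cross_add_right, cross_smul_left, cross_smul_right, cross_self,
    cross_anticomm _ u, smul_add, smul_zero, zero_add, add_zero] at h2 ⊢
  ext i
  have h3 := congrFun h2 i
  simp only [Pi.add_apply, Pi.neg_apply, Pi.smul_apply, smul_eq_mul] at h3 ⊢
  field_simp at h3 ⊢
  linear_combination h3

theorem cross_flux_y (ε : ℝ) {θ a c α β : 𝕜} {u u₁ u₂ v v₂ : Vec 𝕜} (hθ : θ ≠ 0)
    (h1 : β • v + θ • v₂ = -(θ ^ 2 • (a • ((-α / θ ^ 2) • u + θ⁻¹ • u₁)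
      + c • ((-β / θ ^ 2) • u + θ⁻¹ • u₂)))) (g : 𝕜) :
    cross ε u (a • u₁ + c • u₂) + (cross ε u₂ v + cross ε u v₂)
      = cross ε v (-(θ • ((-β / θ ^ 2) • u + θ⁻¹ • u₂)) + g • v) := by
  rw [cross_anticomm v]
  have h2 := congrArg (cross ε u) h1
  rw [← neg_smul] at h2 ⊢
  refine smul_right_injective _ hθ ?_
  simp only [cross_add_left, cross_add_right, cross_smul_left, cross_smul_right, cross_self,
    smul_add, smul_zero, zero_add, add_zero] at h2 ⊢
  ext i
  have h3 := congrFun h2 i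
  simp only [Pi.add_apply, Pi.neg_apply, Pi.smul_apply, smul_eq_mul] at h3 ⊢
  field_simp at h3 ⊢
  linear_combination h3

theorem primed_eq (a b c u : ℝ × ℝ → ℝ) (z : ℝ × ℝ) :
    ((primed a b c u z : ℝ) : 𝕜) = -(u z : 𝕜) / (disc a b c z : 𝕜) := by
  rw [primed]; push_cast; rfl

theorem disc_primed {a b c : ℝ × ℝ → ℝ} {z : ℝ × ℝ} (h : disc a b c z ≠ 0) :
    disc (primed a b c a) (primed a b c b) (primed a b c c) z = (disc a b c z)⁻¹ := by
  have e : a z * b z - c z ^ 2 = disc a b c z := rfl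
  rw [disc, primed, primed, primed]
  refine eq_inv_of_mul_eq_one_left ?_
  field_simp
  linear_combination e

theorem conformal_primed {a b c : ℝ × ℝ → ℝ} (u : ℝ × ℝ → ℝ) {z : ℝ × ℝ} (h : disc a b c z ≠ 0) :
    conformal (primed a b c a) (primed a b c b) (primed a b c c) (primed a b c u) z
      = -Real.sign (disc a b c z) * conformal a b c u z := by
  have h1 := (sqrt_abs_pos h).ne'
  have h2 : √|disc a b c z| ^ 2 = Real.sign (disc a b c z) * disc a b c z := by
    rw [Real.sq_sqrt (abs_nonneg _), sign_mul_self_eq_abs]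
  rw [conformal, disc_primed h, abs_inv, Real.sqrt_inv, conformal, primed]
  field_simp
  rw [h2]
  ring

theorem eventually_sign_eq {g : ℝ × ℝ → ℝ} {z : ℝ × ℝ} (hg : ContinuousAt g z) (h0 : g z ≠ 0) :
    ∀ᶠ w in nhds z, Real.sign (g w) = Real.sign (g z) := by
  rcases lt_or_gt_of_ne h0 with h | h
  · filter_upwards [hg.eventually_lt continuousAt_const h] with w hw
    rw [Real.sign_of_neg hw, Real.sign_of_neg h]
  · filter_upwards [continuousAt_const.eventually_lt hg h] with w hw
    rw [Real.sign_of_pos hw, Real.sign_of_pos h]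

variable {ε : ℝ} {k : ℕ∞} {U : Set (ℝ × ℝ)} {a b c f r : ℝ × ℝ → ℝ} {N : ℝ × ℝ → Vec ℝ}
  {θ : ℝ × ℝ → 𝕜} {N' : ℝ × ℝ → Vec 𝕜}

theorem BianchiNormal.contDiffOn_disc (h : BianchiNormal ε k U a b c f r N) :
    ContDiffOn ℝ k (disc a b c) U :=
  Bianchi.contDiffOn_disc h.contDiffOn_a h.contDiffOn_b h.contDiffOn_c

theorem BianchiNormal.contDiffOn_primed (h : BianchiNormal ε k U a b c f r N) :
    ContDiffOn ℝ k (primed a b c a) U ∧ ContDiffOn ℝ k (primed a b c b) U ∧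
      ContDiffOn ℝ k (primed a b c c) U :=
  ⟨h.contDiffOn_a.neg.div h.contDiffOn_disc h.disc_ne,
    h.contDiffOn_b.neg.div h.contDiffOn_disc h.disc_ne,
    h.contDiffOn_c.neg.div h.contDiffOn_disc h.disc_ne⟩

namespace BianchiTransform

theorem flux_eq (h : BianchiTransform ε k U a b c f r N θ N') {z : ℝ × ℝ} (hz : z ∈ U) :
    primed a b c a z • dx N' z + primed a b c c z • dy N' z
      = -(θ z • dy (fun w => (θ w)⁻¹ • ofRealVec 𝕜 (N w)) z)
        + (primed a b c a z • dx (fun v => (θ v)⁻¹) z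
          + primed a b c c z • dy (fun v => (θ v)⁻¹) z) • θ z • N' z ∧
    primed a b c b z • dy N' z + primed a b c c z • dx N' z
      = θ z • dx (fun w => (θ w)⁻¹ • ofRealVec 𝕜 (N w)) z
        + (primed a b c b z • dy (fun v => (θ v)⁻¹) z
          + primed a b c c z • dx (fun v => (θ v)⁻¹) z) • θ z • N' z := by
  have hU := h.normal.isOpen
  have h1 := h.normal.one_le
  obtain ⟨hθ0, hθ, -, hN', e1, e2⟩ := h.moutard z hz
  have hX := hθ.hasGrad.smul hN'.hasGrad
  have hi := hθ.hasGrad.inv hθ0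
  rw [hX.dx_eq] at e1
  rw [hX.dy_eq] at e2
  have hd : ((disc a b c z : ℝ) : 𝕜) ≠ 0 := by exact_mod_cast h.normal.disc_ne z hz
  simp only [real_smul_vec, RCLike.real_smul_eq_coe_mul, primed_eq, hi.dx_eq, hi.dy_eq,
    smul_smul] at e1 e2 ⊢
  exact inverse_flux hθ0 hd (by simp [disc]) e1 e2

theorem contDiffOn_inv (h : BianchiTransform ε k U a b c f r N θ N') :
    ContDiffOn ℝ k (fun z => (θ z)⁻¹) U := h.contDiffOn_theta.inv fun z hz => (h.moutard z hz).1

/-- The transformed normal field solves the self-adjoint equation with primed coefficients. -/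
theorem selfAdjointEq (h : BianchiTransform ε k U a b c f r N θ N') :
    SelfAdjointEq U (primed a b c a) (primed a b c b) (primed a b c c) (primedPotential a b c θ)
      N' := fun z hz => by
  have hU := h.normal.isOpen
  have h1 := h.normal.one_le
  have h11 := h.normal.one_add_one_le
  have hmem := hU.eventually_mem hz
  obtain ⟨ha, hb, hc⟩ := h.normal.contDiffOn_primed
  have ha := ha.hasGrad hU h1 hz
  have hb := hb.hasGrad hU h1 hz
  have hc := hc.hasGrad hU h1 hz
  have hν : ContDiffOn ℝ k (fun w => (θ w)⁻¹ • ofRealVec 𝕜 (N w)) U :=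
    h.contDiffOn_inv.smul (contDiffOn_ofRealVec (h.normal.contDiffOn_N.of_le le_self_add))
  have hνx := (contDiffOn_dx hU hν h11).hasGrad hU le_rfl hz
  have hνy := (contDiffOn_dy hU hν h11).hasGrad hU le_rfl hz
  have hix := (contDiffOn_dx hU h.contDiffOn_inv h11).hasGrad hU le_rfl hz
  have hiy := (contDiffOn_dy hU h.contDiffOn_inv h11).hasGrad hU le_rfl hz
  have hG1 := ((ha.smul hix).add (hc.smul hiy)).differentiableAt.hasGrad
  have hG2 := ((hb.smul hiy).add (hc.smul hix)).differentiableAt.hasGrad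
  obtain ⟨hθ0, hθ, -, hN', m1, m2⟩ := h.moutard z hz
  have hi := hθ.hasGrad.inv hθ0
  have hX := hθ.hasGrad.smul hN'.hasGrad
  have e1 := ((hθ.hasGrad.smul hνy).neg.add (hG1.smul hX)).congr
    (g := fun w => primed a b c a w • dx N' w + primed a b c c w • dy N' w)
    (by filter_upwards [hmem] with w hw using (h.flux_eq hw).1) rfl rfl
  have e2 := ((hθ.hasGrad.smul hνx).add (hG2.smul hX)).congr
    (g := fun w => primed a b c b w • dy N' w + primed a b c c w • dx N' w)
    (by filter_upwards [hmem] with w hw using (h.flux_eq hw).2) rfl rfl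
  refine ⟨hN', e1.differentiableAt, e2.differentiableAt, ?_⟩
  -- The divergence of the fluxes contains −θ(N/θ)_yx + θ(N/θ)_xy, which cancels. The products of
  -- first derivatives cancel by the Moutard relations, leaving the potential term.
  have symν := dx_dy_comm hU hν (by rwa [one_add_one_eq_two] at h11) hz
  have hd : ((disc a b c z : ℝ) : 𝕜) ≠ 0 := by exact_mod_cast h.normal.disc_ne z hz
  have hdd : ((disc a b c z : ℝ) : 𝕜) = (a z : 𝕜) * b z - (c z : 𝕜) ^ 2 := by simp [disc]
  rw [hX.dx_eq] at m1
  rw [hX.dy_eq] at m2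
  rw [e1.dx_eq, e2.dy_eq, symν, m1, m2, primedPotential]
  simp only [real_smul_vec, RCLike.real_smul_eq_coe_mul, primed_eq, hi.dx_eq, hi.dy_eq]
  ext i
  simp only [Pi.add_apply, Pi.neg_apply, Pi.smul_apply, smul_eq_mul]
  field_simp
  rw [hdd]
  ring

/-- The function `(N' · N') √|Δ'|`, up to a locally constant sign. -/
theorem dot_self_mul_sqrt (h : BianchiTransform ε k U a b c f r N θ N') {z : ℝ × ℝ} (hz : z ∈ U) :
    dot ε (N' z) (N' z)
      * ((√|disc (primed a b c a) (primed a b c b) (primed a b c c) z| : ℝ) : 𝕜)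
      = ((-Real.sign (disc a b c z) * (r z * √|disc a b c z|) : ℝ) : 𝕜) := by
  have hd := h.normal.disc_ne z hz
  have h1 := (sqrt_abs_pos hd).ne'
  have h2 : √|disc a b c z| ^ 2 = Real.sign (disc a b c z) * disc a b c z := by
    rw [Real.sq_sqrt (abs_nonneg _), sign_mul_self_eq_abs]
  have h3 := sign_mul_sign hd
  rw [h.dot_self z hz, ← RCLike.ofReal_mul, disc_primed hd, abs_inv, Real.sqrt_inv]
  congr 1
  field_simp
  linear_combination disc a b c z * r z * h3 + Real.sign (disc a b c z) * r z * h2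

/-- The transformed normal field solves the second normal field equation of Bianchi surfaces. -/
theorem selfAdjointEq_dot_self (h : BianchiTransform ε k U a b c f r N θ N') :
    SelfAdjointEq U
      (conformal (primed a b c a) (primed a b c b) (primed a b c c) (primed a b c a))
      (conformal (primed a b c a) (primed a b c b) (primed a b c c) (primed a b c b))
      (conformal (primed a b c a) (primed a b c b) (primed a b c c) (primed a b c c))
      (fun _ => (0 : 𝕜))
      (fun z => dot ε (N' z) (N' z) *
        ((√|disc (primed a b c a) (primed a b c b) (primed a b c c) z| : ℝ) : 𝕜)) := fun z hz => by
  have hU := h.normal.isOpen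
  have h11 := h.normal.one_add_one_le
  have hd := h.normal.disc_ne
  -- The sign of Δ is locally constant and passes through derivatives.
  have hsign : ∀ w ∈ U, ∀ᶠ v in nhds w, Real.sign (disc a b c v) = Real.sign (disc a b c w) :=
    fun w hw => eventually_sign_eq
      (h.normal.contDiffOn_disc.hasGrad hU h.normal.one_le hw).differentiableAt.continuousAt (hd w hw)
  have hρ := (h.normal.contDiffOn_r.of_le le_self_add).mul
    (contDiffOn_sqrt_abs h.normal.contDiffOn_disc hd)
  have hgrad : ∀ w ∈ U, HasGrad (fun z => dot ε (N' z) (N' z) *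
        ((√|disc (primed a b c a) (primed a b c b) (primed a b c c) z| : ℝ) : 𝕜))
      ((-Real.sign (disc a b c w) * dx (fun w => r w * √|disc a b c w|) w : ℝ) : 𝕜)
      ((-Real.sign (disc a b c w) * dy (fun w => r w * √|disc a b c w|) w : ℝ) : 𝕜) w :=
    fun w hw => (((hasGrad_const (-Real.sign (disc a b c w)) w).mul
      (hρ.hasGrad hU h.normal.one_le hw)).ofReal (𝕜 := 𝕜)).congr (by
        filter_upwards [hsign w hw, hU.eventually_mem hw] with v hv hvU
        rw [h.dot_self_mul_sqrt hvU, hv]) (by simp) (by simp)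
  obtain ⟨hX, hY⟩ := h.normal.contDiffOn_flux h11
  have hX := (hX.hasGrad hU le_rfl hz).ofReal (𝕜 := 𝕜)
  have hY := (hY.hasGrad hU le_rfl hz).ofReal (𝕜 := 𝕜)
  -- The factor −sgn Δ occurs once in the normalized coefficients and once in the function, so the
  -- fluxes are exactly those of r√|Δ|.
  have e1 := hX.congr (g := fun w =>
    conformal (primed a b c a) (primed a b c b) (primed a b c c) (primed a b c a) w
      • dx (fun z => dot ε (N' z) (N' z) *
        ((√|disc (primed a b c a) (primed a b c b) (primed a b c c) z| : ℝ) : 𝕜)) w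
    + conformal (primed a b c a) (primed a b c b) (primed a b c c) (primed a b c c) w
      • dy (fun z => dot ε (N' z) (N' z) *
        ((√|disc (primed a b c a) (primed a b c b) (primed a b c c) z| : ℝ) : 𝕜)) w) (by
    filter_upwards [hU.eventually_mem hz] with w hw
    rw [(hgrad w hw).dx_eq, (hgrad w hw).dy_eq, conformal_primed _ (hd w hw),
      conformal_primed _ (hd w hw), RCLike.real_smul_eq_coe_mul, RCLike.real_smul_eq_coe_mul,
      ← RCLike.ofReal_mul, ← RCLike.ofReal_mul, ← RCLike.ofReal_add]
    congr 1
    simp only [fluxX, smul_eq_mul]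
    linear_combination (conformal a b c a w * dx (fun w => r w * √|disc a b c w|) w
      + conformal a b c c w * dy (fun w => r w * √|disc a b c w|) w) * sign_mul_sign (hd w hw))
    rfl rfl
  have e2 := hY.congr (g := fun w =>
    conformal (primed a b c a) (primed a b c b) (primed a b c c) (primed a b c b) w
      • dy (fun z => dot ε (N' z) (N' z) *
        ((√|disc (primed a b c a) (primed a b c b) (primed a b c c) z| : ℝ) : 𝕜)) w
    + conformal (primed a b c a) (primed a b c b) (primed a b c c) (primed a b c c) w
      • dx (fun z => dot ε (N' z) (N' z) *
        ((√|disc (primed a b c a) (primed a b c b) (primed a b c c) z| : ℝ) : 𝕜)) w) (by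
    filter_upwards [hU.eventually_mem hz] with w hw
    rw [(hgrad w hw).dx_eq, (hgrad w hw).dy_eq, conformal_primed _ (hd w hw),
      conformal_primed _ (hd w hw), RCLike.real_smul_eq_coe_mul, RCLike.real_smul_eq_coe_mul,
      ← RCLike.ofReal_mul, ← RCLike.ofReal_mul, ← RCLike.ofReal_add]
    congr 1
    simp only [fluxY, smul_eq_mul]
    linear_combination (conformal a b c b w * dy (fun w => r w * √|disc a b c w|) w
      + conformal a b c c w * dx (fun w => r w * √|disc a b c w|) w) * sign_mul_sign (hd w hw))
    rfl rfl
  refine ⟨(hgrad z hz).differentiableAt, e1.differentiableAt, e2.differentiableAt, ?_⟩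
  rw [e1.dx_eq, e2.dy_eq, ← RCLike.ofReal_add, h.normal.div_flux z hz, RCLike.ofReal_zero, zero_smul]

/-- The surfaces with normal field `N'`. -/
theorem lelieuvre (h : BianchiTransform ε k U a b c f r N θ N') {R : ℝ × ℝ → Vec ℝ}
    (hL : Lelieuvre ε U a b c N R) (C : Vec 𝕜) :
    Lelieuvre ε U (primed a b c a) (primed a b c b) (primed a b c c) N'
      (newPosition ε R N N' C) := fun z hz => by
  obtain ⟨hR, hN, l1, l2⟩ := hL z hz
  obtain ⟨hθ0, hθ, -, hN', m1, m2⟩ := h.moutard z hz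
  obtain ⟨f1, f2⟩ := h.flux_eq hz
  have hNc := hN.hasGrad.ofRealVec (𝕜 := 𝕜)
  have hi := (hθ.hasGrad.inv hθ0).smul hNc
  have hX := hθ.hasGrad.smul hN'.hasGrad
  have hR' := ((hR.hasGrad.ofRealVec (𝕜 := 𝕜)).add (hNc.cross ε hN'.hasGrad)).add
    (hasGrad_const C z)
  have e := hR'.congr (g := newPosition ε R N N' C) (.of_forall fun w => rfl) rfl rfl
  rw [hX.dx_eq] at m1
  rw [hX.dy_eq] at m2
  rw [hi.dx_eq, hi.dy_eq] at m1 m2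
  refine ⟨e.differentiableAt, hN', ?_, ?_⟩
  · rw [f2, e.dx_eq, l1, hi.dx_eq, ofRealVec_cross, ofRealVec_add, ofRealVec_smul, ofRealVec_smul,
      add_zero, smul_smul]
    simp only [real_smul_vec (𝕜 := 𝕜)] at m1
    exact cross_flux_x ε hθ0 m1 _
  · rw [f1, e.dy_eq, l2, hi.dy_eq, ofRealVec_cross, ofRealVec_add, ofRealVec_smul, ofRealVec_smul,
      add_zero, smul_smul]
    simp only [real_smul_vec (𝕜 := 𝕜)] at m2
    exact cross_flux_y ε hθ0 m2 _

/-- The position vector is determined by the Lelieuvre formulae up to a translation. -/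
theorem _root_.Bianchi.Lelieuvre.exists_eqOn_add {a b c : ℝ × ℝ → ℝ} {N R R' : ℝ × ℝ → Vec 𝕜}
    (hU : IsOpen U) (hUc : IsPreconnected U) (h : Lelieuvre ε U a b c N R)
    (h' : Lelieuvre ε U a b c N R') : ∃ C : Vec 𝕜, Set.EqOn R' (fun z => R z + C) U := by
  rcases U.eq_empty_or_nonempty with rfl | ⟨z₀, hz₀⟩
  · exact ⟨0, Set.eqOn_empty _ _⟩
  refine ⟨R' z₀ - R z₀, fun z hz => ?_⟩
  have := eqOn_of_grad_eq hU hUc (fun z hz => (h' z hz).1.hasGrad.congr_grad (h' z hz).2.2.1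
      (h' z hz).2.2.2) (fun z hz => (h z hz).1.hasGrad.congr_grad (h z hz).2.2.1
      (h z hz).2.2.2) hz₀ hz
  rw [sub_eq_iff_eq_add] at this
  rw [this]
  change R z - R z₀ + R' z₀ = R z + (R' z₀ - R z₀)
  abel

end BianchiTransform

end InverseTransform

/-! ### Curvature and distinguished normal of the transformed surface. -/

section TransformedSurface

variable {𝕜 : Type*} [RCLike 𝕜] {ε : ℝ} {k : ℕ∞} {U : Set (ℝ × ℝ)} {a b c f r : ℝ × ℝ → ℝ}
  {N : ℝ × ℝ → Vec ℝ} {θ : ℝ × ℝ → 𝕜} {N' : ℝ × ℝ → Vec 𝕜}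

theorem BianchiTransform.mono (h : BianchiTransform ε k U a b c f r N θ N') {V : Set (ℝ × ℝ)}
    (hV : IsOpen V) (hVU : V ⊆ U) : BianchiTransform ε k V a b c f r N θ N' where
  normal := h.normal.mono hV hVU
  contDiffOn_theta := h.contDiffOn_theta.mono hVU
  contDiffOn_normal' := h.contDiffOn_normal'.mono hVU
  moutard z hz := h.moutard z (hVU hz)
  dot_self z hz := h.dot_self z (hVU hz)

/-- The product of a solution of the self-adjoint equation with `1 / μ` solves the self-adjoint
equation with coefficients multiplied by `μ²`. -/
theorem div_flux_inv_smul {A B C a b c μ : ℝ × ℝ → ℝ} {g : ℝ × ℝ → 𝕜} {ψ : ℝ × ℝ → Vec 𝕜}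
    (hU : IsOpen U) (ha : ContDiffOn ℝ 1 a U) (hb : ContDiffOn ℝ 1 b U) (hc : ContDiffOn ℝ 1 c U)
    (hμ : ContDiffOn ℝ 2 μ U) (hμ0 : ∀ z ∈ U, μ z ≠ 0) (hA : ∀ z ∈ U, A z = a z * μ z ^ 2)
    (hB : ∀ z ∈ U, B z = b z * μ z ^ 2) (hC : ∀ z ∈ U, C z = c z * μ z ^ 2)
    (hψ : SelfAdjointEq U a b c g ψ) {z : ℝ × ℝ} (hz : z ∈ U) :
    DifferentiableAt ℝ (fluxX A C fun w => (μ w)⁻¹ • ψ w) z ∧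
    DifferentiableAt ℝ (fluxY B C fun w => (μ w)⁻¹ • ψ w) z ∧
    dx (fluxX A C fun w => (μ w)⁻¹ • ψ w) z + dy (fluxY B C fun w => (μ w)⁻¹ • ψ w) z
      = ((μ z : 𝕜) * g z - ((dx (fluxX a c μ) z + dy (fluxY b c μ) z : ℝ) : 𝕜)) • ψ z := by
  have h11 : (1 : WithTop ℕ∞) + 1 ≤ 2 := by norm_num [one_add_one_eq_two]
  have hμx := contDiffOn_dx hU hμ h11
  have hμy := contDiffOn_dy hU hμ h11
  have hG1 := ((ha.mul hμx).add (hc.mul hμy)).hasGrad hU le_rfl hz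
  have hG2 := ((hb.mul hμy).add (hc.mul hμx)).hasGrad hU le_rfl hz
  obtain ⟨hψz, hX, hY, e⟩ := hψ z hz
  have hμz := hμ.hasGrad hU (by norm_num) hz
  have hgrad : ∀ w ∈ U, HasGrad (fun w => (μ w)⁻¹ • ψ w) _ _ w := fun w hw =>
    ((hμ.hasGrad hU (by norm_num) hw).inv (hμ0 w hw)).smul (hψ w hw).1.hasGrad
  -- The flux of ψ/μ with coefficients multiplied by μ² is μ·flux(ψ) − flux(μ)ψ; in the divergence
  -- the mixed first-order terms cancel by symmetry of the coefficients.
  have e1 := ((hμz.smul hX.hasGrad).sub (hG1.smul hψz.hasGrad)).congr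
    (g := fluxX A C fun w => (μ w)⁻¹ • ψ w) (by
    filter_upwards [hU.eventually_mem hz] with w hw
    have h0 := hμ0 w hw
    rw [fluxX, (hgrad w hw).dx_eq, (hgrad w hw).dy_eq, hA w hw, hC w hw]
    ext i
    simp only [Pi.add_apply, Pi.sub_apply, Pi.smul_apply, RCLike.real_smul_eq_coe_mul]
    push_cast
    have h0' : (μ w : 𝕜) ≠ 0 := by exact_mod_cast h0
    field_simp
    ring) rfl rfl
  have e2 := ((hμz.smul hY.hasGrad).sub (hG2.smul hψz.hasGrad)).congr
    (g := fluxY B C fun w => (μ w)⁻¹ • ψ w) (by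
    filter_upwards [hU.eventually_mem hz] with w hw
    have h0 := hμ0 w hw
    rw [fluxY, (hgrad w hw).dx_eq, (hgrad w hw).dy_eq, hB w hw, hC w hw]
    ext i
    simp only [Pi.add_apply, Pi.sub_apply, Pi.smul_apply, RCLike.real_smul_eq_coe_mul]
    push_cast
    have h0' : (μ w : 𝕜) ≠ 0 := by exact_mod_cast h0
    field_simp
    ring) rfl rfl
  refine ⟨e1.differentiableAt, e2.differentiableAt, ?_⟩
  rw [e1.dx_eq, e2.dy_eq]
  have d1 : dx (fluxX a c μ) z = dx (fun w => a w * dx μ w + c w * dy μ w) z := rfl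
  have d2 : dy (fluxY b c μ) z = dy (fun w => b w * dy μ w + c w * dx μ w) z := rfl
  rw [d1, d2]
  ext i
  have e := congrFun e i
  simp only [Pi.add_apply, Pi.sub_apply, Pi.smul_apply, RCLike.real_smul_eq_coe_mul,
    smul_eq_mul] at e ⊢
  push_cast
  linear_combination (μ z : 𝕜) * e

/-- For d = |Δ| and t = r this is |K'|^(−1/4) divided by √|N'·N'|. -/
theorem rpow_neg_quarter_mul {d t : ℝ} (hd : 0 < d) (ht : 0 < t) :
    ((d * t ^ 2)⁻¹) ^ (-(1 / 4) : ℝ) * (√(d * t))⁻¹ = (√√d)⁻¹ := by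
  have hy : 0 < d * t ^ 2 := by positivity
  refine (sq_eq_sq₀ (by positivity) (by positivity)).1 ?_
  have h1 := (Real.sqrt_pos.2 hd).ne'
  rw [mul_pow, rpow_neg_quarter_sq hy.le, inv_pow, inv_pow, Real.sq_sqrt (by positivity),
    Real.sq_sqrt (by positivity), Real.sqrt_mul hd.le, Real.sqrt_sq ht.le]
  field_simp
  rw [Real.sq_sqrt hd.le]

namespace BianchiTransform

theorem unitField_eq (h : BianchiTransform ε k U a b c f r N θ N') {z : ℝ × ℝ} (hz : z ∈ U) :
    unitField ε N' z = (((√(|disc a b c z| * r z))⁻¹ : ℝ) : 𝕜) • N' z := by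
  rw [unitField, h.dot_self z hz, RCLike.norm_ofReal, abs_neg, abs_mul,
    abs_of_pos (h.normal.r_pos z hz), real_smul_vec]

variable {R : ℝ × ℝ → Vec ℝ}

theorem contDiffOn_newPosition (h : BianchiTransform ε k U a b c f r N θ N')
    (hR : ContDiffOn ℝ k R U) (C : Vec 𝕜) : ContDiffOn ℝ k (newPosition ε R N N' C) U :=
  ((contDiffOn_ofRealVec hR).add (contDiffOn_cross ε (contDiffOn_ofRealVec
    (h.normal.contDiffOn_N.of_le le_self_add)) h.contDiffOn_normal')).add contDiffOn_const

/-- Here (N'·N')Δ' = −r, and the unit normal is N' divided by √(|Δ|r). -/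
theorem gaussK_eq (hε : ε = 1 ∨ ε = -1) (h : BianchiTransform ε k U a b c f r N θ N')
    (hL : Lelieuvre ε U a b c N R) (hR : ContDiffOn ℝ k R U) (C : Vec 𝕜) {z : ℝ × ℝ} (hz : z ∈ U)
    (hV : vol (N' z) (dx N' z) (dy N' z) ≠ 0) :
    gaussK ε (newPosition ε R N N' C) (unitField ε N') z
      = ((-(|disc a b c z| * r z ^ 2)⁻¹ : ℝ) : 𝕜) := by
  have hd := h.normal.disc_ne z hz
  have hr := h.normal.r_pos z hz
  have h2 : (2 : WithTop ℕ∞) ≤ k := by rw [← one_add_one_eq_two]; exact h.normal.one_add_one_le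
  rw [(h.lelieuvre hL C).gaussK_eq hε h.normal.isOpen ((h.contDiffOn_newPosition hR C).of_le h2)
    (h.contDiffOn_normal'.of_le h.normal.one_le) hz (h.unitField_eq hz)
    (by rw [disc_primed hd]; exact inv_ne_zero hd) hV, h.dot_self z hz, disc_primed hd,
    ← RCLike.ofReal_pow, ← RCLike.ofReal_mul, ← RCLike.ofReal_div, inv_pow,
    Real.sq_sqrt (by positivity)]
  congr 1
  field_simp

theorem distinguished_eq (hε : ε = 1 ∨ ε = -1) (h : BianchiTransform ε k U a b c f r N θ N')
    (hL : Lelieuvre ε U a b c N R) (hR : ContDiffOn ℝ k R U) (C : Vec 𝕜) {z : ℝ × ℝ} (hz : z ∈ U)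
    (hV : vol (N' z) (dx N' z) (dy N' z) ≠ 0) :
    distinguished ε (newPosition ε R N N' C) (unitField ε N') z
      = (√√|disc a b c z|)⁻¹ • N' z := by
  have hd := abs_pos.2 (h.normal.disc_ne z hz)
  have hr := h.normal.r_pos z hz
  rw [distinguished, h.gaussK_eq hε hL hR C hz hV, RCLike.norm_ofReal, abs_neg,
    abs_of_pos (by positivity), h.unitField_eq hz, ← real_smul_vec, smul_smul,
    rpow_neg_quarter_mul hd hr]

end BianchiTransform

end TransformedSurface

/-! ### The Bianchi conditions for the transformed surface. -/

section TransformedSurface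

variable {𝕜 : Type*} [RCLike 𝕜] {ε : ℝ} {k : ℕ∞} {U : Set (ℝ × ℝ)} {a b c f r : ℝ × ℝ → ℝ}
  {N R : ℝ × ℝ → Vec ℝ} {θ : ℝ × ℝ → 𝕜} {N' : ℝ × ℝ → Vec 𝕜}

namespace BianchiTransform

/-- The transformed surface is a Bianchi surface. -/
theorem isBianchiSurface (hε : ε = 1 ∨ ε = -1) (h : BianchiTransform ε k U a b c f r N θ N')
    (hL : Lelieuvre ε U a b c N R) (hR : ContDiffOn ℝ k R U) (C : Vec 𝕜)
    (hV : ∀ z ∈ U, vol (N' z) (dx N' z) (dy N' z) ≠ 0) :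
    IsBianchiSurface ε U (newPosition ε R N N' C) (unitField ε N') := by
  have hU := h.normal.isOpen
  have h1k := h.normal.one_le
  have h11 := h.normal.one_add_one_le
  have h2 : (2 : WithTop ℕ∞) ≤ k := by rwa [one_add_one_eq_two] at h11
  have hd := h.normal.disc_ne
  have hd' : ∀ z ∈ U, disc (primed a b c a) (primed a b c b) (primed a b c c) z ≠ 0 :=
    fun z hz => by rw [disc_primed (hd z hz)]; exact inv_ne_zero (hd z hz)
  have hr := h.normal.r_pos
  have hL' := h.lelieuvre hL C
  have hR' := (h.contDiffOn_newPosition hR C).of_le h2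
  have hN' := h.contDiffOn_normal'.of_le h1k
  have hn := fun z (hz : z ∈ U) => h.unitField_eq hz
  have hpos : ∀ z ∈ U, 0 < |disc a b c z| * r z := fun z hz =>
    mul_pos (abs_pos.2 (hd z hz)) (hr z hz)
  have hl : ∀ z ∈ U, (((√(|disc a b c z| * r z))⁻¹ : ℝ) : 𝕜) ≠ 0 := fun z hz => by
    exact_mod_cast (inv_pos.2 (Real.sqrt_pos.2 (hpos z hz))).ne'
  have hlk : ContDiffOn ℝ k (fun z => (√(|disc a b c z| * r z))⁻¹) U := by
    refine ((contDiffOn_sqrt_abs (h.normal.contDiffOn_disc.mul (h.normal.contDiffOn_r.of_le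
      le_self_add)) fun z hz => mul_ne_zero (hd z hz) (hr z hz).ne').inv fun z hz =>
      (sqrt_abs_pos (mul_ne_zero (hd z hz) (hr z hz).ne')).ne').congr fun z hz => ?_
    change _ = (√|disc a b c z * r z|)⁻¹
    rw [abs_mul, abs_of_pos (hr z hz)]
  have hdk' : ContDiffOn ℝ k (disc (primed a b c a) (primed a b c b) (primed a b c c)) U :=
    contDiffOn_disc h.normal.contDiffOn_primed.1 h.normal.contDiffOn_primed.2.1
      h.normal.contDiffOn_primed.2.2
  have hII := fun z (hz : z ∈ U) => (hL'.second_form hε hU hR' hN' hz (hn z hz)).2.2.2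
  have hVk : ContDiffOn ℝ 1 (fun z => vol (N' z) (dx N' z) (dy N' z)) U :=
    contDiffOn_vol hN' (contDiffOn_dx hU h.contDiffOn_normal' h11)
      (contDiffOn_dy hU h.contDiffOn_normal' h11)
  have hsign : ∀ z ∈ U, ∀ᶠ w in nhds z, Real.sign (disc a b c w) = Real.sign (disc a b c z) :=
    fun z hz => eventually_sign_eq
      (h.normal.contDiffOn_disc.hasGrad hU h1k hz).differentiableAt.continuousAt (hd z hz)
  -- A root of ±det II written without complex square roots: det II' is the square of l·vol(N',
  -- N'_x, N'_y) times the real number Δ', where l = (|Δ|r)^(−1/2).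
  let s : ℝ × ℝ → 𝕜 := fun z => vol (N' z) (dx N' z) (dy N' z) *
    ((√|disc (primed a b c a) (primed a b c b) (primed a b c c) z|
      * (√(|disc a b c z| * r z))⁻¹ : ℝ) : 𝕜)
  have hlV : ∀ z ∈ U, (((√(|disc a b c z| * r z))⁻¹ : ℝ) : 𝕜) * vol (N' z) (dx N' z) (dy N' z) ≠ 0 :=
    fun z hz => mul_ne_zero (hl z hz) (hV z hz)
  have hτ : ∀ z ∈ U, ∀ᶠ w in nhds z,
      s w * (√|disc (primed a b c a) (primed a b c b) (primed a b c c) w| : ℝ)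
        = -(((-Real.sign (disc a b c z) : ℝ) : 𝕜) * ((((√(|disc a b c w| * r w))⁻¹ : ℝ) : 𝕜)
          * vol (N' w) (dx N' w) (dy N' w))
          * (disc (primed a b c a) (primed a b c b) (primed a b c c) w : ℝ)) := fun z hz => by
    filter_upwards [hsign z hz, hU.eventually_mem hz] with w hw hwU
    have e : √|disc (primed a b c a) (primed a b c b) (primed a b c c) w| ^ 2
        = Real.sign (disc a b c z) * disc (primed a b c a) (primed a b c b) (primed a b c c) w := by
      have h0 := hd w hwU
      rw [Real.sq_sqrt (abs_nonneg _), disc_primed h0, abs_inv, ← hw, ← sign_mul_self_eq_abs]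
      have := sign_mul_sign h0
      have h3 : Real.sign (disc a b c w) ≠ 0 := fun h => by simp [h] at this
      field_simp
      rw [sq, this]
    have e := congrArg (fun t : ℝ => (t : 𝕜)) e
    simp only [s]
    push_cast at e ⊢
    linear_combination vol (N' w) (dx N' w) (dy N' w) * ((√(|disc a b c w| * r w) : ℝ) : 𝕜)⁻¹ * e
  -- The scale μ = |Δ|^(1/4) satisfies 𝒩' = N'/μ, and the normalized primed coefficients are the
  -- primed ones times μ², as rescaling requires.
  have hμ0 : ∀ z ∈ U, √√|disc a b c z| ≠ 0 := fun z hz =>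
    (Real.sqrt_pos.2 (sqrt_abs_pos (hd z hz))).ne'
  have hμk : ContDiffOn ℝ 2 (fun z => √√|disc a b c z|) U :=
    ((contDiffOn_sqrt_abs h.normal.contDiffOn_disc hd).sqrt fun z hz =>
      (sqrt_abs_pos (hd z hz)).ne').of_le h2
  have hμ2 : ∀ u : ℝ × ℝ → ℝ, ∀ z ∈ U,
      conformal (primed a b c a) (primed a b c b) (primed a b c c) (primed a b c u) z
        = primed a b c u z * √√|disc a b c z| ^ 2 := fun u z hz => by
    rw [conformal, disc_primed (hd z hz), abs_inv, Real.sqrt_inv, div_inv_eq_mul,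
      Real.sq_sqrt (Real.sqrt_nonneg _)]
  obtain ⟨ha', hb', hc'⟩ := h.normal.contDiffOn_primed
  have hdist := fun z (hz : z ∈ U) => h.distinguished_eq hε hL hR C hz (hV z hz)
  have hvec := fun z (hz : z ∈ U) => div_flux_inv_smul hU (ha'.of_le h1k) (hb'.of_le h1k)
    (hc'.of_le h1k) hμk hμ0 (hμ2 a) (hμ2 b) (hμ2 c) h.selfAdjointEq hz
  -- The scalar function of the vector condition comes from `div_flux_inv_smul`; its last factor μ
  -- converts N' into 𝒩'.
  refine ⟨hR', (((contDiffOn_ofReal (𝕜 := 𝕜) hlk).smul h.contDiffOn_normal').congr fun z hz => hn z hz).of_le h2,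
    fun z hz => ?_, fun z hz => ?_, fun z hz => ?_, fun z hz => ?_, ?_, s, ?_, fun z hz => ?_,
    fun z => (s z)⁻¹ * ((-Real.sign (disc a b c z) : ℝ) : 𝕜) *
      (((√√|disc a b c z| : ℝ) : 𝕜) * primedPotential a b c θ z
        - ((dx (fluxX (primed a b c a) (primed a b c c) fun w => √√|disc a b c w|) z
          + dy (fluxY (primed a b c b) (primed a b c c) fun w => √√|disc a b c w|) z : ℝ) : 𝕜))
      * ((√√|disc a b c z| : ℝ) : 𝕜), fun z hz => ⟨?_, ?_⟩⟩
  · rw [hL'.detI_eq hε hz, h.dot_self z hz]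
    refine mul_ne_zero ?_ (pow_ne_zero 2 (mul_ne_zero ?_ (hV z hz)))
    · exact_mod_cast neg_ne_zero.2 (mul_ne_zero (hd z hz) (hr z hz).ne')
    · exact_mod_cast hd' z hz
  · rw [hn z hz, dot_smul_left, dot_smul_right, h.dot_self z hz, ← RCLike.ofReal_mul,
      ← RCLike.ofReal_mul]
    have h0 : (√(|disc a b c z| * r z))⁻¹ * ((√(|disc a b c z| * r z))⁻¹ * (|disc a b c z| * r z))
        = 1 := by
      have := (Real.sqrt_pos.2 (hpos z hz)).ne'
      rw [← mul_assoc, ← mul_inv, Real.mul_self_sqrt (hpos z hz).le,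
        inv_mul_cancel₀ (hpos z hz).ne']
    -- The normal has square −1 where Δ > 0 and +1 where Δ < 0.
    rcases abs_choice (disc a b c z) with he | he <;> rw [he] at h0 ⊢
    · right
      rw [mul_neg, mul_neg, h0]; simp
    · left
      rw [← neg_mul, h0]; simp
  · rw [hn z hz, dot_smul_left, dot_smul_left, (hL'.normal hε hz).1, (hL'.normal hε hz).2]
    simp
  · rw [hII z hz]
    exact mul_ne_zero (pow_ne_zero 2 (hlV z hz)) (by exact_mod_cast hd' z hz)
  · refine ContDiffOn.congr ?_ fun z hz => h.gaussK_eq hε hL hR C hz (hV z hz)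
    have hab : ContDiffOn ℝ k (fun z => |disc a b c z| * r z ^ 2) U := by
      refine (((contDiffOn_sqrt_abs h.normal.contDiffOn_disc hd).pow 2).mul
        ((h.normal.contDiffOn_r.of_le le_self_add).pow 2)).congr fun z hz => ?_
      rw [Real.sq_sqrt (abs_nonneg _)]
    exact contDiffOn_ofReal ((hab.inv fun z hz => mul_ne_zero (abs_ne_zero.2 (hd z hz))
      (pow_ne_zero 2 (hr z hz).ne')).neg.of_le h2)
  · exact hVk.mul (contDiffOn_ofReal (((contDiffOn_sqrt_abs hdk' hd').mul hlk).of_le h1k))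
  · rw [hII z hz]
    simp only [s]
    rw [RCLike.ofReal_mul, mul_pow, mul_pow, ← RCLike.ofReal_pow, Real.sq_sqrt (abs_nonneg _)]
    rcases abs_choice (disc (primed a b c a) (primed a b c b) (primed a b c c) z) with he | he <;>
      rw [he]
    · left; ring
    · right; push_cast; ring
  · obtain ⟨hX, hY, e⟩ := hvec z hz
    rw [hL'.starDStarD_eq hε hU hR' hN' hn hd' hlV hz (hτ z hz)
      (by filter_upwards [hU.eventually_mem hz] with w hw using hdist w hw) hX hY, e, hdist z hz,
      real_smul_vec, smul_smul, smul_smul, smul_smul]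
    congr 1
    have : ((√√|disc a b c z| : ℝ) : 𝕜) ≠ 0 := by exact_mod_cast hμ0 z hz
    push_cast
    field_simp
  · obtain ⟨-, hX, hY, e⟩ := h.selfAdjointEq_dot_self z hz
    -- As Δ' = 1/Δ, the product 𝒩'·𝒩' equals (N'·N')√|Δ'|, for which the scalar equation is known.
    rw [hL'.starDStarD_eq hε hU hR' hN' hn hd' hlV hz (hτ z hz) (u' := fun z =>
      dot ε (N' z) (N' z) *
        ((√|disc (primed a b c a) (primed a b c b) (primed a b c c) z| : ℝ) : 𝕜))
      (by
        filter_upwards [hU.eventually_mem hz] with w hw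
        rw [hdist w hw, real_smul_vec, dot_smul_left, dot_smul_right, disc_primed (hd w hw),
          abs_inv, Real.sqrt_inv, ← mul_assoc, ← RCLike.ofReal_mul, ← mul_inv,
          Real.mul_self_sqrt (Real.sqrt_nonneg _), mul_comm]) hX hY]
    refine (congrArg (fun t : 𝕜 => (s z)⁻¹ • ((-Real.sign (disc a b c z) : ℝ) : 𝕜) • t) e).trans ?_
    simp

end BianchiTransform

end TransformedSurface

end Bianchi

/-! ### The main theorem. -/

theorem mainTheorem1 {𝕜 : Type*} [RCLike 𝕜] (ε : ℝ) (hε : ε = 1 ∨ ε = -1)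
    (k : ℕ∞) (hk : 2 ≤ k) (D : Set (ℝ × ℝ)) (hD : IsOpen D)
    (R N : ℝ × ℝ → Vec ℝ) (n : Fin 3 → ℝ × ℝ → Vec ℝ) (P Q : Fin 3 → Fin 3 → ℝ × ℝ → ℝ)
    (r : ℝ × ℝ → ℝ)
    (hR : ContDiffOn ℝ ((k : WithTop ℕ∞) + 1) R D)
    (hN : ContDiffOn ℝ ((k : WithTop ℕ∞) + 1) N D)
    (hn : ∀ A, ContDiffOn ℝ ((k : WithTop ℕ∞) + 1) (n A) D)
    -- a Bianchi surface with unit normal `n 0`, and a normal field `N` with `r = N · N > 0`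
    (hBianchi : IsBianchiSurface ε D R (n 0))
    (hr : ∀ z ∈ D, r z = dot ε (N z) (N z))
    (hr_pos : ∀ z ∈ D, 0 < r z)
    (hn0 : ∀ z ∈ D, n 0 z = (√(r z))⁻¹ • N z)
    -- orthonormal frame and rotation coefficients
    (hframe : ∀ z ∈ D, ∀ A B, dot ε (n A z) (n B z) = if A = B then (if A = 0 then 1 else ε) else 0)
    (hP : ∀ z ∈ D, ∀ A, dx (n A) z = ∑ B, P A B z • n B z)
    (hQ : ∀ z ∈ D, ∀ A, dy (n A) z = ∑ B, Q A B z • n B z) :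
    -- the Lelieuvre coefficients exist
    (∃ a b c : ℝ × ℝ → ℝ, Lelieuvre ε D a b c N R) ∧
    ∀ a b c : ℝ × ℝ → ℝ, Lelieuvre ε D a b c N R →
      -- they are regular, determine the curvature, and `N` solves the self-adjoint equation
      (∀ a₁ b₁ c₁ : ℝ × ℝ → ℝ, Lelieuvre ε D a₁ b₁ c₁ N R →
        Set.EqOn a₁ a D ∧ Set.EqOn b₁ b D ∧ Set.EqOn c₁ c D) ∧
      ContDiffOn ℝ k a D ∧ ContDiffOn ℝ k b D ∧ ContDiffOn ℝ k c D ∧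
      (∀ z ∈ D, disc a b c z ≠ 0 ∧ gaussK ε R (n 0) z = 1 / (r z ^ 2 * disc a b c z)) ∧
      ∃ f : ℝ × ℝ → ℝ, SelfAdjointEq D a b c f N ∧
      ∀ U : Set (ℝ × ℝ), IsOpen U → U ⊆ D →
        -- the system for `p` is compatible, its solution depending on one constant `κ`
        (IsSimplyConnected U → ∀ z₀ ∈ U, ∀ κ : 𝕜,
          ∃ p : ℝ × ℝ → 𝕜, ContDiffOn ℝ k p U ∧ PSystem U a b c r p ∧ p z₀ = κ ∧
            ∀ p₁ : ℝ × ℝ → 𝕜, PSystem U a b c r p₁ → p₁ z₀ = κ → Set.EqOn p₁ p U) ∧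
        ∀ p : ℝ × ℝ → 𝕜, PSystem U a b c r p →
          (∀ z ∈ U, p z ≠ 0 ∧ p z ^ 2 + (r z : 𝕜) ^ 2 * (disc a b c z : 𝕜) ≠ 0) →
          -- the linear system is compatible
          (IsSimplyConnected U → ∀ z₀ ∈ U, ∀ ξ : Fin 3 → 𝕜,
            ∃ x : Fin 3 → ℝ × ℝ → 𝕜, (∀ A, ContDiffOn ℝ k (x A) U) ∧
              LinearSystem U a b c r P Q p x ∧ (∀ A, x A z₀ = ξ A) ∧
              ∀ x₁ : Fin 3 → ℝ × ℝ → 𝕜, LinearSystem U a b c r P Q p x₁ →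
                (∀ A, x₁ A z₀ = ξ A) → ∀ A, Set.EqOn (x₁ A) (x A) U) ∧
          ∀ x : Fin 3 → ℝ × ℝ → 𝕜, LinearSystem U a b c r P Q p x →
            -- the constraint can be imposed by the choice of the initial values
            (IsPreconnected U → ∀ z ∈ U, ∀ w ∈ U,
              constraint ε a b c r p x z = constraint ε a b c r p x w) ∧
            ((∀ z ∈ U, constraint ε a b c r p x z = 0) → (∀ z ∈ U, x 0 z ≠ 0) →
              ∀ (θ : ℝ × ℝ → 𝕜) (N' : ℝ × ℝ → Vec 𝕜),
                θ = theta r p x → N' = newNormal r p x n →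
                -- `N'` is an extended Moutard transform of `N`
                ContDiffOn ℝ k N' U ∧
                SelfAdjointEq U a b c (fun z => (f z : 𝕜)) θ ∧
                Moutard U a b c θ (fun z => ofRealVec 𝕜 (N z)) N' ∧
                SelfAdjointEq U (primed a b c a) (primed a b c b) (primed a b c c)
                  (primedPotential a b c θ) N' ∧
                (∀ z ∈ U, dot ε (ofRealVec 𝕜 (N z)) (N' z) = p z ∧
                  dot ε (N' z) (N' z) = ((-(disc a b c z * r z) : ℝ) : 𝕜)) ∧
                -- `N'` satisfies the second normal field equation of Bianchi surfaces
                SelfAdjointEq U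
                  (conformal (primed a b c a) (primed a b c b) (primed a b c c) (primed a b c a))
                  (conformal (primed a b c a) (primed a b c b) (primed a b c c) (primed a b c b))
                  (conformal (primed a b c a) (primed a b c b) (primed a b c c) (primed a b c c))
                  (fun _ => (0 : 𝕜))
                  (fun z => dot ε (N' z) (N' z) *
                    ((√|disc (primed a b c a) (primed a b c b) (primed a b c c) z| : ℝ) : 𝕜)) ∧
                -- the surfaces with normal field `N'` are `R + N × N' + const`
                (∀ C : Vec 𝕜, Lelieuvre ε U (primed a b c a) (primed a b c b) (primed a b c c) N'
                  (newPosition ε R N N' C)) ∧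
                (IsPreconnected U → ∀ R' : ℝ × ℝ → Vec 𝕜,
                  Lelieuvre ε U (primed a b c a) (primed a b c b) (primed a b c c) N' R' →
                    ∃ C : Vec 𝕜, Set.EqOn R' (newPosition ε R N N' C) U) ∧
                -- they are Bianchi surfaces with `K' = -sgn(Δ) K` wherever they are regular
                ∀ C : Vec 𝕜,
                  IsBianchiSurface ε {z ∈ U | vol (N' z) (dx N' z) (dy N' z) ≠ 0}
                    (newPosition ε R N N' C) (unitField ε N') ∧
                  ∀ z ∈ U, vol (N' z) (dx N' z) (dy N' z) ≠ 0 →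
                    gaussK ε (newPosition ε R N N' C) (unitField ε N') z =
                      ((-(Real.sign (disc a b c z)) * gaussK ε R (n 0) z : ℝ) : 𝕜)) := by
  have hk2 : (2 : WithTop ℕ∞) ≤ k := (WithTop.coe_le_coe.2 hk : ((2 : ℕ∞) : WithTop ℕ∞) ≤ k)
  have hk1 : (1 : WithTop ℕ∞) ≤ k := one_le_two.trans hk2
  have hR2 := hR.of_le (hk2.trans le_self_add)
  have hN1 := hN.of_le (hk1.trans le_self_add)
  have hnN : ∀ z ∈ D, ∃ l : ℝ, l ≠ 0 ∧ n 0 z = l • N z := fun z hz =>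
    ⟨_, (inv_pos.2 (Real.sqrt_pos.2 (hr_pos z hz))).ne', hn0 z hz⟩
  have hV := fun z hz => (hBianchi.vol_ne_zero hε hD hR2 hN1 hnN (z := z) hz).1
  refine ⟨hBianchi.exists_lelieuvre hε hD hR2 hN1 hnN, fun a b c hL => ?_⟩
  obtain ⟨ea, eb, ec⟩ := hL.eq_div hε hV
  obtain ⟨ha, hb, hc⟩ := hL.contDiffOn hε hD hV hR hN
  have hd : ∀ z ∈ D, disc a b c z ≠ 0 := fun z hz =>
    hBianchi.disc_ne_zero hε hD hL hN1 hz (hn0 z hz)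
  have hK : ∀ z ∈ D, gaussK ε R (n 0) z = 1 / (r z ^ 2 * disc a b c z) := fun z hz => by
    have e := hL.gaussK_eq hε hD hR2 hN1 hz (hn0 z hz) (hd z hz) (hV z hz)
    rw [e, ← hr z hz, inv_pow, Real.sq_sqrt (hr_pos z hz).le]
    have h1 := (hr_pos z hz).ne'
    have h2 := hd z hz
    simp only [RCLike.ofReal_real_eq_id, id_eq]
    field_simp
  obtain ⟨f, hf⟩ := hL.selfAdjointEq hε hD (fun z hz => by rw [← hr z hz]; exact (hr_pos z hz).ne')
    (ha.of_le hk1) (hb.of_le hk1) (hc.of_le hk1) hR2 (hN.of_le (hk2.trans le_self_add))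
  refine ⟨fun a₁ b₁ c₁ hL₁ => ?_, ha, hb, hc, fun z hz => ⟨hd z hz, hK z hz⟩, f, hf,
    fun U hU hUD => ?_⟩
  · obtain ⟨ea₁, eb₁, ec₁⟩ := hL₁.eq_div hε hV
    exact ⟨fun z hz => (ea₁ z hz).trans (ea z hz).symm, fun z hz => (eb₁ z hz).trans (eb z hz).symm,
      fun z hz => (ec₁ z hz).trans (ec z hz).symm⟩
  have hBN : BianchiNormal ε k U a b c f r N := BianchiNormal.mono
    { isOpen := hD
      two_le := hk
      contDiffOn_a := ha
      contDiffOn_b := hb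
      contDiffOn_c := hc
      contDiffOn_N := hN
      eqN := hf
      r_eq := hr
      r_pos := hr_pos
      disc_ne := hd
      div_flux := fun z hz => hBianchi.div_flux_eq_zero hε hD hL hN1 hr hr_pos hn0 hV (ha.of_le hk2)
        (hb.of_le hk2) (hc.of_le hk2)
        (((contDiffOn_dot ε hN hN).congr hr).of_le (hk2.trans le_self_add)) hd hz } hU hUD
  have hF : AdaptedFrame ε k U r N n P Q := AdaptedFrame.mono ⟨hn, hn0, hframe, hP, hQ⟩ hUD
  have hLU : Lelieuvre ε U a b c N R := fun z hz => hL z (hUD hz)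
  have hRU : ContDiffOn ℝ k R U := (hR.of_le le_self_add).mono hUD
  refine ⟨fun hUc z₀ hz₀ κ => hBN.existsUnique_p hUc hz₀ κ, fun p hp hp0 => ⟨fun hUc z₀ hz₀ ξ =>
    existsUnique_linearSystem hε hBN hF hp hp0 hUc hz₀ ξ, fun x hx => ⟨fun hUc z hz w hw =>
    constraint_const hε hBN hF hp hp0 hx hUc hz hw, fun h0 hx0 θ N' hθ hN' => ?_⟩⟩⟩
  subst hθ hN'
  have hM := hBN.moutardData hp hp0
  -- From here on X is the vector with frame components x, so θ = X·N/p, N' = X/θ, and the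
  -- constraint is the vanishing of the first integral.
  have hX := (linearSystem_iff hε hBN hF hp0 fun z hz => (hx z hz).1).1 hx
  have hθ := fun z hz => (thetaOf_frameVec (p := p) (x := x) hBN hF (z := z) hz).symm
  have hnew := fun z hz => newNormal_eq (n := n) hBN (fun z hz => (hp0 z hz).1) hx0 (z := z) hz
  obtain ⟨hT, hNN⟩ := hBN.bianchiTransform hM hX hθ (fun z hz => (hnew z hz).1)
    (fun z hz => (hnew z hz).2) (fun z hz => (constraint_eq hBN hF hz).symm.trans (h0 z hz))
  refine ⟨hT.contDiffOn_normal', (hBN.selfAdjointEq_theta hM hX hθ).2, hT.moutard, hT.selfAdjointEq,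
    fun z hz => ⟨hNN z hz, hT.dot_self z hz⟩, hT.selfAdjointEq_dot_self, hT.lelieuvre hLU,
    fun hUc R' hR' => ?_, fun C => ⟨?_, fun z hz hVz => ?_⟩⟩
  · obtain ⟨C, hC⟩ := (hT.lelieuvre hLU 0).exists_eqOn_add hU hUc hR'
    exact ⟨C, fun z hz => (hC hz).trans (by simp [newPosition])⟩
  · have hW : IsOpen {z ∈ U | vol (newNormal r p x n z) (dx (newNormal r p x n) z)
        (dy (newNormal r p x n) z) ≠ 0} :=
      (contDiffOn_vol (hT.contDiffOn_normal'.of_le hk1)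
        (contDiffOn_dx hU hT.contDiffOn_normal' hBN.one_add_one_le)
        (contDiffOn_dy hU hT.contDiffOn_normal' hBN.one_add_one_le)).continuousOn.isOpen_inter_preimage
        hU isOpen_compl_singleton
    have hWU : {z ∈ U | vol (newNormal r p x n z) (dx (newNormal r p x n) z)
        (dy (newNormal r p x n) z) ≠ 0} ⊆ U := fun z hz => hz.1
    exact (hT.mono hW hWU).isBianchiSurface hε (fun z hz => hLU z (hWU hz)) (hRU.mono hWU) C
      fun z hz => hz.2
  · rw [hT.gaussK_eq hε hLU hRU C hz hVz, hK z (hUD hz)]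
    congr 1
    have h1 := hBN.r_pos z hz
    have h2 := hBN.disc_ne z hz
    have h3 := sign_mul_sign h2
    have h4 : Real.sign (disc a b c z) ≠ 0 := fun h => by simp [h] at h3
    -- It remains to compare −1/(|Δ|r²) with −sgn Δ/(r²Δ).
    rw [← sign_mul_self_eq_abs]
    field_simp
    rw [sq, h3]
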